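/- Let $M$ be a metric space, $V=\{v_1,\dots,v_n\}\subseteq M$ a set of $n$ distinct points, and $G=(V,E)$ an undirected graph in which every edge $uv$ has weight $d_M(u,v)$. Let $d_G(u,v)\in[0,\infty]$ denote the length of a shortest path between $u$ and $v$ in $G$ ($\infty$ if there is none). The *dilation* of $G$ is the smallest $t\in[1,\infty]$ such that $d_G(u,v)\le t\cdot d_M(u,v)$ for all distinct $u,v\in V$ (so it is $\infty$ exactly if $G$ is disconnected). For $1\le k\le n^2$ let $t^*=t^*(G,k)\in[1,\infty]$ be the minimum dilation of $(V,E\cup S)$ over all sets $S\subseteq V\times V$ with $|S|=k$, where each pair in $S$ is read as an undirected edge (and pairs $(v,v)$ have no effect). **Theorem.** For every fixed $\varepsilon>0$ there is an algorithm for the real RAM (unit-cost exact arithmetic $+,-,\cdot,/$ and comparisons of real numbers, together with words of $O(\log n)$ bits for counting and addressing; no floor function, logarithms or roots on reals) that, given $n$, an integer $k$ with $1\le k\le n^2$, the distance matrix $(d_M(v_i,v_j))_{i,j}$ and the adjacency matrix of $G$, halts and computes a $(1+\varepsilon)(k+1)$-approximation of $t^*$: it outputs a set $S\subseteq V\times V$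 with $|S|=k$ and a value $t\in[1,\infty]$ such that $$t^*\;\le\;\text{dilation of }(V,E\cup S)\;\le\; t\;\le\;(1+\varepsilon)(k+1)\,t^* .$$ Its running time is $O(n^3\log n)$: there is a constant $C$, depending only on $\varepsilon$, such that it makes at most $C\,n^3\log n$ steps whenever $n\ge 2$. -/

import Mathlib

/-! ## Metric graphs and dilation

The vertices are `0, …, n - 1`; vertex `i` is the point `x i` of the metric space `M`. -/

open scoped ENNReal

namespace MetricGraph

variable {V M : Type*} [MetricSpace M]

/-- The total weight of a walk; an edge `{u, v}` weighs the distance of its end points in `M`. -/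
noncomputable def walkWeight (x : V → M) {G : SimpleGraph V} {u v : V} (p : G.Walk u v) : ℝ≥0∞ :=
  (p.darts.map fun e => edist (x e.fst) (x e.snd)).sum

/-- The shortest path distance in the weighted graph `G` (`∞` if there is no path). -/
noncomputable def graphDist (x : V → M) (G : SimpleGraph V) (u v : V) : ℝ≥0∞ :=
  ⨅ p : G.Walk u v, walkWeight x p

/-- `G` is a `t`-spanner: graph distances exceed the metric distances at most by the factor `t`. -/
def IsSpanner (x : V → M) (G : SimpleGraph V) (t : ℝ≥0∞) : Prop :=
  ∀ u v : V, graphDist x G u v ≤ t * edist (x u) (x v)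

/-- The dilation of `G`: the smallest `t ≥ 1` for which `G` is a `t`-spanner
(`∞` if `G` is disconnected). -/
noncomputable def dilation (x : V → M) (G : SimpleGraph V) : ℝ≥0∞ :=
  sInf {t : ℝ≥0∞ | 1 ≤ t ∧ IsSpanner x G t}

/-- The undirected graph `(V, E ∪ S)`. -/
def addEdges (G : SimpleGraph V) (S : Finset (V × V)) : SimpleGraph V :=
  G ⊔ SimpleGraph.fromRel fun u v => (u, v) ∈ S

/-- The minimum dilation `t*` of `(V, E ∪ S)` over all sets `S ⊆ V × V` with `|S| = k`. -/
noncomputable def minDilation (x : V → M) (G : SimpleGraph V) (k : ℕ) : ℝ≥0∞ :=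
  ⨅ (S : Finset (V × V)) (_ : S.card = k), dilation x (addEdges G S)

end MetricGraph

/-! ## The real RAM

A random access machine with two kinds of cells: words (natural numbers below a bound `B`, used
for counting and addressing) and real numbers (exact arithmetic and comparisons, unit cost). There
is no way to turn a real number into a word other than by branching on comparisons: no floor,
no logarithm, no roots. -/

namespace RealRAM

/-- Registers and arrays (named by natural numbers; a program mentions finitely many of them). -/
structure State where
  /-- word registers -/
  w : ℕ → ℕ
  /-- real registers -/
  r : ℕ → ℝ
  /-- word arrays -/
  wa : ℕ → ℕ → ℕ
  /-- real arrays -/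
  ra : ℕ → ℕ → ℝ

/-- Elementary instructions; `d` is the destination, `a` and `b` are operand registers, `A` is the
name of an array. -/
inductive Instr where
  /-- word constant -/
  | wconst (d c : ℕ)
  | wmov (d a : ℕ)
  | wadd (d a b : ℕ)
  /-- truncated subtraction of words -/
  | wsub (d a b : ℕ)
  | wmul (d a b : ℕ)
  /-- quotient of words, rounded down -/
  | wdiv (d a b : ℕ)
  /-- word register `d` := cell of the word array `A` at the address in word register `a` -/
  | wload (d A a : ℕ)
  /-- cell of the word array `A` at the address in word register `a` := word register `b` -/
  | wstore (A a b : ℕ)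
  /-- real constant, a natural number -/
  | rconst (d c : ℕ)
  /-- real register `d` := word register `a` -/
  | rofw (d a : ℕ)
  | rmov (d a : ℕ)
  | radd (d a b : ℕ)
  | rsub (d a b : ℕ)
  | rmul (d a b : ℕ)
  | rdiv (d a b : ℕ)
  /-- real register `d` := cell of the real array `A` at the address in word register `a` -/
  | rload (d A a : ℕ)
  /-- cell of the real array `A` at the address in word register `a` := real register `b` -/
  | rstore (A a b : ℕ)

/-- Comparisons of two registers. -/
inductive Test where
  | wlt (a b : ℕ)
  | weq (a b : ℕ)
  | rlt (a b : ℕ)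

/-- Programs. -/
inductive Prog where
  | skip
  | instr (I : Instr)
  | seq (p q : Prog)
  | ite (b : Test) (p q : Prog)
  | while (b : Test) (p : Prog)

/-- Write a word to a register; the machine is stuck if the word is too large. -/
def State.setW (B : ℕ) (s : State) (d v : ℕ) : Option State :=
  if v < B then some { s with w := Function.update s.w d v } else none

/-- Write a real number to a register. -/
def State.setR (s : State) (d : ℕ) (v : ℝ) : State :=
  { s with r := Function.update s.r d v }

/-- The effect of an instruction on a machine with words below `B`; `none` means that the machine
is stuck (word overflow or division by zero). -/
noncomputable def Instr.apply (B : ℕ) (s : State) : Instr → Option State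
  | wconst d c => s.setW B d c
  | wmov d a => s.setW B d (s.w a)
  | wadd d a b => s.setW B d (s.w a + s.w b)
  | wsub d a b => s.setW B d (s.w a - s.w b)
  | wmul d a b => s.setW B d (s.w a * s.w b)
  | wdiv d a b => if s.w b = 0 then none else s.setW B d (s.w a / s.w b)
  | wload d A a => s.setW B d (s.wa A (s.w a))
  | wstore A a b =>
      some { s with wa := Function.update s.wa A (Function.update (s.wa A) (s.w a) (s.w b)) }
  | rconst d c => some (s.setR d (c : ℝ))
  | rofw d a => some (s.setR d (s.w a : ℝ))
  | rmov d a => some (s.setR d (s.r a))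
  | radd d a b => some (s.setR d (s.r a + s.r b))
  | rsub d a b => some (s.setR d (s.r a - s.r b))
  | rmul d a b => some (s.setR d (s.r a * s.r b))
  | rdiv d a b => if s.r b = 0 then none else some (s.setR d (s.r a / s.r b))
  | rload d A a => some (s.setR d (s.ra A (s.w a)))
  | rstore A a b =>
      some { s with ra := Function.update s.ra A (Function.update (s.ra A) (s.w a) (s.r b)) }

/-- The truth value of a comparison. -/
def Test.Holds (s : State) : Test → Prop
  | wlt a b => s.w a < s.w b
  | weq a b => s.w a = s.w b
  | rlt a b => s.r a < s.r b

/-- `Exec B p s T s'`: on a machine with words below `B`, the program `p` started in state `s`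
halts in state `s'` after exactly `T` steps. Every instruction and every evaluation of a
comparison is one step. -/
inductive Exec (B : ℕ) : Prog → State → ℕ → State → Prop where
  | skip (s : State) : Exec B .skip s 1 s
  | instr {I : Instr} {s s' : State} (h : I.apply B s = some s') : Exec B (.instr I) s 1 s'
  | seq {p q : Prog} {s s' s'' : State} {T T' : ℕ}
      (hp : Exec B p s T s') (hq : Exec B q s' T' s'') : Exec B (.seq p q) s (T + T') s''
  | ite_true {b : Test} {p q : Prog} {s s' : State} {T : ℕ} (hb : b.Holds s)
      (hp : Exec B p s T s') : Exec B (.ite b p q) s (T + 1) s'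
  | ite_false {b : Test} {p q : Prog} {s s' : State} {T : ℕ} (hb : ¬ b.Holds s)
      (hq : Exec B q s T s') : Exec B (.ite b p q) s (T + 1) s'
  | while_true {b : Test} {p : Prog} {s s' s'' : State} {T T' : ℕ} (hb : b.Holds s)
      (hp : Exec B p s T s') (hw : Exec B (.while b p) s' T' s'') :
      Exec B (.while b p) s (T + T' + 1) s''
  | while_false {b : Test} {p : Prog} {s : State} (hb : ¬ b.Holds s) :
      Exec B (.while b p) s 1 s

/-- The contents of an array that stores an `n × n` matrix row by row: entry `(i, j)` is in cell
`i * n + j`, and all further cells are `0`. -/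
def matrixCells {α : Type*} [Zero α] (n : ℕ) (f : Fin n → Fin n → α) (c : ℕ) : α :=
  if h : c < n * n then
    f ⟨c / n, Nat.div_lt_of_lt_mul h⟩ ⟨c % n, Nat.mod_lt c (Nat.pos_of_mul_pos_left (c.zero_le.trans_lt h))⟩
  else 0

open Classical in
/-- The initial state for the input `(x, G, k)`: word registers `0` and `1` hold `n` and `k`, word
array `0` the adjacency matrix of `G`, real array `0` the distance matrix; all else is `0`. -/
noncomputable def inputState {n : ℕ} {M : Type*} [MetricSpace M] (x : Fin n → M)
    (G : SimpleGraph (Fin n)) (k : ℕ) : State where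
  w := fun a => if a = 0 then n else if a = 1 then k else 0
  r := fun _ => 0
  wa := fun A => if A = 0 then matrixCells n (fun i j => if G.Adj i j then 1 else 0) else fun _ => 0
  ra := fun A => if A = 0 then matrixCells n (fun i j => dist (x i) (x j)) else fun _ => 0

/-- The set of vertex pairs that a final state represents: word array `1` holds its incidence
matrix. -/
def outputEdges (n : ℕ) (s : State) : Finset (Fin n × Fin n) :=
  Finset.univ.filter fun e => s.wa 1 (e.1 * n + e.2) ≠ 0

/-- The number in `[0, ∞]` that a final state represents: `∞` if word register `2` is `0`, and the
contents of real register `0` otherwise. -/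
noncomputable def outputValue (s : State) : ℝ≥0∞ :=
  if s.w 2 = 0 then ⊤ else ENNReal.ofReal (s.r 0)

end RealRAM

/-! Fix a threshold τ and repeatedly add a shortest pair whose current graph distance exceeds τ
times its metric distance. If this stops after at most k pairs, the result is a τ-spanner. The heart
of the proof is the converse bound (`IsGreedySeq.lt_of_walks`, `IsGreedySeq.le_minDilation`): if k +
1 pairs can be added in this way, then τ ≤ (k + 1) t*.

For this bound, suppose S with |S| ≤ k has dilation about t. Each greedy pair is joined in G ∪ S by
a walk at most t times its length. The traces of these k + 1 walks on S are vectors over the field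
with two elements in dimension at most k, so some nonempty set of walks sums to a chain that avoids
S. This chain lies in G and its boundary is that of the corresponding greedy pairs. Together with
all of these pairs but the last, say of length L, it carries a walk between the ends of the last
pair, which must be longer than τL. A crude count gives a bound slightly worse than (k + 1)t. The
exact factor comes from the fact that each walk spends at least the fraction k/(k + 1) of the length
of its pair on S, and this portion cancels.

One greedy run takes cubic time: Floyd-Warshall once, then at most n + 1 rounds of quadratic cost,
since a distance matrix absorbs a new edge in quadratic time. It remains to reach a good threshold
in O(log n) runs, although t* ranges over an unbounded interval and the machine has no logarithms.
Greedy with threshold n on the empty graph adds at most n pairs (`IsGreedySeq.length_le`), and their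
lengths, the scales, approximate all distances up to polynomial factors. A finite t* is, again up to
a polynomial factor, a quotient of two distances and hence of two scales
(`IsGreedySeq.exists_ratio`). The at most n² quotients, scaled up by n⁷, are sorted in cubic time
and searched by bisection. This yields a successful threshold at most n¹² t*, which is then lowered
by the constant factor q/(q + 1) until greedy fails; that takes O(q log n) runs. The last success r
then satisfies r · q/(q + 1) ≤ (k + 1) t*.

If k ≥ n, the threshold n itself succeeds and is good enough. Finally, arbitrary pairs are added to
reach exactly k. -/

set_option linter.unusedSectionVars false

/-! ### Walk lengths and shortest path distances -/

namespace MetricGraph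

variable {V M : Type*} [MetricSpace M]

/-- The length of an unordered pair of vertices. -/
noncomputable def edgeLen (x : V → M) : Sym2 V → ℝ :=
  Sym2.lift ⟨fun a b => dist (x a) (x b), fun a b => dist_comm (x a) (x b)⟩

@[simp] theorem edgeLen_mk (x : V → M) (a b : V) : edgeLen x s(a, b) = dist (x a) (x b) := rfl

theorem edgeLen_nonneg (x : V → M) (e : Sym2 V) : 0 ≤ edgeLen x e := by
  induction e with | _ a b => exact dist_nonneg

/-- The sum of a weight function over the edges of a walk. -/
def walkSum (w : Sym2 V → ℝ) {G : SimpleGraph V} {u v : V} (p : G.Walk u v) : ℝ :=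
  (p.edges.map w).sum

@[simp] theorem walkSum_nil (w : Sym2 V → ℝ) {G : SimpleGraph V} {u : V} :
    walkSum w (SimpleGraph.Walk.nil : G.Walk u u) = 0 := by simp [walkSum]

@[simp] theorem walkSum_cons (w : Sym2 V → ℝ) {G : SimpleGraph V} {u v z : V} (h : G.Adj u v)
    (p : G.Walk v z) : walkSum w (SimpleGraph.Walk.cons h p) = w s(u, v) + walkSum w p := by
  simp [walkSum]

theorem walkSum_nonneg {w : Sym2 V → ℝ} (hw : ∀ e, 0 ≤ w e) {G : SimpleGraph V} {u v : V}
    (p : G.Walk u v) : 0 ≤ walkSum w p := by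
  induction p with
  | nil => simp
  | cons h p ih => rw [walkSum_cons]; exact add_nonneg (hw _) ih

theorem walkWeight_eq (x : V → M) {G : SimpleGraph V} {u v : V} (p : G.Walk u v) :
    walkWeight x p = ENNReal.ofReal (walkSum (edgeLen x) p) := by
  induction p with
  | nil => simp [walkWeight]
  | cons h p ih =>
    rw [walkSum_cons, ENNReal.ofReal_add (edgeLen_nonneg _ _)
      (walkSum_nonneg (edgeLen_nonneg x) _), ← ih]
    simp [walkWeight, edist_dist]

theorem graphDist_le (x : V → M) {G : SimpleGraph V} {u v : V} (p : G.Walk u v) :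
    graphDist x G u v ≤ ENNReal.ofReal (walkSum (edgeLen x) p) := by
  rw [← walkWeight_eq]; exact iInf_le _ p

theorem graphDist_self (x : V → M) (G : SimpleGraph V) (u : V) : graphDist x G u u = 0 := by
  simpa using graphDist_le x (SimpleGraph.Walk.nil : G.Walk u u)

theorem graphDist_triangle (x : V → M) (G : SimpleGraph V) (u v z : V) :
    graphDist x G u z ≤ graphDist x G u v + graphDist x G v z := by
  unfold graphDist
  rw [ENNReal.iInf_add]
  refine le_iInf fun p => ?_
  rw [ENNReal.add_iInf]
  refine le_iInf fun q => (iInf_le _ (p.append q)).trans ?_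
  simp [walkWeight]

theorem graphDist_comm (x : V → M) (G : SimpleGraph V) (u v : V) :
    graphDist x G u v = graphDist x G v u := by
  have key : ∀ u v, graphDist x G u v ≤ graphDist x G v u := fun u v => by
    refine le_iInf fun p => (graphDist_le x p.reverse).trans ?_
    rw [walkWeight_eq]
    simp [walkSum, List.sum_reverse]
  exact le_antisymm (key _ _) (key _ _)

theorem graphDist_adj (x : V → M) {G : SimpleGraph V} {u v : V} (h : G.Adj u v) :
    graphDist x G u v ≤ ENNReal.ofReal (dist (x u) (x v)) := by
  simpa using graphDist_le x h.toWalk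

theorem graphDist_anti (x : V → M) {G H : SimpleGraph V} (h : G ≤ H) (u v : V) :
    graphDist x H u v ≤ graphDist x G u v := by
  refine le_iInf fun p => (graphDist_le x (p.mapLe h)).trans ?_
  rw [walkWeight_eq]
  simp [walkSum]

theorem edist_le_graphDist (x : V → M) (G : SimpleGraph V) (u v : V) :
    edist (x u) (x v) ≤ graphDist x G u v := by
  refine le_iInf fun p => ?_
  induction p with
  | nil => simp
  | @cons a b c h p ih =>
    refine (edist_triangle _ (x b) _).trans ?_
    simp only [walkWeight, SimpleGraph.Walk.darts_cons, List.map_cons, List.sum_cons]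
    gcongr
    exact ih

/-- The distance is an infimum over infinitely many walks; the strict inequality avoids showing that
it is attained. The factors 2 and the slack t' > t further on serve to produce such strict
inequalities. -/
theorem exists_walk_of_graphDist_lt (x : V → M) {G : SimpleGraph V} {u v : V} {r : ℝ}
    (h : graphDist x G u v < ENNReal.ofReal r) :
    ∃ p : G.Walk u v, walkSum (edgeLen x) p < r := by
  obtain ⟨p, hp⟩ := iInf_lt_iff.1 h
  rw [walkWeight_eq] at hp
  exact ⟨p, (ENNReal.ofReal_lt_ofReal_iff_of_nonneg (walkSum_nonneg (edgeLen_nonneg x) _)).1 hp⟩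

/-! ### Chains modulo two -/

section Chain

variable [DecidableEq V]

/-- The chain modulo two of a walk. -/
def chain {G : SimpleGraph V} {u v : V} (p : G.Walk u v) : Sym2 V → ZMod 2 :=
  (p.edges.map fun e => Pi.single e 1).sum

@[simp] theorem chain_nil {G : SimpleGraph V} {u : V} :
    chain (SimpleGraph.Walk.nil : G.Walk u u) = 0 := by simp [chain]

@[simp] theorem chain_cons {G : SimpleGraph V} {u v z : V} (h : G.Adj u v) (p : G.Walk v z) :
    chain (SimpleGraph.Walk.cons h p) = Pi.single s(u, v) 1 + chain p := by simp [chain]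

theorem mem_edges_of_chain_ne_zero {G : SimpleGraph V} {u v : V} (p : G.Walk u v) {e : Sym2 V}
    (h : chain p e ≠ 0) : e ∈ p.edges := by
  induction p with
  | nil => simp at h
  | cons hadj p ih =>
    rw [chain_cons, Pi.add_apply] at h
    rw [SimpleGraph.Walk.edges_cons, List.mem_cons]
    by_contra! hcon
    rw [Pi.single_eq_of_ne hcon.1, zero_add] at h
    exact hcon.2 (ih h)

/-- The sum of `f a + f b` over an unordered pair. -/
def pairSum (f : V → ZMod 2) : Sym2 V → ZMod 2 :=
  Sym2.lift ⟨fun a b => f a + f b, fun _ _ => add_comm _ _⟩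

@[simp] theorem pairSum_mk (f : V → ZMod 2) (a b : V) : pairSum f s(a, b) = f a + f b := rfl

variable [Fintype V]

/-- The pairing of a vertex function with the boundary of a chain. -/
def boundary (f : V → ZMod 2) (c : Sym2 V → ZMod 2) : ZMod 2 := ∑ e, c e * pairSum f e

theorem boundary_add (f : V → ZMod 2) (c c' : Sym2 V → ZMod 2) :
    boundary f (c + c') = boundary f c + boundary f c' := by
  simp [boundary, add_mul, Finset.sum_add_distrib]

theorem boundary_sum (f : V → ZMod 2) {ι : Type*} (I : Finset ι) (c : ι → Sym2 V → ZMod 2) :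
    boundary f (∑ i ∈ I, c i) = ∑ i ∈ I, boundary f (c i) := by
  simp only [boundary, Finset.sum_apply, Finset.sum_mul]
  exact Finset.sum_comm

@[simp] theorem boundary_single (f : V → ZMod 2) (a b : V) :
    boundary f (Pi.single s(a, b) 1) = f a + f b := by
  rw [boundary, Finset.sum_eq_single s(a, b)]
  · simp
  · intro e _ he
    rw [Pi.single_eq_of_ne he, zero_mul]
  · simp

/-- Interior vertices are met twice and cancel modulo two. -/
theorem boundary_chain (f : V → ZMod 2) {G : SimpleGraph V} {u v : V} (p : G.Walk u v) :
    boundary f (chain p) = f u + f v := by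
  induction p with
  | nil => simp [boundary, CharTwo.add_self_eq_zero]
  | @cons u v z h p ih =>
    rw [chain_cons, boundary_add, boundary_single, ih]
    have := CharTwo.add_self_eq_zero (f v)
    linear_combination this

/-- The total weight of the support of a chain. -/
def chainWeight (w : Sym2 V → ℝ) (c : Sym2 V → ZMod 2) : ℝ := ∑ e, if c e = 0 then 0 else w e

/-- The support of a sum is contained in the union of the supports; cancellation can only help. -/
theorem chainWeight_add {w : Sym2 V → ℝ} (hw : ∀ e, 0 ≤ w e) (c c' : Sym2 V → ZMod 2) :
    chainWeight w (c + c') ≤ chainWeight w c + chainWeight w c' := by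
  rw [chainWeight, chainWeight, chainWeight, ← Finset.sum_add_distrib]
  refine Finset.sum_le_sum fun e _ => ?_
  have := hw e
  by_cases h : c e = 0 <;> by_cases h' : c' e = 0 <;> simp only [Pi.add_apply, h, h'] <;>
    split_ifs <;> simp_all

theorem chainWeight_zero (w : Sym2 V → ℝ) : chainWeight w 0 = 0 := by simp [chainWeight]

theorem chainWeight_single (w : Sym2 V → ℝ) (e : Sym2 V) :
    chainWeight w (Pi.single e 1) = w e := by
  rw [chainWeight, Finset.sum_eq_single e]
  · simp
  · intro e' _ he
    rw [Pi.single_eq_of_ne he, if_pos rfl]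
  · simp

theorem chainWeight_sum {w : Sym2 V → ℝ} (hw : ∀ e, 0 ≤ w e) {ι : Type*} (I : Finset ι)
    (c : ι → Sym2 V → ZMod 2) :
    chainWeight w (∑ i ∈ I, c i) ≤ ∑ i ∈ I, chainWeight w (c i) := by
  classical
  induction I using Finset.induction_on with
  | empty => simp [chainWeight_zero]
  | insert a I ha ih =>
    rw [Finset.sum_insert ha, Finset.sum_insert ha]
    exact (chainWeight_add hw _ _).trans (by gcongr)

theorem chainWeight_chain {w : Sym2 V → ℝ} (hw : ∀ e, 0 ≤ w e) {G : SimpleGraph V} {u v : V}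
    (p : G.Walk u v) : chainWeight w (chain p) ≤ walkSum w p := by
  induction p with
  | nil => simp [chainWeight_zero]
  | cons h p ih =>
    rw [chain_cons, walkSum_cons]
    exact (chainWeight_add hw _ _).trans (by rw [chainWeight_single]; gcongr)

/-- A chain with boundary `u + v` carries a walk from `u` to `v`. -/
theorem exists_walk_of_boundary {w : Sym2 V → ℝ} (hw : ∀ e, 0 ≤ w e) {H : SimpleGraph V}
    {c : Sym2 V → ZMod 2} {u v : V} (hc : ∀ e, c e ≠ 0 → e ∈ H.edgeSet)
    (hb : ∀ f, boundary f c = f u + f v) : ∃ p : H.Walk u v, walkSum w p ≤ chainWeight w c := by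
  classical
  let K : SimpleGraph V := SimpleGraph.fromEdgeSet {e | c e ≠ 0}
  have hK : K.edgeSet = {e | c e ≠ 0} := by
    rw [SimpleGraph.edgeSet_fromEdgeSet, sdiff_eq_left, Set.disjoint_left]
    exact fun e he hd => H.not_isDiag_of_mem_edgeSet (hc e he) hd
  have hKH : K ≤ H := by
    rw [← SimpleGraph.edgeSet_subset_edgeSet, hK]; exact hc
  -- Otherwise, test the boundary on the indicator of the component of u in the support: both ends
  -- of every support edge lie on the same side, so the pairing is 0, whereas f u + f v = 1.
  have hreach : K.Reachable u v := by
    by_contra hn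
    have h := hb fun z => if K.Reachable u z then 1 else 0
    rw [if_pos (SimpleGraph.Reachable.refl u), if_neg hn, add_zero, boundary,
      Finset.sum_eq_zero] at h
    · exact zero_ne_one h
    · intro e _
      induction e with | _ a b
      by_cases hce : c s(a, b) = 0
      · rw [hce, zero_mul]
      · have hab : K.Adj a b := by
          rw [← SimpleGraph.mem_edgeSet, hK]; exact hce
        have : K.Reachable u a ↔ K.Reachable u b :=
          ⟨fun h => h.trans hab.reachable, fun h => h.trans hab.symm.reachable⟩
        rw [pairSum_mk]
        simp only [this, CharTwo.add_self_eq_zero, mul_zero]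
  -- A path uses each edge once, so its length is a sum over a subset of the support.
  obtain ⟨q, hq⟩ := hreach.exists_isPath
  refine ⟨q.mapLe hKH, ?_⟩
  have h1 : walkSum w (q.mapLe hKH) = ∑ e ∈ q.edges.toFinset, w e := by
    rw [List.sum_toFinset _ hq.isTrail.edges_nodup]; simp [walkSum]
  have h2 : chainWeight w c = ∑ e with c e ≠ 0, w e := by
    rw [chainWeight, Finset.sum_filter]
    exact Finset.sum_congr rfl fun e _ => by by_cases h : c e = 0 <;> simp [h]
  rw [h1, h2]
  refine Finset.sum_le_sum_of_subset_of_nonneg (fun e he => ?_) fun e _ _ => hw e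
  have := q.edges_subset_edgeSet (List.mem_toFinset.1 he)
  rw [hK] at this
  simpa using this

/-- There are more vectors than dimensions. Coefficients over the two-element field are 0 or 1, so a
linear dependence is just a subset with sum zero. -/
theorem exists_dependence {m : ℕ} {ι : Type*} [Fintype ι] (h : Fintype.card ι < m)
    (vec : ℕ → ι → ZMod 2) :
    ∃ I : Finset ℕ, I.Nonempty ∧ (∀ i ∈ I, i < m) ∧ ∑ i ∈ I, vec i = 0 := by
  have hdep : ¬ LinearIndependent (ZMod 2) fun i : Fin m => vec i := fun hl => by
    have := hl.fintype_card_le_finrank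
    simp at this
    omega
  rw [Fintype.not_linearIndependent_iff] at hdep
  obtain ⟨g, hg, i, hi⟩ := hdep
  refine ⟨(Finset.univ.filter fun i => g i ≠ 0).map Fin.valEmbedding, ⟨i, ?_⟩, ?_, ?_⟩
  · exact Finset.mem_map.2 ⟨i, by simpa using hi, rfl⟩
  · simp +contextual
  · rw [Finset.sum_map, Finset.sum_filter]
    refine Eq.trans ?_ hg
    refine Finset.sum_congr rfl fun i _ => ?_
    have : g i = 0 ∨ g i = 1 := by generalize g i = a; revert a; decide
    rcases this with h | h <;> simp [h]

end Chain

end MetricGraph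

/-! ### Greedy sequences and the lower bound for the dilation -/

namespace MetricGraph

variable {V M : Type*} [MetricSpace M]

theorem addEdges_adj {G : SimpleGraph V} {S : Finset (V × V)} {a b : V} :
    (addEdges G S).Adj a b ↔ G.Adj a b ∨ (a ≠ b ∧ ((a, b) ∈ S ∨ (b, a) ∈ S)) := by
  simp [addEdges]

theorem addEdges_mono (G : SimpleGraph V) {S S' : Finset (V × V)} (h : S ⊆ S') :
    addEdges G S ≤ addEdges G S' := by
  intro a b
  simp only [addEdges_adj]
  rintro (h1 | ⟨h1, h2 | h2⟩)
  · exact Or.inl h1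
  · exact Or.inr ⟨h1, Or.inl (h h2)⟩
  · exact Or.inr ⟨h1, Or.inr (h h2)⟩

theorem le_addEdges (G : SimpleGraph V) (S : Finset (V × V)) : G ≤ addEdges G S := le_sup_left

variable [DecidableEq V]

/-- The set of the first `i` members of a sequence of vertex pairs. -/
def firstPairs (e : ℕ → V × V) (i : ℕ) : Finset (V × V) := (Finset.range i).image e

/-- `e 0, …, e (m - 1)` are pairs that the greedy algorithm with threshold `τ` may add to `G`:
each is a shortest pair that violates the threshold when it is added. -/
def IsGreedySeq (x : V → M) (G : SimpleGraph V) (τ : ℝ) (e : ℕ → V × V) (m : ℕ) : Prop :=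
  ∀ i < m, ENNReal.ofReal (τ * dist (x (e i).1) (x (e i).2)) <
      graphDist x (addEdges G (firstPairs e i)) (e i).1 (e i).2 ∧
    ∀ a b, dist (x a) (x b) < dist (x (e i).1) (x (e i).2) →
      graphDist x (addEdges G (firstPairs e i)) a b ≤ ENNReal.ofReal (τ * dist (x a) (x b))

theorem IsGreedySeq.ne {x : V → M} {G : SimpleGraph V} {τ : ℝ} {e : ℕ → V × V} {m : ℕ}
    (h : IsGreedySeq x G τ e m) {i : ℕ} (hi : i < m) : (e i).1 ≠ (e i).2 := fun heq => by
  have := (h i hi).1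
  rw [heq, graphDist_self] at this
  exact not_lt_zero this

/-- If a later pair were shorter, it would already have met the threshold when the earlier one was
chosen, and it would still meet it, since adding edges only decreases distances. -/
theorem IsGreedySeq.monotone {x : V → M} {G : SimpleGraph V} {τ : ℝ} {e : ℕ → V × V} {m : ℕ}
    (h : IsGreedySeq x G τ e m) {i j : ℕ} (hij : i ≤ j) (hj : j < m) :
    dist (x (e i).1) (x (e i).2) ≤ dist (x (e j).1) (x (e j).2) := by
  by_contra! hlt
  refine (h j hj).1.not_ge ((graphDist_anti x (addEdges_mono G ?_) _ _).trans
    ((h i (hij.trans_lt hj)).2 _ _ hlt))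
  exact Finset.image_subset_image (Finset.range_mono hij)

/-- Each edge of the walk is replaced by a detour in H whose length is bounded by w. -/
theorem graphDist_le_walkSum (x : V → M) {G H : SimpleGraph V} {w : Sym2 V → ℝ}
    (hw : ∀ e, 0 ≤ w e) {u v : V} (p : G.Walk u v)
    (h : ∀ a b, G.Adj a b → s(a, b) ∈ p.edges → graphDist x H a b ≤ ENNReal.ofReal (w s(a, b))) :
    graphDist x H u v ≤ ENNReal.ofReal (walkSum w p) := by
  induction p with
  | nil => simp [graphDist_self]
  | @cons a b c hab p ih =>
    rw [walkSum_cons, ENNReal.ofReal_add (hw _) (walkSum_nonneg hw _)]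
    refine (graphDist_triangle x H a b c).trans (add_le_add (h a b hab (by simp)) (ih ?_))
    exact fun a' b' hadj hmem => h a' b' hadj (by simp [hmem])

variable [Fintype V]

/-- A dependence of walks modulo two closes a cycle through the last greedy pair. -/
theorem IsGreedySeq.lt_of_cycle {x : V → M} {G : SimpleGraph V} {τ : ℝ} {e : ℕ → V × V} {m : ℕ}
    (h : IsGreedySeq x G τ e m) {I : Finset ℕ} {j : ℕ} (hj : j ∈ I) (hmax : ∀ i ∈ I, i ≤ j)
    (hjm : j < m) {c : Sym2 V → ZMod 2} (hc : ∀ e, c e ≠ 0 → e ∈ G.edgeSet)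
    (hb : ∀ f : V → ZMod 2, boundary f c = ∑ i ∈ I, (f (e i).1 + f (e i).2)) :
    τ * dist (x (e j).1) (x (e j).2) <
      chainWeight (edgeLen x) c + ∑ i ∈ I.erase j, dist (x (e i).1) (x (e i).2) := by
  have hsupp : ∀ d, (c + ∑ i ∈ I.erase j, Pi.single s((e i).1, (e i).2) 1 : Sym2 V → ZMod 2) d ≠ 0 →
      d ∈ (addEdges G (firstPairs e j)).edgeSet := by
    intro d hd
    by_cases hcd : c d = 0
    · rw [Pi.add_apply, hcd, zero_add, Finset.sum_apply] at hd
      obtain ⟨i, hi, hne⟩ := Finset.exists_ne_zero_of_sum_ne_zero hd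
      have hde : d = s((e i).1, (e i).2) := by
        by_contra hne'
        rw [Pi.single_eq_of_ne hne'] at hne
        exact hne rfl
      obtain ⟨hij, hiI⟩ := Finset.mem_erase.1 hi
      have hlt : i < j := lt_of_le_of_ne (hmax i hiI) hij
      rw [hde, SimpleGraph.mem_edgeSet, addEdges_adj]
      exact Or.inr ⟨h.ne (hlt.trans hjm), Or.inl (Finset.mem_image_of_mem e (Finset.mem_range.2 hlt))⟩
    · exact SimpleGraph.edgeSet_mono (le_addEdges G _) (hc d hcd)
  -- Modulo two, the pairs other than the last cancel their share of the boundary of c; only the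
  -- ends of pair j remain.
  have hbd : ∀ f : V → ZMod 2,
      boundary f (c + ∑ i ∈ I.erase j, Pi.single s((e i).1, (e i).2) 1) = f (e j).1 + f (e j).2 := by
    intro f
    rw [boundary_add, boundary_sum, hb, ← Finset.add_sum_erase I _ hj]
    simp only [boundary_single]
    linear_combination CharTwo.add_self_eq_zero (∑ i ∈ I.erase j, (f (e i).1 + f (e i).2))
  obtain ⟨p, hp⟩ := exists_walk_of_boundary (edgeLen_nonneg x) hsupp hbd
  have h1 := (h j hjm).1.trans_le (graphDist_le x p)
  have h2 := lt_of_not_ge fun hle => h1.not_ge (ENNReal.ofReal_le_ofReal hle)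
  refine (h2.trans_le hp).trans_le ((chainWeight_add (edgeLen_nonneg x) _ _).trans ?_)
  gcongr
  refine (chainWeight_sum (edgeLen_nonneg x) _ _).trans (Finset.sum_le_sum fun i _ => ?_)
  rw [chainWeight_single, edgeLen_mk]

/-- With a threshold at least the number of vertices, at most that many pairs are added. -/
theorem IsGreedySeq.length_le {x : V → M} {G : SimpleGraph V} {τ : ℝ} {e : ℕ → V × V} {m : ℕ}
    (h : IsGreedySeq x G τ e m) (hτ : (Fintype.card V : ℝ) ≤ τ) : m ≤ Fintype.card V := by
  by_contra! hlt
  -- Incidence vectors of pairs live in dimension |V|. In a dependent subset every vertex has even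
  -- degree, so the pairs close up without any edge of G, and the zero chain can be used below.
  obtain ⟨I, hI, hIm, hsum⟩ := exists_dependence (m := Fintype.card V + 1) (ι := V)
    (Nat.lt_succ_self _) fun i => Pi.single (e i).1 1 + Pi.single (e i).2 1
  have hj := I.max'_mem hI
  set j := I.max' hI
  have hjm : j < m := (hIm j hj).trans_le hlt
  have key := h.lt_of_cycle (c := 0) hj (fun i hi => I.le_max' i hi) hjm (by simp) fun f => by
    have h0 : boundary f 0 = 0 := by simp [boundary]
    have := congrArg (fun g : V → ZMod 2 => ∑ z, g z * f z) hsum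
    simp only [Finset.sum_apply, Finset.sum_mul, Pi.zero_apply, zero_mul,
      Finset.sum_const_zero] at this
    rw [Finset.sum_comm] at this
    rw [h0, ← this]
    refine Finset.sum_congr rfl fun i _ => ?_
    simp [add_mul, Finset.sum_add_distrib, Pi.single_apply]
  have hcard : (I.erase j).card ≤ Fintype.card V := by
    have : I ⊆ Finset.range (Fintype.card V + 1) := fun i hi => Finset.mem_range.2 (hIm i hi)
    have := Finset.card_le_card this
    rw [Finset.card_range] at this
    rw [Finset.card_erase_of_mem hj]; omega
  have hle : ∑ i ∈ I.erase j, dist (x (e i).1) (x (e i).2) ≤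
      Fintype.card V * dist (x (e j).1) (x (e j).2) := by
    refine (Finset.sum_le_card_nsmul _ _ (dist (x (e j).1) (x (e j).2)) fun i hi => ?_).trans ?_
    · exact h.monotone (I.le_max' i (Finset.mem_of_mem_erase hi)) hjm
    · rw [nsmul_eq_mul]; gcongr
  rw [chainWeight_zero, zero_add] at key
  have := mul_le_mul_of_nonneg_right hτ (dist_nonneg (x := x (e j).1) (y := x (e j).2))
  linarith

/-- If the greedy algorithm adds more than `k` pairs, then no `k` pairs suffice for a
substantially smaller threshold. -/
theorem IsGreedySeq.lt_of_walks {x : V → M} {G : SimpleGraph V} {τ t : ℝ} {e : ℕ → V × V} {k : ℕ}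
    (h : IsGreedySeq x G τ e (k + 1)) {S : Finset (V × V)} (hS : S.card ≤ k) (ht : 1 ≤ t)
    (hp : ∀ i < k + 1, ∃ p : (addEdges G S).Walk (e i).1 (e i).2,
      walkSum (edgeLen x) p ≤ t * dist (x (e i).1) (x (e i).2)) : τ < (k + 1) * t := by
  by_contra! hτ
  -- The walks are made total in i, with a trivial walk as default value, so that they can be chosen
  -- as functions on the natural numbers.
  have hp' : ∀ i, ∃ (u v : V) (p : (addEdges G S).Walk u v), i < k + 1 → u = (e i).1 ∧
      v = (e i).2 ∧ walkSum (edgeLen x) p ≤ t * dist (x (e i).1) (x (e i).2) := fun i => by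
    by_cases hi : i < k + 1
    · obtain ⟨p, hp⟩ := hp i hi
      exact ⟨_, _, p, fun _ => ⟨rfl, rfl, hp⟩⟩
    · exact ⟨(e i).1, _, SimpleGraph.Walk.nil, fun h => absurd h hi⟩
  choose u v p hp using hp'
  let N : Finset (Sym2 V) := S.image fun q => s(q.1, q.2)
  -- The length of a walk splits into a part off S, which lies in G, and a part on S.
  let wOff : Sym2 V → ℝ := fun d => if d ∈ N then 0 else edgeLen x d
  let wOn : Sym2 V → ℝ := fun d => if d ∈ N then edgeLen x d else 0
  have hOff : ∀ d, 0 ≤ wOff d := fun d => by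
    simp only [wOff]; split_ifs; exacts [le_rfl, edgeLen_nonneg x d]
  have hOn : ∀ d, 0 ≤ wOn d := fun d => by
    simp only [wOn]; split_ifs; exacts [edgeLen_nonneg x d, le_rfl]
  have hsplit : ∀ {u v : V} (p : (addEdges G S).Walk u v),
      walkSum wOff p + walkSum wOn p = walkSum (edgeLen x) p := fun p => by
    rw [walkSum, walkSum, walkSum, ← List.sum_map_add]
    congr 2
    funext d
    simp only [wOff, wOn]; split_ifs <;> simp
  have hmemG : ∀ d ∈ (addEdges G S).edgeSet, d ∉ N → d ∈ G.edgeSet := fun d hd hdN => by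
    induction d with | _ a b
    rw [SimpleGraph.mem_edgeSet, addEdges_adj] at hd
    rcases hd with hd | ⟨-, hd | hd⟩
    · exact hd
    · exact absurd (Finset.mem_image_of_mem (fun q : V × V => s(q.1, q.2)) hd) hdN
    · exact absurd (Sym2.eq_swap ▸ Finset.mem_image_of_mem (fun q : V × V => s(q.1, q.2)) hd) hdN
  have hkt : 1 ≤ τ := by nlinarith [(Nat.cast_nonneg k : (0 : ℝ) ≤ k)]
  -- Each walk spends at least k/(k + 1) of the length L of its pair on S. This is clear if it uses
  -- an edge of S of length at least L. Otherwise its edges in S are shorter than L and already meet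
  -- the threshold when pair i is added, so the violation gives τL < wOff + τ wOn. With wOff + wOn ≤
  -- tL this becomes (τ - t)L < (τ - 1) wOn, and (τ - t)/(τ - 1) is at least k/(k + 1) since τ ≥ (k
  -- + 1)t.
  have hon : ∀ i < k + 1,
      k * dist (x (e i).1) (x (e i).2) ≤ (k + 1) * walkSum wOn (p i) := fun i hi => by
    obtain ⟨hu, hv, hw⟩ := hp i hi
    set L := dist (x (e i).1) (x (e i).2) with hL
    have hL0 : 0 ≤ L := dist_nonneg
    by_cases hlong : ∃ d ∈ (p i).edges, d ∈ N ∧ L ≤ edgeLen x d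
    · obtain ⟨d, hd, hdN, hdL⟩ := hlong
      have : wOn d ≤ walkSum wOn (p i) :=
        List.single_le_sum (by simpa using fun d _ => hOn d) _ (List.mem_map_of_mem hd)
      simp only [wOn, if_pos hdN] at this
      nlinarith [(Nat.cast_nonneg k : (0 : ℝ) ≤ k)]
    · push Not at hlong
      have h1 : graphDist x (addEdges G (firstPairs e i)) (u i) (v i) ≤
          ENNReal.ofReal (walkSum (fun d => wOff d + τ * wOn d) (p i)) := by
        refine graphDist_le_walkSum x (fun d => ?_) _ fun a b hab hmem => ?_
        · have := hOff d; have := hOn d; positivity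
        · by_cases hN : s(a, b) ∈ N
          · simp only [wOff, wOn, if_pos hN, zero_add]
            exact (h i hi).2 a b (hlong _ hmem hN)
          · simp only [wOff, wOn, if_neg hN, mul_zero, add_zero]
            exact graphDist_adj x (le_addEdges G _ (hmemG _ hab hN))
      have h2 : walkSum (fun d => wOff d + τ * wOn d) (p i) =
          walkSum wOff (p i) + τ * walkSum wOn (p i) := by
        simp only [walkSum, List.sum_map_add, List.sum_map_mul_left]
      have h1' : graphDist x (addEdges G (firstPairs e i)) (e i).1 (e i).2 ≤
          ENNReal.ofReal (walkSum wOff (p i) + τ * walkSum wOn (p i)) := by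
        rw [← hu, ← hv, ← h2]; exact h1
      have h3 := lt_of_not_ge fun hle =>
        ((h i hi).1.trans_le h1').not_ge (ENNReal.ofReal_le_ofReal hle)
      rw [← hL] at h3
      have h4 := hsplit (p i)
      by_contra! h5
      have hk : (0 : ℝ) ≤ k := Nat.cast_nonneg k
      have h6 : (τ - t) * L < (τ - 1) * walkSum wOn (p i) := by linarith
      have h7 : (τ - 1) * ((k + 1) * walkSum wOn (p i)) ≤ (τ - 1) * (k * L) :=
        mul_le_mul_of_nonneg_left h5.le (by linarith)
      have h8 : (k + 1) * ((τ - t) * L) < (k + 1) * ((τ - 1) * walkSum wOn (p i)) :=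
        mul_lt_mul_of_pos_left h6 (by linarith)
      have h9 : ((k + 1) * (τ - t) - k * (τ - 1)) * L < 0 := by linarith
      have h10 : 0 ≤ ((k + 1) * (τ - t) - k * (τ - 1)) * L := mul_nonneg (by linarith) hL0
      linarith
  -- The vectors are the restrictions of the k + 1 chains to S, in dimension |S| ≤ k.
  obtain ⟨I, hI, hIm, hsum⟩ := exists_dependence (m := k + 1) (ι := S)
    (by rw [Fintype.card_coe]; omega) fun i q => chain (p i) s(q.1.1, q.1.2)
  have hj := I.max'_mem hI
  set j := I.max' hI with hjdef
  have hjm := hIm j hj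
  set c := ∑ i ∈ I, chain (p i) with hc
  have hcN : ∀ d ∈ N, c d = 0 := fun d hd => by
    obtain ⟨q, hq, rfl⟩ := Finset.mem_image.1 hd
    have := congrFun hsum ⟨q, hq⟩
    rw [Finset.sum_apply] at this
    rw [hc, Finset.sum_apply, this, Pi.zero_apply]
  have hcG : ∀ d, c d ≠ 0 → d ∈ G.edgeSet := fun d hd => by
    refine hmemG d ?_ fun hN => hd (hcN d hN)
    rw [hc, Finset.sum_apply] at hd
    obtain ⟨i, -, hne⟩ := Finset.exists_ne_zero_of_sum_ne_zero hd
    exact (p i).edges_subset_edgeSet (mem_edges_of_chain_ne_zero (p i) hne)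
  have key := h.lt_of_cycle hj (fun i hi => I.le_max' i hi) hjm hcG fun f => by
    rw [hc, boundary_sum]
    refine Finset.sum_congr rfl fun i hi => ?_
    rw [boundary_chain, (hp i (hIm i hi)).1, (hp i (hIm i hi)).2.1]
  have hcw : chainWeight (edgeLen x) c ≤ ∑ i ∈ I, walkSum wOff (p i) := by
    have : chainWeight (edgeLen x) c = chainWeight wOff c :=
      Finset.sum_congr rfl fun d _ => by
        by_cases hd : c d = 0
        · simp [hd]
        · have : d ∉ N := fun hN => hd (hcN d hN)
          simp [hd, wOff, this]
    rw [this]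
    exact (chainWeight_sum hOff _ _).trans
      (Finset.sum_le_sum fun i _ => chainWeight_chain hOff _)
  set L := dist (x (e j).1) (x (e j).2) with hL
  have hL0 : 0 ≤ L := dist_nonneg
  have hk : (0 : ℝ) ≤ k := Nat.cast_nonneg k
  have hcard : (I.card : ℝ) ≤ k + 1 := by
    have : I ⊆ Finset.range (k + 1) := fun i hi => Finset.mem_range.2 (hIm i hi)
    have := Finset.card_le_card this
    rw [Finset.card_range] at this
    exact_mod_cast this
  -- The part off S is at most t - k/(k + 1) times the length of the pair; adding the pair itself
  -- gives the factor t + 1/(k + 1).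
  have hterm : ∀ i ∈ I, walkSum wOff (p i) + dist (x (e i).1) (x (e i).2) ≤
      (t + 1 / (k + 1)) * L := fun i hi => by
    have h1 := hon i (hIm i hi)
    have h2 := (hp i (hIm i hi)).2.2
    have h3 := hsplit (p i)
    have h4 := h.monotone (I.le_max' i hi) hjm
    rw [← hjdef, ← hL] at h4
    set l := dist (x (e i).1) (x (e i).2)
    have h5 : k / (k + 1) * l ≤ walkSum wOn (p i) := by
      rw [div_mul_eq_mul_div, div_le_iff₀ (by linarith)]; linarith
    have h6 : (k : ℝ) / (k + 1) = 1 - 1 / (k + 1) := by field_simp; ring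
    have h7 : (t + 1 / (k + 1)) * l ≤ (t + 1 / (k + 1)) * L :=
      mul_le_mul_of_nonneg_left h4 (by positivity)
    rw [h6] at h5
    linarith
  -- At most k + 1 terms add up to at most (k + 1)tL + L. The surplus L is exactly the last pair,
  -- which is missing from the walk in `key`.
  have htotal := Finset.sum_le_card_nsmul I _ _ hterm
  rw [nsmul_eq_mul, Finset.sum_add_distrib, ← Finset.add_sum_erase I _ hj] at htotal
  have h1 : I.card * ((t + 1 / (k + 1)) * L) ≤ (k + 1) * ((t + 1 / (k + 1)) * L) :=
    mul_le_mul_of_nonneg_right hcard (by positivity)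
  have h2 : ((k : ℝ) + 1) * ((t + 1 / (k + 1)) * L) = (k + 1) * t * L + L := by
    field_simp
  have h3 := mul_le_mul_of_nonneg_right hτ hL0
  rw [← Finset.add_sum_erase I _ hj] at hcw
  rw [← Finset.add_sum_erase I _ hj] at htotal
  linarith

end MetricGraph

/-! ### Bounds for the minimum dilation, and scales that approximate it -/

namespace MetricGraph

variable {V M : Type*} [MetricSpace M]

theorem one_le_dilation (x : V → M) (G : SimpleGraph V) : 1 ≤ dilation x G :=
  le_sInf fun _ ht => ht.1

theorem one_le_minDilation (x : V → M) (G : SimpleGraph V) (k : ℕ) : 1 ≤ minDilation x G k :=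
  le_iInf₂ fun _ _ => one_le_dilation x _

theorem IsSpanner.mono {x : V → M} {G H : SimpleGraph V} {t : ℝ≥0∞} (h : IsSpanner x G t)
    (hle : G ≤ H) : IsSpanner x H t := fun u v => (graphDist_anti x hle u v).trans (h u v)

theorem IsSpanner.one_le {x : V → M} (hx : Function.Injective x) {G : SimpleGraph V} {τ : ℝ}
    (h : IsSpanner x G (ENNReal.ofReal τ)) {u v : V} (huv : u ≠ v) : 1 ≤ τ := by
  have h1 := (edist_le_graphDist x G u v).trans (h u v)
  have hpos : 0 < dist (x u) (x v) := dist_pos.2 (hx.ne huv)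
  by_contra! hlt
  rw [edist_dist, ← ENNReal.ofReal_mul' dist_nonneg] at h1
  have := (ENNReal.ofReal_le_ofReal_iff' (p := dist (x u) (x v))).1 h1
  rcases this with h | h <;> nlinarith

theorem dilation_le {x : V → M} {G : SimpleGraph V} {τ : ℝ}
    (h : IsSpanner x G (ENNReal.ofReal τ)) (hτ : 1 ≤ τ) : dilation x G ≤ ENNReal.ofReal τ :=
  sInf_le ⟨by simpa using hτ, h⟩

theorem minDilation_le (x : V → M) (G : SimpleGraph V) {k : ℕ} {S : Finset (V × V)}
    (hS : S.card = k) : minDilation x G k ≤ dilation x (addEdges G S) := iInf₂_le S hS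

/-- Fewer than k pairs can be extended to exactly k without increasing distances. -/
theorem IsSpanner.minDilation_le [Fintype V] {x : V → M} {G : SimpleGraph V} {k : ℕ}
    {S : Finset (V × V)} {τ : ℝ} (h : IsSpanner x (addEdges G S) (ENNReal.ofReal τ)) (hτ : 1 ≤ τ)
    (hS : S.card ≤ k) (hk : k ≤ Fintype.card V ^ 2) : minDilation x G k ≤ ENNReal.ofReal τ := by
  obtain ⟨S', hSS', -, hS'⟩ := Finset.exists_subsuperset_card_eq (Finset.subset_univ S) hS
    (by rwa [Finset.card_univ, Fintype.card_prod, ← sq])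
  exact (MetricGraph.minDilation_le x G hS').trans
    (dilation_le (h.mono (addEdges_mono G hSS')) hτ)

variable [DecidableEq V] [Fintype V]

theorem IsGreedySeq.le_minDilation {x : V → M} (hx : Function.Injective x) {G : SimpleGraph V} {τ : ℝ} {e : ℕ → V × V} {k : ℕ}
    (h : IsGreedySeq x G τ e (k + 1)) :
    ENNReal.ofReal τ ≤ ((k + 1 : ℕ) : ℝ≥0∞) * minDilation x G k := by
  have hk0 : ((k + 1 : ℕ) : ℝ≥0∞) ≠ 0 := by simp
  have hkt : ((k + 1 : ℕ) : ℝ≥0∞) ≠ ⊤ := ENNReal.natCast_ne_top _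
  rw [mul_comm, ← ENNReal.div_le_iff hk0 hkt]
  refine le_iInf₂ fun S hS => le_sInf ?_
  rintro t ⟨ht1, ht⟩
  rw [ENNReal.div_le_iff hk0 hkt]
  rcases eq_or_ne t ⊤ with rfl | htop
  · rw [ENNReal.top_mul hk0]; exact le_top
  lift t to NNReal using htop
  have ht1' : (1 : ℝ) ≤ t := by exact_mod_cast ht1
  have hlt : ∀ t' : ℝ, (t : ℝ) < t' → τ < (k + 1) * t' := fun t' ht' =>
    h.lt_of_walks hS.le (ht1'.trans ht'.le) fun i hi => by
      have hpos : 0 < dist (x (e i).1) (x (e i).2) := dist_pos.2 (hx.ne (h.ne hi))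
      obtain ⟨p, hp⟩ := exists_walk_of_graphDist_lt x (r := t' * dist (x (e i).1) (x (e i).2))
        ((ht (e i).1 (e i).2).trans_lt (by
          rw [edist_dist, ← ENNReal.ofReal_coe_nnreal, ← ENNReal.ofReal_mul t.coe_nonneg]
          exact (ENNReal.ofReal_lt_ofReal_iff (by nlinarith)).2 (by gcongr)))
      exact ⟨p, hp.le⟩
  have hle : τ ≤ (k + 1) * t := by
    by_contra! hcon
    have := hlt (τ / (k + 1)) (by rw [lt_div_iff₀ (by positivity)]; linarith)
    rw [mul_div_cancel₀ _ (by positivity)] at this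
    exact lt_irrefl _ this
  rw [← ENNReal.ofReal_coe_nnreal, ← ENNReal.ofReal_natCast, ← ENNReal.ofReal_mul t.coe_nonneg]
  refine ENNReal.ofReal_le_ofReal ?_
  push_cast
  linarith

/-- A walk contains an edge which is short and yet approximates the distance of the end points. -/
theorem exists_long_edge (x : V → M) {G : SimpleGraph V} {u v : V} (huv : u ≠ v) (p : G.Walk u v) :
    ∃ a b, G.Adj a b ∧ dist (x a) (x b) ≤ walkSum (edgeLen x) p ∧
      graphDist x G u v ≤ ENNReal.ofReal (Fintype.card V * dist (x a) (x b)) := by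
  -- A path has fewer than |V| edges, so its longest edge carries at least the fraction 1/|V| of its
  -- length. It is also an edge of p, and thus no longer than p.
  have hq := p.bypass_isPath
  set q := p.bypass
  have hne : q.edges ≠ [] := fun h => huv (by
    have : q.length = 0 := by rw [← SimpleGraph.Walk.length_edges, h]; rfl
    exact SimpleGraph.Walk.eq_of_length_eq_zero this)
  obtain ⟨d, hd, hmax⟩ := q.edges.toFinset.exists_max_image (edgeLen x)
    (by rwa [List.toFinset_nonempty_iff])
  rw [List.mem_toFinset] at hd
  have hpd := p.edges_bypass_subset_edges hd
  have hG := q.edges_subset_edgeSet hd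
  induction d with | _ a b
  refine ⟨a, b, hG, List.single_le_sum (by simpa using fun d _ => edgeLen_nonneg x d) _
    (List.mem_map_of_mem hpd), (graphDist_le x q).trans (ENNReal.ofReal_le_ofReal ?_)⟩
  have h1 : walkSum (edgeLen x) q ≤ (q.edges.map (edgeLen x)).length • dist (x a) (x b) := by
    refine List.sum_le_card_nsmul _ _ fun r hr => ?_
    obtain ⟨d, hd, rfl⟩ := List.mem_map.1 hr
    exact hmax d (List.mem_toFinset.2 hd)
  refine h1.trans ?_
  rw [nsmul_eq_mul, List.length_map, SimpleGraph.Walk.length_edges]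
  have := hq.length_lt.le
  gcongr

/-- The lengths of the pairs added to the empty graph approximate all distances. -/
theorem exists_scale {x : V → M} (hx : Function.Injective x) {e : ℕ → V × V} {m : ℕ}
    (hm : IsSpanner x (addEdges ⊥ (firstPairs e m)) (ENNReal.ofReal (Fintype.card V)))
    {u v : V} (huv : u ≠ v) :
    ∃ i < m, dist (x u) (x v) ≤ Fintype.card V * dist (x (e i).1) (x (e i).2) ∧
      dist (x (e i).1) (x (e i).2) ≤ 2 * Fintype.card V * dist (x u) (x v) := by
  have hpos : 0 < dist (x u) (x v) := dist_pos.2 (hx.ne huv)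
  have hn : (0 : ℝ) < Fintype.card V := by exact_mod_cast Fintype.card_pos_iff.2 ⟨u⟩
  obtain ⟨p, hp⟩ := exists_walk_of_graphDist_lt x (r := 2 * Fintype.card V * dist (x u) (x v))
    ((hm u v).trans_lt (by
      rw [edist_dist, ← ENNReal.ofReal_mul hn.le]
      exact (ENNReal.ofReal_lt_ofReal_iff (by positivity)).2 (by nlinarith [mul_pos hn hpos])))
  obtain ⟨a, b, hab, h1, h2⟩ := exists_long_edge x huv p
  have h3 := (edist_le_graphDist x _ u v).trans h2
  rw [edist_dist, ENNReal.ofReal_le_ofReal_iff (by positivity)] at h3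
  rw [addEdges_adj] at hab
  have key : ∀ {a b}, (a, b) ∈ firstPairs e m → ∃ i < m, e i = (a, b) := fun hmem => by
    simpa [firstPairs] using hmem
  rcases hab with hab | ⟨-, hab | hab⟩
  · exact absurd hab (by simp)
  · obtain ⟨i, hi, he⟩ := key hab
    exact ⟨i, hi, by rw [he]; exact h3, by rw [he]; exact h1.trans hp.le⟩
  · obtain ⟨i, hi, he⟩ := key hab
    exact ⟨i, hi, by rw [he, dist_comm (x b)]; exact h3,
      by rw [he, dist_comm (x b)]; exact h1.trans hp.le⟩

/-- A quotient of two scales approximates a finite minimum dilation up to a polynomial factor. -/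
theorem IsGreedySeq.exists_ratio {x : V → M} (hx : Function.Injective x) {e : ℕ → V × V} {m : ℕ}
    (h : IsGreedySeq x ⊥ (Fintype.card V) e m)
    (hm : IsSpanner x (addEdges ⊥ (firstPairs e m)) (ENNReal.ofReal (Fintype.card V)))
    (hV : 2 ≤ Fintype.card V) {G : SimpleGraph V} {k : ℕ} {t : ℝ}
    (ht : minDilation x G k = ENNReal.ofReal t) (ht1 : 1 ≤ t) :
    ∃ i < m, ∃ j < m,
      t ≤ Fintype.card V ^ 5 *
        (dist (x (e i).1) (x (e i).2) / dist (x (e j).1) (x (e j).2)) ∧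
      dist (x (e i).1) (x (e i).2) / dist (x (e j).1) (x (e j).2) ≤ Fintype.card V ^ 5 * t := by
  set n := (Fintype.card V : ℝ) with hn
  have hn2 : (2 : ℝ) ≤ n := by rw [hn]; exact_mod_cast hV
  have hn5 : 8 * n ^ 2 ≤ n ^ 5 := by
    have : 2 ^ 3 * n ^ 2 ≤ n ^ 3 * n ^ 2 := by gcongr
    linarith [this, (by ring : n ^ 3 * n ^ 2 = n ^ 5)]
  have hn5' : 4 * n ^ 3 ≤ n ^ 5 := by
    have : 2 ^ 2 * n ^ 3 ≤ n ^ 2 * n ^ 3 := by gcongr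
    linarith [this, (by ring : n ^ 2 * n ^ 3 = n ^ 5)]
  have hn4 : 4 ≤ n ^ 2 := by nlinarith
  have hpos : ∀ i < m, 0 < dist (x (e i).1) (x (e i).2) := fun i hi =>
    dist_pos.2 (hx.ne (h.ne hi))
  have hlt : minDilation x G k < ENNReal.ofReal (2 * t) := by
    rw [ht]; exact (ENNReal.ofReal_lt_ofReal_iff (by linarith)).2 (by linarith)
  obtain ⟨S, hlt'⟩ := iInf_lt_iff.1 hlt
  obtain ⟨hS, hD⟩ := iInf_lt_iff.1 hlt'
  have hge : ENNReal.ofReal t ≤ dilation x (addEdges G S) := ht ▸ minDilation_le x G hS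
  -- For t ≤ 2 the quotient 1 of a scale by itself will do. For t > 2, the number t/2 exceeds 1 and
  -- is not a valid dilation of G ∪ S, so some pair uv has distance between (t/2) and 2t times its
  -- length. A long edge ab of a corresponding walk then makes d(a,b)/d(u,v) comparable to t, and
  -- both distances are replaced by scales.
  by_cases ht2 : t ≤ 2
  · obtain ⟨u, v, huv⟩ := Fintype.one_lt_card_iff.1 (by omega : 1 < Fintype.card V)
    obtain ⟨i, hi, -⟩ := exists_scale hx hm huv
    refine ⟨i, hi, i, hi, ?_, ?_⟩ <;> rw [div_self (hpos i hi).ne'] <;> nlinarith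
  · push Not at ht2
    have hns : ¬ IsSpanner x (addEdges G S) (ENNReal.ofReal (t / 2)) := fun hs => by
      have := hge.trans (dilation_le hs (by linarith))
      rw [ENNReal.ofReal_le_ofReal_iff (by linarith)] at this
      linarith
    simp only [IsSpanner, not_forall, not_le] at hns
    obtain ⟨u, v, huv⟩ := hns
    have hne : u ≠ v := by
      rintro rfl
      rw [graphDist_self] at huv
      exact not_lt_zero huv
    have huvpos : 0 < dist (x u) (x v) := dist_pos.2 (hx.ne hne)
    obtain ⟨t', ⟨-, ht'⟩, ht't⟩ := sInf_lt_iff.1 hD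
    obtain ⟨p, hp⟩ := exists_walk_of_graphDist_lt x (r := 2 * t * dist (x u) (x v))
      ((ht' u v).trans_lt (by
        rw [edist_dist, ENNReal.ofReal_mul (by linarith)]
        exact (ENNReal.mul_lt_mul_iff_left (by simpa using hx.ne hne) ENNReal.ofReal_ne_top).2 ht't))
    obtain ⟨a, b, hab, h1, h2⟩ := exists_long_edge x hne p
    have h3 := huv.trans_le h2
    rw [edist_dist, ← ENNReal.ofReal_mul (by linarith), ← hn] at h3
    have h3 := (ENNReal.ofReal_lt_ofReal_iff_of_nonneg (by positivity)).1 h3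
    have h1 := h1.trans hp.le
    obtain ⟨i, hi, hi1, hi2⟩ := exists_scale hx hm hab.ne
    obtain ⟨j, hj, hj1, hj2⟩ := exists_scale hx hm hne
    have hpi := hpos i hi
    have hpj := hpos j hj
    refine ⟨i, hi, j, hj, ?_, ?_⟩
    · rw [← mul_div_assoc, le_div_iff₀ hpj]
      rw [← hn] at hi1 hj2
      set mi := dist (x (e i).1) (x (e i).2)
      set mj := dist (x (e j).1) (x (e j).2)
      calc t * mj ≤ t * (2 * n * dist (x u) (x v)) := by gcongr
        _ = 4 * n * (t / 2 * dist (x u) (x v)) := by ring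
        _ ≤ 4 * n * (n * dist (x a) (x b)) := by gcongr
        _ ≤ 4 * n * (n * (n * mi)) := by gcongr
        _ = 4 * n ^ 3 * mi := by ring
        _ ≤ n ^ 5 * mi := by gcongr
    · rw [div_le_iff₀ hpj]
      rw [← hn] at hi2 hj1
      set mi := dist (x (e i).1) (x (e i).2)
      set mj := dist (x (e j).1) (x (e j).2)
      calc mi ≤ 2 * n * dist (x a) (x b) := hi2
        _ ≤ 2 * n * (2 * t * dist (x u) (x v)) := by gcongr
        _ ≤ 2 * n * (2 * t * (n * mj)) := by gcongr
        _ = 4 * n ^ 2 * t * mj := by ring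
        _ ≤ n ^ 5 * t * mj := by gcongr; nlinarith

end MetricGraph

/-! ## Program logic for the real RAM -/

namespace RealRAM

/-- Update a word register, whatever the size of the word. -/
def State.updW (s : State) (d v : ℕ) : State := { s with w := Function.update s.w d v }

/-- Update a cell of a word array. -/
def State.updWA (s : State) (A a v : ℕ) : State :=
  { s with wa := Function.update s.wa A (Function.update (s.wa A) a v) }

/-- Update a cell of a real array. -/
def State.updRA (s : State) (A a : ℕ) (v : ℝ) : State :=
  { s with ra := Function.update s.ra A (Function.update (s.ra A) a v) }

section

variable (s : State) (A d a v : ℕ) (y : ℝ)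

@[simp] theorem State.updW_w : (s.updW d v).w a = if a = d then v else s.w a :=
  Function.update_apply ..
@[simp] theorem State.updW_r : (s.updW d v).r = s.r := rfl
@[simp] theorem State.updW_wa : (s.updW d v).wa = s.wa := rfl
@[simp] theorem State.updW_ra : (s.updW d v).ra = s.ra := rfl
@[simp] theorem State.setR_w : (s.setR d y).w = s.w := rfl
@[simp] theorem State.setR_r : (s.setR d y).r a = if a = d then y else s.r a :=
  Function.update_apply ..
@[simp] theorem State.setR_wa : (s.setR d y).wa = s.wa := rfl
@[simp] theorem State.setR_ra : (s.setR d y).ra = s.ra := rfl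
@[simp] theorem State.updWA_w : (s.updWA d a v).w = s.w := rfl
@[simp] theorem State.updWA_r : (s.updWA d a v).r = s.r := rfl
@[simp] theorem State.updWA_wa :
    (s.updWA d a v).wa A = if A = d then Function.update (s.wa d) a v else s.wa A :=
  Function.update_apply ..
@[simp] theorem State.updWA_ra : (s.updWA d a v).ra = s.ra := rfl
@[simp] theorem State.updRA_w : (s.updRA d a y).w = s.w := rfl
@[simp] theorem State.updRA_r : (s.updRA d a y).r = s.r := rfl
@[simp] theorem State.updRA_wa : (s.updRA d a y).wa = s.wa := rfl
@[simp] theorem State.updRA_ra :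
    (s.updRA d a y).ra A = if A = d then Function.update (s.ra d) a y else s.ra A :=
  Function.update_apply ..

end

/-- The state after an instruction that does not get stuck. -/
noncomputable def Instr.eff (s : State) : Instr → State
  | wconst d c => s.updW d c
  | wmov d a => s.updW d (s.w a)
  | wadd d a b => s.updW d (s.w a + s.w b)
  | wsub d a b => s.updW d (s.w a - s.w b)
  | wmul d a b => s.updW d (s.w a * s.w b)
  | wdiv d a b => s.updW d (s.w a / s.w b)
  | wload d A a => s.updW d (s.wa A (s.w a))
  | wstore A a b => s.updWA A (s.w a) (s.w b)
  | rconst d c => s.setR d (c : ℝ)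
  | rofw d a => s.setR d (s.w a : ℝ)
  | rmov d a => s.setR d (s.r a)
  | radd d a b => s.setR d (s.r a + s.r b)
  | rsub d a b => s.setR d (s.r a - s.r b)
  | rmul d a b => s.setR d (s.r a * s.r b)
  | rdiv d a b => s.setR d (s.r a / s.r b)
  | rload d A a => s.setR d (s.ra A (s.w a))
  | rstore A a b => s.updRA A (s.w a) (s.r b)

/-- The condition under which an instruction does not get stuck. -/
def Instr.Ok (B : ℕ) (s : State) : Instr → Prop
  | wconst _ c => c < B
  | wmov _ a => s.w a < B
  | wadd _ a b => s.w a + s.w b < B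
  | wsub _ a b => s.w a - s.w b < B
  | wmul _ a b => s.w a * s.w b < B
  | wdiv _ a b => s.w b ≠ 0 ∧ s.w a / s.w b < B
  | wload _ A a => s.wa A (s.w a) < B
  | rdiv _ _ b => s.r b ≠ 0
  | _ => True

theorem Instr.apply_eq {B : ℕ} {s : State} {I : Instr} (h : I.Ok B s) :
    I.apply B s = some (I.eff s) := by
  cases I <;> simp_all [Instr.Ok, Instr.apply, Instr.eff, State.setW, State.updW, State.updWA,
    State.updRA]

/-- `p`, started in `s`, halts after at most `T` steps in a state that satisfies `Q`. -/
def Runs (B : ℕ) (p : Prog) (s : State) (T : ℕ) (Q : State → Prop) : Prop :=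
  ∃ T' ≤ T, ∃ s', Exec B p s T' s' ∧ Q s'

theorem Runs.mono {B : ℕ} {p : Prog} {s : State} {T T' : ℕ} {Q Q' : State → Prop}
    (h : Runs B p s T Q) (hT : T ≤ T') (hQ : ∀ s', Q s' → Q' s') : Runs B p s T' Q' := by
  obtain ⟨t, ht, s', he, hs⟩ := h
  exact ⟨t, ht.trans hT, s', he, hQ s' hs⟩

theorem Runs.seq {B : ℕ} {p q : Prog} {s : State} {T T' : ℕ} {R Q : State → Prop}
    (hp : Runs B p s T R) (hq : ∀ s', R s' → Runs B q s' T' Q) :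
    Runs B (.seq p q) s (T + T') Q := by
  obtain ⟨t, ht, s', he, hs⟩ := hp
  obtain ⟨t', ht', s'', he', hs'⟩ := hq s' hs
  exact ⟨t + t', add_le_add ht ht', s'', .seq he he', hs'⟩

theorem Runs.ite {B : ℕ} {b : Test} {p q : Prog} {s : State} {T : ℕ} {Q : State → Prop}
    (hp : b.Holds s → Runs B p s T Q) (hq : ¬ b.Holds s → Runs B q s T Q) :
    Runs B (.ite b p q) s (T + 1) Q := by
  by_cases h : b.Holds s
  · obtain ⟨t, ht, s', he, hs⟩ := hp h
    exact ⟨t + 1, by omega, s', .ite_true h he, hs⟩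
  · obtain ⟨t, ht, s', he, hs⟩ := hq h
    exact ⟨t + 1, by omega, s', .ite_false h he, hs⟩

/-- The weakest precondition of a loop-free program. -/
def wp (B : ℕ) : Prog → State → (State → Prop) → Prop
  | .skip, s, Q => Q s
  | .instr I, s, Q => I.Ok B s ∧ Q (I.eff s)
  | .seq p q, s, Q => wp B p s fun s' => wp B q s' Q
  | .ite b p q, s, Q => (b.Holds s → wp B p s Q) ∧ (¬ b.Holds s → wp B q s Q)
  | .while _ _, _, _ => False

/-- The worst-case number of steps of a loop-free program. -/
def Prog.cost : Prog → ℕ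
  | .skip => 1
  | .instr _ => 1
  | .seq p q => p.cost + q.cost
  | .ite _ p q => max p.cost q.cost + 1
  | .while _ _ => 0

theorem Runs.of_wp {B : ℕ} {p : Prog} {s : State} {Q : State → Prop} (h : wp B p s Q) :
    Runs B p s p.cost Q := by
  induction p generalizing s Q with
  | skip => exact ⟨1, le_rfl, s, .skip s, h⟩
  | instr I => exact ⟨1, le_rfl, _, .instr (Instr.apply_eq h.1), h.2⟩
  | seq p q ihp ihq => exact (ihp h).seq fun s' hs' => ihq hs'
  | ite b p q ihp ihq =>
    exact Runs.ite (fun hb => (ihp (h.1 hb)).mono (le_max_left _ _) fun _ => id)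
      fun hb => (ihq (h.2 hb)).mono (le_max_right _ _) fun _ => id
  | _ => exact h.elim

/-- The kind (word register, real register, word array, real array) and the name of the cell or
array that an instruction writes to. -/
def Instr.writes : Instr → ℕ → ℕ → Bool
  | wconst d _ | wmov d _ | wadd d _ _ | wsub d _ _ | wmul d _ _ | wdiv d _ _ | wload d _ _ =>
    fun κ a => κ == 0 && a == d
  | rconst d _ | rofw d _ | rmov d _ | radd d _ _ | rsub d _ _ | rmul d _ _ | rdiv d _ _
  | rload d _ _ => fun κ a => κ == 1 && a == d
  | wstore A _ _ => fun κ a => κ == 2 && a == A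
  | rstore A _ _ => fun κ a => κ == 3 && a == A

/-- The registers and arrays that a program may write to. -/
def Prog.writes : Prog → ℕ → ℕ → Bool
  | .skip => fun _ _ => false
  | .instr I => I.writes
  | .seq p q => fun κ a => p.writes κ a || q.writes κ a
  | .ite _ p q => fun κ a => p.writes κ a || q.writes κ a
  | .while _ p => p.writes

/-- All that is outside of the write set is unchanged. -/
structure Frame (W : ℕ → ℕ → Bool) (s s' : State) : Prop where
  w : ∀ a, W 0 a = false → s'.w a = s.w a
  r : ∀ a, W 1 a = false → s'.r a = s.r a
  wa : ∀ a, W 2 a = false → s'.wa a = s.wa a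
  ra : ∀ a, W 3 a = false → s'.ra a = s.ra a

theorem Frame.refl (W : ℕ → ℕ → Bool) (s : State) : Frame W s s :=
  ⟨fun _ _ => rfl, fun _ _ => rfl, fun _ _ => rfl, fun _ _ => rfl⟩

theorem Frame.trans {W : ℕ → ℕ → Bool} {s s' s'' : State} (h : Frame W s s')
    (h' : Frame W s' s'') : Frame W s s'' :=
  ⟨fun a ha => (h'.w a ha).trans (h.w a ha), fun a ha => (h'.r a ha).trans (h.r a ha),
    fun a ha => (h'.wa a ha).trans (h.wa a ha), fun a ha => (h'.ra a ha).trans (h.ra a ha)⟩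

theorem Frame.mono {W W' : ℕ → ℕ → Bool} {s s' : State} (h : Frame W s s')
    (hW : ∀ κ a, W' κ a = false → W κ a = false) : Frame W' s s' :=
  ⟨fun a ha => h.w a (hW _ _ ha), fun a ha => h.r a (hW _ _ ha),
    fun a ha => h.wa a (hW _ _ ha), fun a ha => h.ra a (hW _ _ ha)⟩

theorem Instr.frame (s : State) (I : Instr) : Frame I.writes s (I.eff s) := by
  cases I <;> constructor <;> intro a ha <;> simp_all [Instr.writes, Instr.eff]

theorem Instr.eq_eff {B : ℕ} {s s' : State} {I : Instr} (h : I.apply B s = some s') :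
    s' = I.eff s := by
  cases I <;> simp only [Instr.apply, State.setW] at h <;> (try split_ifs at h) <;>
    exact (Option.some.inj h).symm

/-- The write set is computed from the syntax, so that for concrete programs the preservation of a
register or array is checked by `rfl`. -/
theorem Exec.frame {B : ℕ} {p : Prog} {s s' : State} {T : ℕ} (h : Exec B p s T s') :
    Frame p.writes s s' := by
  induction h with
  | skip s => exact Frame.refl _ _
  | instr h => rw [Instr.eq_eff h]; exact Instr.frame _ _
  | seq _ _ ih ih' =>
    exact (ih.mono fun κ a h => (Bool.or_eq_false_iff.1 h).1).trans
      (ih'.mono fun κ a h => (Bool.or_eq_false_iff.1 h).2)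
  | ite_true _ _ ih => exact ih.mono fun κ a h => (Bool.or_eq_false_iff.1 h).1
  | ite_false _ _ ih => exact ih.mono fun κ a h => (Bool.or_eq_false_iff.1 h).2
  | while_true _ _ _ ih ih' => exact ih.trans ih'
  | while_false _ => exact Frame.refl _ _

theorem Runs.frame {B : ℕ} {p : Prog} {s : State} {T : ℕ} {Q : State → Prop}
    (h : Runs B p s T Q) : Runs B p s T fun s' => Q s' ∧ Frame p.writes s s' := by
  obtain ⟨t, ht, s', he, hs⟩ := h
  exact ⟨t, ht, s', he, hs, he.frame⟩

/-- While loops: `Inv m` says that at most `m` further rounds are needed. -/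
theorem Runs.loop {B : ℕ} {b : Test} {p : Prog} {T : ℕ} {Inv : ℕ → State → Prop}
    (step : ∀ m s, Inv m s → b.Holds s → ∃ m' < m, Runs B p s T (Inv m')) (m : ℕ) (s : State)
    (h : Inv m s) :
    Runs B (.while b p) s (m * (T + 1) + 1) fun s' => (∃ m, Inv m s') ∧ ¬ b.Holds s' := by
  induction m using Nat.strong_induction_on generalizing s with
  | _ m ih =>
    by_cases hb : b.Holds s
    · obtain ⟨m', hm', t, ht, s', he, hs⟩ := step m s h hb
      obtain ⟨t', ht', s'', he', hs'⟩ := ih m' hm' s' hs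
      refine ⟨t + t' + 1, ?_, s'', .while_true hb he he', hs'⟩
      have : (m' + 1) * (T + 1) ≤ m * (T + 1) := Nat.mul_le_mul_right _ hm'
      have h2 : (m' + 1) * (T + 1) = m' * (T + 1) + (T + 1) := by ring
      omega
    · exact ⟨1, by omega, s, .while_false hb, ⟨m, h⟩, hb⟩

/-- `for i := 0, …, N - 1`, where word register `3` holds the constant `1`. -/
def forLoop (i N : ℕ) (p : Prog) : Prog :=
  .seq (.instr (.wconst i 0)) (.while (.wlt i N) (.seq p (.instr (.wadd i i 3))))

/-- The body has to establish the invariant for the state with the counter already increased. The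
frame passed to `step` saves repeating unchanged registers in the invariant. -/
theorem Runs.forLoop {B i N : ℕ} {p : Prog} {s : State} {m T : ℕ} (Inv : ℕ → State → Prop)
    (hm : s.w N = m) (hone : s.w 3 = 1) (hB : m < B) (hi3 : i ≠ 3) (hiN : i ≠ N)
    (hpi : p.writes 0 i = false) (hp3 : p.writes 0 3 = false) (hpN : p.writes 0 N = false)
    (h0 : Inv 0 (s.updW i 0))
    (step : ∀ j < m, ∀ s', Frame (RealRAM.forLoop i N p).writes s s' → s'.w i = j → Inv j s' →
      Runs B p s' T fun s'' => Inv (j + 1) (s''.updW i (j + 1))) :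
    Runs B (RealRAM.forLoop i N p) s (m * (T + 2) + 2) (Inv m) := by
  have hW : ∀ a, a ≠ i → p.writes 0 a = false → (RealRAM.forLoop i N p).writes 0 a = false :=
    fun a ha hpa => by simp [RealRAM.forLoop, Prog.writes, Instr.writes, ha, hpa]
  have hloop := Runs.loop (B := B) (b := .wlt i N) (p := .seq p (.instr (.wadd i i 3)))
    (T := T + 1) (Inv := fun f s' => Frame (RealRAM.forLoop i N p).writes s s' ∧
      s'.w i + f = m ∧ Inv (s'.w i) s') ?_ m (s.updW i 0) ?_
  · have h1 : Runs B (.instr (.wconst i 0)) s 1 fun s' => s' = s.updW i 0 :=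
      Runs.of_wp ⟨by simp only [Instr.Ok]; omega, rfl⟩
    refine (h1.seq (T' := m * (T + 2) + 1) (Q := Inv m) ?_).mono (by omega) fun _ => id
    rintro _ rfl
    refine hloop.mono le_rfl ?_
    rintro s' ⟨⟨f, hF, hf, hI⟩, hb⟩
    have : s'.w N = m := (hF.w N (hW N hiN.symm hpN)).trans hm
    simp only [Test.Holds, this] at hb
    have : s'.w i = m := by omega
    rwa [this] at hI
  · rintro f s' ⟨hF, hf, hI⟩ hb
    have hN' : s'.w N = m := (hF.w N (hW N hiN.symm hpN)).trans hm
    have h3' : s'.w 3 = 1 := (hF.w 3 (hW 3 hi3.symm hp3)).trans hone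
    simp only [Test.Holds, hN'] at hb
    refine ⟨f - 1, by omega, (step _ hb s' hF rfl hI).frame.seq fun s'' hs'' => ?_⟩
    obtain ⟨hI', hF'⟩ := hs''
    have hi'' : s''.w i = s'.w i := hF'.w i hpi
    have h3'' : s''.w 3 = 1 := (hF'.w 3 hp3).trans h3'
    refine Runs.of_wp ⟨?_, ?_⟩
    · simp only [Instr.Ok, hi'', h3'']; omega
    · have he : Instr.eff s'' (.wadd i i 3) = s''.updW i (s'.w i + 1) := by
        simp only [Instr.eff, hi'', h3'']
      rw [he]
      have hwi : (s''.updW i (s'.w i + 1)).w i = s'.w i + 1 := by simp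
      refine ⟨hF.trans ⟨fun a ha => ?_, fun a ha => ?_, fun a ha => ?_, fun a ha => ?_⟩,
        by rw [hwi]; omega, by rw [hwi]; exact hI'⟩ <;>
      simp only [RealRAM.forLoop, Prog.writes, Instr.writes, Bool.or_eq_false_iff] at ha
      · have : a ≠ i := by simpa using ha.1
        simp only [State.updW_w, if_neg this]
        exact hF'.w a ha.2.1
      · exact hF'.r a ha.2.1
      · exact hF'.wa a ha.2.1
      · exact hF'.ra a ha.2.1
  · refine ⟨⟨fun a ha => ?_, fun _ _ => rfl, fun _ _ => rfl, fun _ _ => rfl⟩, by simp, by simpa⟩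
    simp only [RealRAM.forLoop, Prog.writes, Instr.writes, Bool.or_eq_false_iff] at ha
    have : a ≠ i := by simpa using ha.1
    simp [this]

end RealRAM

/-! ## Distance matrices -/

namespace MetricGraph

variable {V M : Type*} [MetricSpace M]

/-- The distance matrix after the insertion of an edge `{u, v}` of length `L`. -/
noncomputable def matInsert (d : V → V → ℝ) (u v : V) (L : ℝ) (i j : V) : ℝ :=
  min (min (d i j) (d u i + L + d v j)) (d v i + L + d u j)

/-- `d` approximates the shortest path distances in `G`; it satisfies the triangle inequality for
intermediate vertices in `K`, and entries from `W` on are meaningless. -/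
structure IsDistMat (x : V → M) (G : SimpleGraph V) (W : ℝ) (K : V → Prop) (d : V → V → ℝ) :
    Prop where
  diag : ∀ i, d i i = 0
  symm : ∀ i j, d i j = d j i
  nonneg : ∀ i j, 0 ≤ d i j
  tri : ∀ i j k, K k → d i j ≤ d i k + d k j
  adj : ∀ i j, G.Adj i j → d i j ≤ dist (x i) (x j)
  upper : ∀ i j, d i j < W → graphDist x G i j ≤ ENNReal.ofReal (d i j)

/-- All summands are nonnegative, so a new entry below W is built only from meaningful old entries.
-/
theorem matInsert_lt {d : V → V → ℝ} {u v : V} {L W : ℝ} (hd : ∀ i j, 0 ≤ d i j) (hL : 0 ≤ L)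
    {i j : V} (h : matInsert d u v L i j < W) :
    (d i j < W ∧ matInsert d u v L i j = d i j) ∨
    (d u i < W ∧ d v j < W ∧ matInsert d u v L i j = d u i + L + d v j) ∨
    (d v i < W ∧ d u j < W ∧ matInsert d u v L i j = d v i + L + d u j) := by
  have h1 := hd u i; have h2 := hd v j; have h3 := hd v i; have h4 := hd u j
  unfold matInsert at h ⊢
  rcases min_choice (min (d i j) (d u i + L + d v j)) (d v i + L + d u j) with h5 | h5
  · rw [h5] at h ⊢
    rcases min_choice (d i j) (d u i + L + d v j) with h6 | h6
    · rw [h6] at h ⊢; exact Or.inl ⟨h, rfl⟩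
    · rw [h6] at h ⊢; exact Or.inr (Or.inl ⟨by linarith, by linarith, rfl⟩)
  · rw [h5] at h ⊢; exact Or.inr (Or.inr ⟨by linarith, by linarith, rfl⟩)

/-- The common part of a Floyd-Warshall step (u = v, L = 0, same graph) and of the insertion of an
edge; only the triangle inequality needs separate arguments. -/
theorem IsDistMat.insert {x : V → M} {G H : SimpleGraph V} {W L : ℝ} {K K' : V → Prop}
    {d : V → V → ℝ} (h : IsDistMat x G W K d) {u v : V} (hL : 0 ≤ L) (hGH : G ≤ H)
    (huv : graphDist x H u v ≤ ENNReal.ofReal L)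
    (hH : ∀ i j, H.Adj i j → G.Adj i j ∨ (L = dist (x u) (x v) ∧
      (i = u ∧ j = v ∨ i = v ∧ j = u)))
    (htri : ∀ i j k, K' k → matInsert d u v L i j ≤ matInsert d u v L i k + matInsert d u v L k j) :
    IsDistMat x H W K' (matInsert d u v L) where
  diag i := by
    have := h.diag i; have := h.nonneg u i; have := h.nonneg v i
    unfold matInsert
    rw [min_eq_left, min_eq_left] <;> [skip; linarith; rw [min_eq_left] <;> linarith]
    assumption
  symm i j := by
    unfold matInsert
    rw [h.symm i j, min_assoc, min_assoc, min_comm (d u i + L + d v j), add_right_comm (d v i),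
      add_right_comm (d u i), add_comm (d v i), add_comm (d u i), add_right_comm (d u j),
      add_right_comm (d v j)]
  nonneg i j := by
    have := h.nonneg i j; have := h.nonneg u i; have := h.nonneg v j
    have := h.nonneg v i; have := h.nonneg u j
    refine le_min (le_min ?_ ?_) ?_ <;> positivity
  tri := htri
  adj i j hij := by
    rcases hH i j hij with hG | ⟨rfl, ⟨rfl, rfl⟩ | ⟨rfl, rfl⟩⟩
    · exact ((min_le_left _ _).trans (min_le_left _ _)).trans (h.adj i j hG)
    · refine ((min_le_left _ _).trans (min_le_right _ _)).trans ?_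
      rw [h.diag, h.diag]; linarith
    · refine (min_le_right _ _).trans ?_
      rw [h.diag, h.diag, dist_comm]; linarith
  upper i j hij := by
    have key : ∀ a b, d a b < W → graphDist x H a b ≤ ENNReal.ofReal (d a b) := fun a b hab =>
      (graphDist_anti x hGH a b).trans (h.upper a b hab)
    rcases matInsert_lt h.nonneg hL hij with ⟨h1, h2⟩ | ⟨h1, h2, h3⟩ | ⟨h1, h2, h3⟩
    · rw [h2]; exact key i j h1
    · rw [h3, ENNReal.ofReal_add (add_nonneg (h.nonneg _ _) hL) (h.nonneg _ _),
        ENNReal.ofReal_add (h.nonneg _ _) hL]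
      refine (graphDist_triangle x H i v j).trans (add_le_add
        ((graphDist_triangle x H i u v).trans (add_le_add ?_ huv)) (key v j h2))
      rw [graphDist_comm]; exact key u i h1
    · rw [h3, ENNReal.ofReal_add (add_nonneg (h.nonneg _ _) hL) (h.nonneg _ _),
        ENNReal.ofReal_add (h.nonneg _ _) hL]
      refine (graphDist_triangle x H i u j).trans (add_le_add
        ((graphDist_triangle x H i v u).trans (add_le_add ?_ ?_)) (key u j h2))
      · rw [graphDist_comm]; exact key v i h1
      · rw [graphDist_comm]; exact huv

/-- A step of the Floyd-Warshall algorithm. -/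
theorem IsDistMat.insert_vertex {x : V → M} {G : SimpleGraph V} {W : ℝ} {K : V → Prop}
    {d : V → V → ℝ} (h : IsDistMat x G W K d) (v : V) :
    IsDistMat x G W (fun k => K k ∨ k = v) (matInsert d v v 0) := by
  have hm : ∀ i j, matInsert d v v 0 i j = min (d i j) (d i v + d v j) := fun i j => by
    unfold matInsert; rw [min_assoc, min_self, add_zero, h.symm v i]
  refine h.insert le_rfl le_rfl (by simp [graphDist_self]) (fun i j => Or.inl) ?_
  intro i j k hk
  rw [hm, hm, hm]
  have h0 := h.diag v
  rcases hk with hk | rfl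
  · have h1 := h.tri i j k hk
    have h2 := h.tri v j k hk
    have h3 := h.tri i v k hk
    have h4 := h.nonneg v k
    have h5 := h.nonneg k v
    rcases min_choice (d i k) (d i v + d v k) with h6 | h6 <;>
    rcases min_choice (d k j) (d k v + d v j) with h7 | h7 <;> rw [h6, h7]
    · exact (min_le_left _ _).trans h1
    all_goals exact (min_le_right _ _).trans (by linarith)
  · rw [h0, add_zero, zero_add, min_self, min_self]
    exact min_le_right _ _

/-- A shortest route uses the new edge at most once: if both parts of a route via k use it, a route
with one use or none is no longer. This is checked in all nine combinations. -/
theorem IsDistMat.insert_edge {x : V → M} {G H : SimpleGraph V} {W : ℝ}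
    {d : V → V → ℝ} (h : IsDistMat x G W (fun _ => True) d) {u v : V} (hGH : G ≤ H)
    (huv : H.Adj u v) (hH : ∀ i j, H.Adj i j → G.Adj i j ∨ (i = u ∧ j = v ∨ i = v ∧ j = u)) :
    IsDistMat x H W (fun _ => True) (matInsert d u v (dist (x u) (x v))) := by
  refine h.insert dist_nonneg hGH (graphDist_adj x huv)
    (fun i j hij => (hH i j hij).imp id fun h => ⟨rfl, h⟩) ?_
  intro i j k _
  have hL : 0 ≤ dist (x u) (x v) := dist_nonneg
  set L := dist (x u) (x v)
  have hle1 : matInsert d u v L i j ≤ d i j := (min_le_left _ _).trans (min_le_left _ _)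
  have hle2 : matInsert d u v L i j ≤ d u i + L + d v j := (min_le_left _ _).trans (min_le_right _ _)
  have hle3 : matInsert d u v L i j ≤ d v i + L + d u j := min_le_right _ _
  have t := fun a b c => h.tri a b c trivial
  have sy := h.symm
  have hn := h.nonneg
  have c1 : ∀ i j, matInsert d u v L i j = d i j ∨ matInsert d u v L i j = d u i + L + d v j ∨
      matInsert d u v L i j = d v i + L + d u j := fun i j => by
    rcases matInsert_lt hn hL (lt_add_one (matInsert d u v L i j)) with h | h | h
    · exact Or.inl h.2
    · exact Or.inr (Or.inl h.2.2)
    · exact Or.inr (Or.inr h.2.2)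
  have e1 := t i j k
  have e2 := t v j k
  have e3 := t u j k
  have e4 := t u i k
  have e5 := t v i k
  rw [sy k i] at e4 e5
  have e8 := t i j u
  have e9 := t i j v
  rw [sy i u] at e8
  rw [sy i v] at e9
  have e6 := hn u k
  have e7 := hn v k
  rcases c1 i k with h1 | h1 | h1 <;> rcases c1 k j with h2 | h2 | h2 <;> rw [h1, h2] <;>
  linarith [hn u i, hn v i, hn u j, hn v j]

/-- Sum the edge bounds along a walk by the triangle inequality. No restriction to entries below W
is needed in this direction. -/
theorem IsDistMat.le_graphDist {x : V → M} {G : SimpleGraph V} {W : ℝ}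
    {d : V → V → ℝ} (h : IsDistMat x G W (fun _ => True) d) (u v : V) :
    ENNReal.ofReal (d u v) ≤ graphDist x G u v := by
  refine le_iInf fun p => ?_
  rw [walkWeight_eq]
  refine ENNReal.ofReal_le_ofReal ?_
  induction p with
  | nil => simp [h.diag]
  | @cons a b c hab p ih =>
    rw [walkSum_cons, edgeLen_mk]
    exact (h.tri a c b trivial).trans (add_le_add (h.adj a b hab) ih)

/-- The matrix of edge lengths, with `W` for the missing edges. -/
theorem isDistMat_edges {x : V → M} {G : SimpleGraph V} {W : ℝ} (hW : 0 ≤ W) {d : V → V → ℝ}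
    (hdiag : ∀ i, d i i = 0) (hadj : ∀ i j, G.Adj i j → d i j = dist (x i) (x j))
    (hnadj : ∀ i j, i ≠ j → ¬ G.Adj i j → d i j = W) :
    IsDistMat x G W (fun _ => False) d := by
  refine ⟨hdiag, fun i j => ?_, fun i j => ?_, fun _ _ _ => False.elim,
    fun i j h => (hadj i j h).le, fun i j h => ?_⟩ <;>
  rcases eq_or_ne i j with rfl | hne
  · rfl
  · by_cases hij : G.Adj i j
    · rw [hadj i j hij, hadj j i hij.symm, dist_comm]
    · rw [hnadj i j hne hij, hnadj j i hne.symm fun h => hij h.symm]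
  · exact (hdiag i).ge
  · by_cases hij : G.Adj i j
    · rw [hadj i j hij]; exact dist_nonneg
    · rwa [hnadj i j hne hij]
  · simp [graphDist_self]
  · by_cases hij : G.Adj i j
    · rw [hadj i j hij]; exact graphDist_adj x hij
    · exact absurd (hnadj i j hne hij) h.ne

end MetricGraph

/-! ## Matrix routines -/

namespace RealRAM

open Instr Test

instance : Coe Instr Prog := ⟨Prog.instr⟩

local infixr:65 " ;; " => Prog.seq

/-- The registers that hold `n`, `1`, `0` and `n * n` throughout. -/
structure Std (n : ℕ) (s : State) : Prop where
  w0 : s.w 0 = n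
  w3 : s.w 3 = 1
  w4 : s.w 4 = 0
  w5 : s.w 5 = n * n

theorem Std.of_frame {n : ℕ} {W : ℕ → ℕ → Bool} {s s' : State} (h : Std n s) (hF : Frame W s s')
    (hW : W 0 0 = false ∧ W 0 3 = false ∧ W 0 4 = false ∧ W 0 5 = false) : Std n s' :=
  ⟨(hF.w 0 hW.1).trans h.w0, (hF.w 3 hW.2.1).trans h.w3, (hF.w 4 hW.2.2.1).trans h.w4,
    (hF.w 5 hW.2.2.2).trans h.w5⟩

/-- Words are large enough for the matrix routines. -/
def WordBound (n B : ℕ) : Prop := 0 < n ∧ 2 * (n * n) + n + 2 < B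

attribute [local simp] wp Instr.Ok Instr.eff Test.Holds

theorem div_facts (j n : ℕ) : j / n * n ≤ j ∧ j / n ≤ j ∧ j - j / n * n = j % n := by
  have := Nat.div_add_mod' j n
  exact ⟨Nat.div_mul_le_self j n, Nat.div_le_self j n, by omega⟩

theorem forall_le_of {P : ℕ → Prop} {j : ℕ} (h : ∀ c < j, P c) (hj : P j) : ∀ c ≤ j, P c :=
  fun c hc => hc.eq_or_lt.elim (fun h' => h' ▸ hj) (h c)

section Cell

variable {n : ℕ} (i j : Fin n)

theorem cell_lt : (i * n + j : ℕ) < n * n := by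
  have h1 : (i : ℕ) + 1 ≤ n := i.2
  nlinarith [j.2]

theorem cell_div : (i * n + j : ℕ) / n = i := by
  have := i.pos
  rw [mul_comm, Nat.mul_add_div this, Nat.div_eq_of_lt j.2, add_zero]

theorem cell_mod : (i * n + j : ℕ) % n = j := by
  rw [mul_comm, Nat.mul_add_mod, Nat.mod_eq_of_lt j.2]

end Cell

/-- Initialize the matrix in real array `1`, for the graph with adjacency matrix in word array `A`;
clear word array `3`. -/
def initMat (A : ℕ) : Prog := forLoop 10 5 <|
  wdiv 11 10 0 ;; wmul 12 11 0 ;; wsub 12 10 12 ;; wstore 3 10 4 ;;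
  .ite (weq 11 12) (rconst 8 0)
    (wload 13 A 10 ;; .ite (weq 13 4) (rmov 8 3) (rload 8 0 10)) ;;
  rstore 1 10 8

theorem runs_initMat {n B A : ℕ} {s : State} (hB : WordBound n B) (hs : Std n s) (hA : A ≠ 3)
    (hAB : ∀ c, s.wa A c < B) :
    Runs B (initMat A) s (15 * (n * n) + 2) fun s' => ∀ c < n * n, s'.wa 3 c = 0 ∧
      s'.ra 1 c = if c / n = c % n then 0 else if s.wa A c = 0 then s.r 3 else s.ra 0 c := by
  obtain ⟨hn, hB⟩ := hB
  refine (Runs.forLoop (m := n * n) (T := 9) (fun j s' => ∀ c < j, s'.wa 3 c = 0 ∧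
      s'.ra 1 c = if c / n = c % n then 0 else if s.wa A c = 0 then s.r 3 else s.ra 0 c)
    hs.w5 hs.w3 (by omega) (by decide) (by decide) rfl rfl rfl (by simp) ?_).mono
    (by omega) fun _ => id
  intro j hj s' hF hi hI
  obtain ⟨h0, h3, h4, h5⟩ := hs.of_frame hF ⟨rfl, rfl, rfl, rfl⟩
  have hA' : s'.wa A = s.wa A := hF.wa A (by
    simp [forLoop, Prog.writes, Instr.writes, hA])
  have hr3 : s'.r 3 = s.r 3 := hF.r 3 rfl
  have hra : s'.ra 0 = s.ra 0 := hF.ra 0 rfl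
  refine (Runs.of_wp ?_).mono (Nat.le_of_ble_eq_true rfl) fun _ => id
  obtain ⟨h6, h7, h8⟩ := div_facts j n
  have h9 := hAB j
  have key : ∀ y : ℝ, (y = if j / n = j % n then 0 else if s.wa A j = 0 then s.r 3 else s.ra 0 j) →
      ∀ c ≤ j, Function.update (s'.wa 3) j 0 c = 0 ∧ Function.update (s'.ra 1) j y c =
        if c / n = c % n then 0 else if s.wa A c = 0 then s.r 3 else s.ra 0 c := by
    intro y hy c hc
    rcases hc.eq_or_lt with rfl | hc
    · simpa using hy
    · rw [Function.update_of_ne hc.ne, Function.update_of_ne hc.ne]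
      exact hI c hc
  simp [h0, h4, hi, hr3, hra, hA, hA', h8]
  refine ⟨⟨by omega, by omega⟩, by omega, by omega, fun h => key 0 (by simp [h]), fun h =>
    ⟨by omega, fun h' => key _ (by simp [h, h']), fun h' => key _ (by simp [h, h'])⟩⟩

/-- Copy row `w u` of the matrix in real array `1` to real array `X`. -/
def copyRow (X u : ℕ) : Prog := forLoop 10 0 <|
  wmul 11 u 0 ;; wadd 11 11 10 ;; rload 8 1 11 ;; rstore X 10 8

theorem runs_copyRow {n B X u : ℕ} {s : State} (hB : WordBound n B) (hs : Std n s) (hX : X ≠ 1)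
    (hu10 : u ≠ 10) (hu11 : u ≠ 11) (hu : s.w u < n) :
    Runs B (copyRow X u) s (6 * n + 2) fun s' => ∀ b < n, s'.ra X b = s.ra 1 (s.w u * n + b) := by
  obtain ⟨hn, hB⟩ := hB
  refine (Runs.forLoop (m := n) (T := 4) (fun j s' => ∀ b < j, s'.ra X b = s.ra 1 (s.w u * n + b))
    hs.w0 hs.w3 (by omega) (by decide) (by decide) rfl rfl rfl (by simp) ?_).mono
    (by omega) fun _ => id
  intro j hj s' hF hi hI
  obtain ⟨h0, h3, h4, h5⟩ := hs.of_frame hF ⟨rfl, rfl, rfl, rfl⟩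
  have hwu : s'.w u = s.w u := hF.w u (by simp [forLoop, Prog.writes, Instr.writes, hu10, hu11])
  have hra : s'.ra 1 = s.ra 1 := hF.ra 1 (by simp [forLoop, Prog.writes, Instr.writes, hX.symm])
  refine (Runs.of_wp ?_).mono (Nat.le_of_ble_eq_true rfl) fun _ => id
  have h6 : s.w u * n + n ≤ n * n := by nlinarith
  simp [h0, hi, hwu, hra]
  refine ⟨by omega, by omega, fun c hc => ?_⟩
  rcases hc.eq_or_lt with rfl | hc
  · simp
  · rw [Function.update_of_ne hc.ne]; exact hI c hc

/-- Improve the matrix in real array `1` by the sums of the entries of two vectors and `r 9`. -/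
def relax (X Y : ℕ) : Prog := forLoop 10 5 <|
  wdiv 11 10 0 ;; wmul 12 11 0 ;; wsub 12 10 12 ;; rload 8 X 11 ;; radd 8 8 9 ;; rload 10 Y 12 ;;
  radd 8 8 10 ;; rload 10 1 10 ;; .ite (rlt 8 10) (rstore 1 10 8) .skip

/-- The invariant also records that cells not yet visited are unchanged, as the matrix is updated in
place. -/
theorem runs_relax {n B X Y : ℕ} {s : State} (hB : WordBound n B) (hs : Std n s) (hX : X ≠ 1)
    (hY : Y ≠ 1) :
    Runs B (relax X Y) s (12 * (n * n) + 2) fun s' => ∀ c < n * n,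
      s'.ra 1 c = min (s.ra 1 c) (s.ra X (c / n) + s.r 9 + s.ra Y (c % n)) := by
  obtain ⟨hn, hB⟩ := hB
  refine (Runs.forLoop (m := n * n) (T := 10) (fun j s' => (∀ c < j,
      s'.ra 1 c = min (s.ra 1 c) (s.ra X (c / n) + s.r 9 + s.ra Y (c % n))) ∧
      ∀ c, j ≤ c → s'.ra 1 c = s.ra 1 c)
    hs.w5 hs.w3 (by omega) (by decide) (by decide) rfl rfl rfl (by simp) ?_).mono
    (by omega) fun _ h => h.1
  intro j hj s' hF hi hI
  obtain ⟨h0, h3, h4, h5⟩ := hs.of_frame hF ⟨rfl, rfl, rfl, rfl⟩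
  have hr9 : s'.r 9 = s.r 9 := hF.r 9 rfl
  have hraX : s'.ra X = s.ra X := hF.ra X (by simp [forLoop, Prog.writes, Instr.writes, hX])
  have hraY : s'.ra Y = s.ra Y := hF.ra Y (by simp [forLoop, Prog.writes, Instr.writes, hY])
  refine (Runs.of_wp ?_).mono (Nat.le_of_ble_eq_true rfl) fun _ => id
  obtain ⟨h6, h7, h8⟩ := div_facts j n
  have hj' := hI.2 j le_rfl
  simp [h0, hi, hr9, hraX, hraY, h8, hj']
  refine ⟨⟨by omega, by omega⟩, by omega, by omega, fun h => ⟨fun c hc => ?_, fun c hc => ?_⟩,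
    fun h => ⟨fun c hc => ?_, fun c hc => ?_⟩⟩
  · rcases hc.eq_or_lt with rfl | hc
    · rw [Function.update_self, min_eq_right h.le]
    · rw [Function.update_of_ne hc.ne]; exact hI.1 c hc
  · rw [Function.update_of_ne (by omega)]; exact hI.2 c (by omega)
  · rcases hc.eq_or_lt with rfl | hc
    · rw [min_eq_left h, hj']
    · exact hI.1 c hc
  · exact hI.2 c (by omega)

/-- Insert an edge of length `r 9` between the vertices in word registers `15` and `16` into the
matrix in real array `1`. -/
def insertEdge : Prog := copyRow 3 15 ;; copyRow 4 16 ;; relax 3 4 ;; relax 4 3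

/-- The matrix with the entries of an array. -/
def toMat (n : ℕ) (D : ℕ → ℝ) (i j : Fin n) : ℝ := D (i * n + j)

/-- Both rows are copied first, since each relaxation needs their old entries. The two relaxations
are the two minima in `matInsert`. -/
theorem runs_insertEdge {n B : ℕ} {s : State} (hB : WordBound n B) (hs : Std n s)
    (hu : s.w 15 < n) (hv : s.w 16 < n) :
    Runs B insertEdge s (44 * (n * n)) fun s' => toMat n (s'.ra 1) =
      MetricGraph.matInsert (toMat n (s.ra 1)) ⟨s.w 15, hu⟩ ⟨s.w 16, hv⟩ (s.r 9) := by
  have hn := hB.1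
  have hnn : n ≤ n * n := Nat.le_mul_self n
  have h1nn : 1 ≤ n * n := Nat.mul_pos hn hn
  refine Runs.mono ((runs_copyRow (X := 3) (u := 15) hB hs (by decide) (by decide) (by decide)
    hu).frame.seq (T' := (6 * n + 2) + ((12 * (n * n) + 2) + (12 * (n * n) + 2))) fun s1 h1 => ?_)
    (by omega) fun _ => id
  obtain ⟨hr1, hF1⟩ := h1
  have hs1 := hs.of_frame hF1 ⟨rfl, rfl, rfl, rfl⟩
  have hv1 : s1.w 16 = s.w 16 := hF1.w 16 rfl
  have ha1 : s1.ra 1 = s.ra 1 := hF1.ra 1 rfl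
  refine (runs_copyRow (X := 4) (u := 16) hB hs1 (by decide) (by decide) (by decide)
    (hv1 ▸ hv)).frame.seq fun s2 h2 => ?_
  obtain ⟨hr2, hF2⟩ := h2
  have hs2 := hs1.of_frame hF2 ⟨rfl, rfl, rfl, rfl⟩
  have ha2 : s2.ra 1 = s.ra 1 := (hF2.ra 1 rfl).trans ha1
  have hx2 : s2.ra 3 = s1.ra 3 := hF2.ra 3 rfl
  refine (runs_relax (X := 3) (Y := 4) hB hs2 (by decide) (by decide)).frame.seq fun s3 h3 => ?_
  obtain ⟨hr3, hF3⟩ := h3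
  have hs3 := hs2.of_frame hF3 ⟨rfl, rfl, rfl, rfl⟩
  have hx3 : s3.ra 3 = s1.ra 3 := (hF3.ra 3 rfl).trans hx2
  have hy3 : s3.ra 4 = s2.ra 4 := hF3.ra 4 rfl
  have hL1 : s1.r 9 = s.r 9 := hF1.r 9 rfl
  have hL2 : s2.r 9 = s.r 9 := (hF2.r 9 rfl).trans hL1
  have hL3 : s3.r 9 = s.r 9 := (hF3.r 9 rfl).trans hL2
  refine (runs_relax (X := 4) (Y := 3) hB hs3 (by decide) (by decide)).mono le_rfl fun s4 h4 => ?_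
  funext i j
  have hc := cell_lt i j
  rw [toMat, h4 _ hc, hr3 _ hc, cell_div, cell_mod, hx3, hy3, hL3, hL2, hx2, ha2,
    hr1 _ i.2, hr1 _ j.2, hr2 _ i.2, hr2 _ j.2, ha1, hv1]
  rfl

/-- All shortest path distances by the Floyd-Warshall algorithm. -/
def floydWarshall : Prog :=
  rconst 9 0 ;; forLoop 17 0 (wmov 15 17 ;; wmov 16 17 ;; insertEdge)

theorem runs_floydWarshall {n B : ℕ} {s : State} (hB : WordBound n B) (hs : Std n s)
    {M : Type*} [MetricSpace M] {x : Fin n → M} {G : SimpleGraph (Fin n)} {W : ℝ}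
    (hd : MetricGraph.IsDistMat x G W (fun _ => False) (toMat n (s.ra 1))) :
    Runs B floydWarshall s (51 * (n * n * n)) fun s' =>
      MetricGraph.IsDistMat x G W (fun _ => True) (toMat n (s'.ra 1)) := by
  have hn := hB.1
  have hnn : n ≤ n * n := Nat.le_mul_self n
  have h1nn : 1 ≤ n * n := Nat.mul_pos hn hn
  have hnB : n < B := by have := hB.2; omega
  have h1 : Runs B (rconst 9 0 : Instr) s 1 fun s' => s' = s.setR 9 0 := Runs.of_wp (by simp)
  refine Runs.mono (h1.seq (T' := n * (44 * (n * n) + 2 + 2) + 2) fun s1 hs1 => ?_) ?_ fun _ => id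
  swap
  · have : n * (44 * (n * n) + 2 + 2) = 44 * (n * n * n) + 4 * n := by ring
    have : n * n ≤ n * n * n := Nat.le_mul_of_pos_right _ hn
    omega
  subst hs1
  have hs1 : Std n (s.setR 9 0) := ⟨hs.w0, hs.w3, hs.w4, hs.w5⟩
  refine (Runs.forLoop (m := n) (T := 44 * (n * n) + 2) (fun j s' =>
      MetricGraph.IsDistMat x G W (fun k => (k : ℕ) < j) (toMat n (s'.ra 1)))
    hs1.w0 hs1.w3 hnB (by decide) (by decide) rfl rfl rfl ?_ ?_).mono le_rfl fun s' h => ?_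
  · simpa using hd
  · intro j hj s' hF hi hI
    have hs' := hs1.of_frame hF ⟨rfl, rfl, rfl, rfl⟩
    have h9 : s'.r 9 = 0 := (hF.r 9 rfl).trans (by simp)
    have ha : Runs B (wmov 15 17 : Instr) s' 1 fun t => t = s'.updW 15 j :=
      Runs.of_wp (by simp [hi]; omega)
    refine Runs.mono (ha.seq (T' := 1 + 44 * (n * n)) ?_) (by omega) fun _ => id
    rintro _ rfl
    have hb : Runs B (wmov 16 17 : Instr) (s'.updW 15 j) 1 fun t =>
        t = (s'.updW 15 j).updW 16 j := Runs.of_wp (by simp [hi]; omega)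
    refine hb.seq ?_
    rintro _ rfl
    refine (runs_insertEdge hB (s := (s'.updW 15 j).updW 16 j)
      ⟨hs'.w0, hs'.w3, hs'.w4, hs'.w5⟩ (by simpa) (by simpa)).mono le_rfl fun t ht => ?_
    have hins := hI.insert_vertex ⟨j, hj⟩
    simp only [State.updW_ra, ht, State.updW_w, State.updW_r, h9]
    convert hins using 2 with k
    · simp [Fin.ext_iff, Nat.le_iff_lt_or_eq]
    · simp
    · simp
  · convert h using 2 with k
    simp

/-- Find a shortest pair that violates the threshold `r 1`. -/
def scan : Prog :=
  wconst 18 0 ;; forLoop 10 5 (rload 8 0 10 ;; rmul 12 1 8 ;; rload 13 1 10 ;;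
    .ite (rlt 12 13)
      (.ite (weq 18 4) (wconst 18 1 ;; wmov 19 10 ;; rmov 11 8)
        (.ite (rlt 8 11) (wconst 18 1 ;; wmov 19 10 ;; rmov 11 8) .skip)) .skip)

/-- The result of `scan` on the first `j` cells. -/
def ScanPost (τ : ℝ) (D₀ D : ℕ → ℝ) (j : ℕ) (s : State) : Prop :=
  (s.w 18 = 0 ∧ ∀ c < j, D c ≤ τ * D₀ c) ∨
  (s.w 18 = 1 ∧ s.w 19 < j ∧ τ * D₀ (s.w 19) < D (s.w 19) ∧ s.r 11 = D₀ (s.w 19) ∧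
    ∀ c < j, D₀ c < D₀ (s.w 19) → D c ≤ τ * D₀ c)

theorem runs_scan {n B : ℕ} {s : State} (hB : WordBound n B) (hs : Std n s) :
    Runs B scan s (12 * (n * n) + 3) (ScanPost (s.r 1) (s.ra 0) (s.ra 1) (n * n)) := by
  obtain ⟨hn, hB⟩ := hB
  have h1 : Runs B (wconst 18 0 : Instr) s 1 fun s' => s' = s.updW 18 0 :=
    Runs.of_wp (by simp; omega)
  refine Runs.mono (h1.seq (T' := n * n * (9 + 2) + 2) ?_) (by omega) fun _ => id
  rintro _ rfl
  have hs1 : Std n (s.updW 18 0) := ⟨hs.w0, hs.w3, hs.w4, hs.w5⟩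
  refine Runs.forLoop (ScanPost (s.r 1) (s.ra 0) (s.ra 1)) hs1.w5 hs1.w3 (by omega) (by decide)
    (by decide) rfl rfl rfl (by simp [ScanPost]) ?_
  intro j hj s' hF hi hI
  have h4 : s'.w 4 = 0 := (hF.w 4 rfl).trans hs1.w4
  have hr1 : s'.r 1 = s.r 1 := hF.r 1 rfl
  have ha0 : s'.ra 0 = s.ra 0 := hF.ra 0 rfl
  have ha1 : s'.ra 1 = s.ra 1 := hF.ra 1 rfl
  refine (Runs.of_wp ?_).mono (Nat.le_of_ble_eq_true rfl) fun _ => id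
  simp [h4, hi, hr1, ha0, ha1, ScanPost]
  simp only [ScanPost] at hI
  refine ⟨fun h => ⟨fun h18 => ⟨by omega, by omega, h, ?_⟩, fun h18 => ⟨fun hlt =>
    ⟨by omega, by omega, h, ?_⟩, fun hge => ?_⟩⟩, fun h => ?_⟩
  · rcases hI with hI | hI
    · exact forall_le_of (fun c hc _ => hI.2 c hc) fun h => absurd h (lt_irrefl _)
    · omega
  · rcases hI with hI | hI
    · omega
    · exact forall_le_of (fun c hc hlt' => hI.2.2.2.2 c hc (by rw [← hI.2.2.2.1]; exact hlt'.trans hlt))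
        fun h => absurd h (lt_irrefl _)
  · rcases hI with hI | hI
    · omega
    · refine Or.inr ⟨hI.1, hI.2.1.le, hI.2.2.1, hI.2.2.2.1,
        forall_le_of hI.2.2.2.2 fun hlt' => ?_⟩
      rw [← hI.2.2.2.1] at hlt'; linarith
  · rcases hI with hI | hI
    · exact Or.inl ⟨hI.1, forall_le_of hI.2 h⟩
    · exact Or.inr ⟨hI.1, hI.2.1.le, hI.2.2.1, hI.2.2.2.1, forall_le_of hI.2.2.2.2 fun _ => h⟩

end RealRAM

/-! ## The greedy algorithm -/

namespace MetricGraph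

variable {V M : Type*} [MetricSpace M]

theorem IsDistMat.lt_graphDist {x : V → M} {G : SimpleGraph V} {W r : ℝ} {d : V → V → ℝ}
    (h : IsDistMat x G W (fun _ => True) d) {u v : V} (hr : 0 ≤ r) (hlt : r < d u v) :
    ENNReal.ofReal r < graphDist x G u v :=
  ((ENNReal.ofReal_lt_ofReal_iff_of_nonneg hr).2 hlt).trans_le (h.le_graphDist u v)

theorem IsDistMat.graphDist_le {x : V → M} {G : SimpleGraph V} {W r : ℝ} {K : V → Prop}
    {d : V → V → ℝ} (h : IsDistMat x G W K d) {u v : V} (hle : d u v ≤ r) (hr : r < W) :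
    graphDist x G u v ≤ ENNReal.ofReal r :=
  (h.upper u v (hle.trans_lt hr)).trans (ENNReal.ofReal_le_ofReal hle)

variable [DecidableEq V]

theorem firstPairs_update {e : ℕ → V × V} {m i : ℕ} (q : V × V) (hi : i ≤ m) :
    firstPairs (Function.update e m q) i = firstPairs e i := by
  refine Finset.image_congr fun j hj => Function.update_of_ne ?_ _ _
  have := Finset.mem_range.1 hj
  omega

theorem firstPairs_succ (e : ℕ → V × V) (m : ℕ) :
    firstPairs e (m + 1) = insert (e m) (firstPairs e m) := by
  rw [firstPairs, Finset.range_add_one, Finset.image_insert]; rfl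

theorem firstPairs_card_le (e : ℕ → V × V) (m : ℕ) : (firstPairs e m).card ≤ m :=
  Finset.card_image_le.trans (Finset.card_range m).le

theorem IsGreedySeq.snoc {x : V → M} {G : SimpleGraph V} {τ : ℝ} {e : ℕ → V × V} {m : ℕ}
    (h : IsGreedySeq x G τ e m) {q : V × V}
    (hq : ENNReal.ofReal (τ * dist (x q.1) (x q.2)) <
      graphDist x (addEdges G (firstPairs e m)) q.1 q.2)
    (hmin : ∀ a b, dist (x a) (x b) < dist (x q.1) (x q.2) →
      graphDist x (addEdges G (firstPairs e m)) a b ≤ ENNReal.ofReal (τ * dist (x a) (x b))) :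
    IsGreedySeq x G τ (Function.update e m q) (m + 1) := fun i hi => by
  rw [firstPairs_update q (Nat.lt_succ_iff.1 hi)]
  rcases (Nat.lt_succ_iff.1 hi).eq_or_lt with rfl | hi
  · rw [Function.update_self]; exact ⟨hq, hmin⟩
  · rw [Function.update_of_ne hi.ne]; exact h i hi

end MetricGraph

namespace RealRAM

open Instr Test MetricGraph

attribute [local simp] wp Instr.Ok Instr.eff Test.Holds

local infixr:65 " ;; " => Prog.seq

/-- Add the pair in cell `w 19` of length `r 11`. -/
def addPair : Prog :=
  (wstore 3 19 3 ;; rstore 2 7 11 ;; wadd 7 7 3 ;; wdiv 15 19 0 ;; wmul 16 15 0 ;; wsub 16 19 16 ;;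
    rmov 9 11) ;; insertEdge

/-- A round of the greedy algorithm. -/
def greedyRound : Prog :=
  scan ;; .ite (weq 18 4) (wconst 9 1 ;; wconst 8 0)
    (.ite (wlt 7 6) addPair (wconst 9 0 ;; wconst 8 0))

/-- The greedy algorithm with threshold `r 1` for at most `w 6` pairs, for the graph with adjacency
matrix in word array `A`. It reports in `w 9` whether it succeeds. -/
def greedy (A : ℕ) : Prog :=
  (rmul 3 1 2 ;; rconst 8 1 ;; radd 3 3 8) ;; initMat A ;; floydWarshall ;;
  (wconst 7 0 ;; wconst 8 1) ;; .while (wlt 4 8) greedyRound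

variable {n B A : ℕ} {M : Type*} [MetricSpace M] {x : Fin n → M} {G : SimpleGraph (Fin n)}

/-- The distance matrix is present, and `r 2` bounds all distances. -/
structure HasDist (x : Fin n → M) (s : State) : Prop where
  std : Std n s
  dist : toMat n (s.ra 0) = fun i j => dist (x i) (x j)
  bound : ∀ i j, Dist.dist (x i) (x j) ≤ s.r 2

theorem HasDist.of_frame {W : ℕ → ℕ → Bool} {s s' : State} (h : HasDist x s) (hF : Frame W s s')
    (hW : W 0 0 = false ∧ W 0 3 = false ∧ W 0 4 = false ∧ W 0 5 = false)
    (h2 : W 1 2 = false) (h0 : W 3 0 = false) : HasDist x s' :=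
  ⟨h.std.of_frame hF hW, by rw [hF.ra 0 h0]; exact h.dist, by rw [hF.r 2 h2]; exact h.bound⟩

/-- Word array `A` holds the adjacency matrix of `G`. -/
structure HasGraph (B A : ℕ) (G : SimpleGraph (Fin n)) (s : State) : Prop where
  lt : ∀ c, s.wa A c < B
  adj : ∀ i j : Fin n, s.wa A (i * n + j) ≠ 0 ↔ G.Adj i j

/-- The pairs `e 0, …, e (m - 1)` have been found. -/
structure Found (x : Fin n → M) (G : SimpleGraph (Fin n)) (τ : ℝ) (e : ℕ → Fin n × Fin n) (m : ℕ)
    (s : State) : Prop where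
  seq : IsGreedySeq x G τ e m
  count : s.w 7 = m
  len : ∀ i < m, s.ra 2 i = dist (x (e i).1) (x (e i).2)
  val : ∀ i j : Fin n, s.wa 3 (i * n + j) = if (i, j) ∈ firstPairs e m then 1 else 0

/-- The outcome of the greedy algorithm. -/
def GreedyPost (x : Fin n → M) (G : SimpleGraph (Fin n)) (τ : ℝ) (K : ℕ) (s : State) : Prop :=
  ∃ e m, m ≤ K ∧ Found x G τ e m s ∧
    ((s.w 9 = 1 ∧ IsSpanner x (addEdges G (firstPairs e m)) (ENNReal.ofReal τ)) ∨
      (s.w 9 = 0 ∧ ∃ e', IsGreedySeq x G τ e' (K + 1)))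

theorem exists_cell {c : ℕ} (hn : 0 < n) (hc : c < n * n) :
    ∃ u v : Fin n, (u : ℕ) = c / n ∧ (v : ℕ) = c % n ∧ (u * n + v : ℕ) = c :=
  ⟨⟨c / n, Nat.div_lt_of_lt_mul hc⟩, ⟨c % n, Nat.mod_lt _ hn⟩, rfl, rfl, Nat.div_add_mod' c n⟩

theorem cell_inj {i j u v : Fin n} : (i * n + j : ℕ) = u * n + v ↔ i = u ∧ j = v := by
  refine ⟨fun h => ⟨Fin.ext ?_, Fin.ext ?_⟩, fun h => by rw [h.1, h.2]⟩
  · rw [← cell_div i j, h, cell_div]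
  · rw [← cell_mod i j, h, cell_mod]

theorem runs_addPair {s : State} (hB : WordBound n B) (hs : HasDist x s) {τ W : ℝ} {e : ℕ → Fin n × Fin n} {m : ℕ} (hm : m ≤ n)
    (hf : Found x G τ e m s)
    (hd : IsDistMat x (addEdges G (firstPairs e m)) W (fun _ => True) (toMat n (s.ra 1)))
    (q : Fin n × Fin n) (hq : s.w 19 = q.1 * n + q.2)
    (hlt : τ * dist (x q.1) (x q.2) < toMat n (s.ra 1) q.1 q.2)
    (hq' : IsGreedySeq x G τ (Function.update e m q) (m + 1))
    (hL : s.r 11 = dist (x q.1) (x q.2)) :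
    Runs B addPair s (51 * (n * n)) fun s' =>
      Found x G τ (Function.update e m q) (m + 1) s' ∧
      IsDistMat x (addEdges G (firstPairs (Function.update e m q) (m + 1))) W (fun _ => True)
        (toMat n (s'.ra 1)) := by
  obtain ⟨hn, hB'⟩ := hB
  have h1nn : 1 ≤ n * n := Nat.mul_pos hn hn
  have hc : s.w 19 < n * n := hq ▸ cell_lt q.1 q.2
  obtain ⟨h0, h3, h4, h5⟩ := hs.std
  obtain ⟨h6, h7, h8⟩ := div_facts (s.w 19) n
  have hdiv : s.w 19 / n = q.1 := by rw [hq, cell_div]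
  have hmod : s.w 19 % n = q.2 := by rw [hq, cell_mod]
  have hne : q.1 ≠ q.2 := fun h => by
    rw [h, dist_self, mul_zero, hd.diag] at hlt
    exact lt_irrefl _ hlt
  have hpre : Runs B (wstore 3 19 3 ;; rstore 2 7 11 ;; wadd 7 7 3 ;; wdiv 15 19 0 ;;
      wmul 16 15 0 ;; wsub 16 19 16 ;; rmov 9 11) s 7 fun s' => Std n s' ∧ s'.w 15 = q.1 ∧
      s'.w 16 = q.2 ∧ s'.r 9 = dist (x q.1) (x q.2) ∧ s'.w 7 = m + 1 ∧
      s'.ra 2 = Function.update (s.ra 2) m (dist (x q.1) (x q.2)) ∧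
      s'.wa 3 = Function.update (s.wa 3) (q.1 * n + q.2) 1 ∧ s'.ra 1 = s.ra 1 := by
    refine Runs.of_wp ?_
    rw [hdiv] at h6 h7 h8
    simp [h0, h3, hdiv, h8, hmod, hf.count, hL]
    refine ⟨by omega, ⟨by omega, by omega⟩, by omega, by omega, ⟨by simpa, by simpa, by simpa,
      by simpa⟩, by rw [hq]⟩
  refine (hpre.seq (T' := 44 * (n * n)) fun s1 h1 => ?_).mono (by omega) fun _ => id
  obtain ⟨hs1, hu, hv, hr9, hw7, hra2, hwa3, hra1⟩ := h1
  refine (runs_insertEdge ⟨hn, hB'⟩ hs1 (hu ▸ q.1.2) (hv ▸ q.2.2)).frame.mono le_rfl fun s2 h2 => ?_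
  obtain ⟨hmat, hF⟩ := h2
  have hsucc : firstPairs (Function.update e m q) (m + 1) = insert q (firstPairs e m) := by
    rw [firstPairs_succ, firstPairs_update q le_rfl, Function.update_self]
  refine ⟨⟨hq', (hF.w 7 rfl).trans hw7, fun i hi => ?_, fun i j => ?_⟩, ?_⟩
  · rw [hF.ra 2 rfl, hra2]
    rcases (Nat.lt_succ_iff.1 hi).eq_or_lt with rfl | hi
    · rw [Function.update_self, Function.update_self]
    · rw [Function.update_of_ne hi.ne, Function.update_of_ne hi.ne]; exact hf.len i hi
  · rw [hF.wa 3 rfl, hwa3, hsucc, Function.update_apply, hf.val i j]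
    by_cases h : i = q.1 ∧ j = q.2 <;> simp [cell_inj, Prod.ext_iff, h]
  · rw [hmat, hr9, hra1, hsucc]
    have e1 : (⟨s1.w 15, hu ▸ q.1.2⟩ : Fin n) = q.1 := Fin.ext hu
    have e2 : (⟨s1.w 16, hv ▸ q.2.2⟩ : Fin n) = q.2 := Fin.ext hv
    rw [e1, e2]
    refine hd.insert_edge (addEdges_mono G (Finset.subset_insert _ _)) ?_ fun i j hij => ?_
    · rw [addEdges_adj]; exact Or.inr ⟨hne, Or.inl (Finset.mem_insert_self _ _)⟩
    · rw [addEdges_adj] at hij ⊢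
      simp only [Finset.mem_insert, Prod.ext_iff] at hij
      tauto

/-- The state between the rounds of the greedy algorithm, which needs at most `f` further rounds. -/
def GreedyInv (x : Fin n → M) (G : SimpleGraph (Fin n)) (τ W : ℝ) (K : ℕ) (s₀ : State) (f : ℕ)
    (s : State) : Prop :=
  Frame greedyRound.writes s₀ s ∧
  ((s.w 8 = 1 ∧ ∃ e m, m + f = K + 1 ∧ m ≤ K ∧ Found x G τ e m s ∧
      IsDistMat x (addEdges G (firstPairs e m)) W (fun _ => True) (toMat n (s.ra 1))) ∨
    (s.w 8 = 0 ∧ GreedyPost x G τ K s))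

theorem runs_greedyRound {s₀ s : State} (hB : WordBound n B) (hs : HasDist x s₀) {τ W : ℝ}
    (hr1 : s₀.r 1 = τ) (hτ : 0 ≤ τ) (hW : ∀ i j, τ * dist (x i) (x j) < W) {K f : ℕ} (hK : K ≤ n)
    (hw6 : s₀.w 6 = K) (hinv : GreedyInv x G τ W K s₀ f s) (h8 : s.w 8 = 1) :
    0 < f ∧ Runs B greedyRound s (70 * (n * n)) (GreedyInv x G τ W K s₀ (f - 1)) := by
  have hn := hB.1
  have hB' := hB.2
  have h1nn : 1 ≤ n * n := Nat.mul_pos hn hn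
  obtain ⟨hF, ⟨-, e, m, hmf, hmK, hf, hd⟩ | h⟩ := hinv
  swap
  · omega
  have hs' : HasDist x s := hs.of_frame hF ⟨rfl, rfl, rfl, rfl⟩ rfl rfl
  have hs1 : s.r 1 = τ := (hF.r 1 rfl).trans hr1
  have hs6 : s.w 6 = K := (hF.w 6 rfl).trans hw6
  refine ⟨by omega, ((runs_scan hB hs'.std).frame.seq
    (T' := 51 * (n * n) + 1 + 1) fun s1 h1 => ?_).frame.mono (by omega)
    (Q' := GreedyInv x G τ W K s₀ (f - 1)) fun s'' h => ⟨hF.trans h.2, h.1⟩⟩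
  obtain ⟨hscan, hF1⟩ := h1
  rw [hs1] at hscan
  have hs1' : HasDist x s1 := hs'.of_frame hF1 ⟨rfl, rfl, rfl, rfl⟩ rfl rfl
  have hf1 : Found x G τ e m s1 := ⟨hf.seq, (hF1.w 7 rfl).trans hf.count,
    by rw [hF1.ra 2 rfl]; exact hf.len, by rw [hF1.wa 3 rfl]; exact hf.val⟩
  have ha1 : s1.ra 1 = s.ra 1 := hF1.ra 1 rfl
  have h46 : s1.w 6 = K := (hF1.w 6 rfl).trans hs6
  have hdist : ∀ i j : Fin n, s.ra 0 (i * n + j) = dist (x i) (x j) :=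
    fun i j => congrFun (congrFun hs'.dist i) j
  refine Runs.ite (fun h18 => ?_) fun h18 => ?_
  · simp only [Test.Holds, hs1'.std.w4] at h18
    rcases hscan with hscan | hscan
    swap
    · omega
    refine (Runs.of_wp (p := wconst 9 1 ;; wconst 8 0)
      (Q := fun s2 => s2 = (s1.updW 9 1).updW 8 0) ?_).mono
      (Nat.le_trans (Nat.le_of_ble_eq_true rfl : _ ≤ 2) (by omega)) fun s2 hs2 => ?_
    · simp; omega
    subst hs2
    refine Or.inr ⟨by simp, e, m, hmK, ⟨hf1.seq, by simpa using hf1.count, by simpa using hf1.len,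
      by simpa using hf1.val⟩, Or.inl ⟨by simp, fun i j => ?_⟩⟩
    have := hscan.2 _ (cell_lt i j)
    rw [hdist] at this
    rw [edist_dist, ← ENNReal.ofReal_mul hτ]
    exact hd.graphDist_le this (hW i j)
  · simp only [Test.Holds, hs1'.std.w4] at h18
    rcases hscan with hscan | ⟨-, hc, hviol, hlen, hmin⟩
    · omega
    obtain ⟨u, v, -, -, hcell⟩ := exists_cell hn hc
    rw [← hcell, hdist] at hviol hlen
    have hseq : IsGreedySeq x G τ (Function.update e m (u, v)) (m + 1) := by
      refine hf.seq.snoc (hd.lt_graphDist (mul_nonneg hτ dist_nonneg) hviol) fun a b hab => ?_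
      refine hd.graphDist_le ?_ (hW a b)
      have := hmin _ (cell_lt a b)
      rw [← hcell, hdist, hdist] at this
      exact this hab
    refine Runs.ite (fun h76 => ?_) fun h76 => ?_
    · simp only [Test.Holds, h46, hf1.count] at h76
      refine (runs_addPair hB hs1' (hmK.trans hK) hf1 (by rwa [ha1]) (u, v) hcell.symm
        (by rwa [ha1]) hseq hlen).frame.mono (by omega) fun s2 h2 => Or.inl ⟨?_, ?_⟩
      · rw [h2.2.w 8 rfl, hF1.w 8 rfl, h8]
      · exact ⟨_, m + 1, by omega, by omega, h2.1.1, h2.1.2⟩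
    · simp only [Test.Holds, h46, hf1.count] at h76
      refine (Runs.of_wp (p := wconst 9 0 ;; wconst 8 0)
        (Q := fun s2 => s2 = (s1.updW 9 0).updW 8 0) ?_).mono
        (Nat.le_trans (Nat.le_of_ble_eq_true rfl : _ ≤ 2) (by omega)) fun s2 hs2 => ?_
      · simp; omega
      subst hs2
      -- The budget is exhausted, but the violating pair just found extends the sequence to K + 1
      -- pairs; this is the witness of failure.
      have hmK' : m = K := by omega
      exact Or.inr ⟨by simp, e, m, hmK, ⟨hf1.seq, by simpa using hf1.count, by simpa using hf1.len,
        by simpa using hf1.val⟩, Or.inr ⟨by simp, _, hmK' ▸ hseq⟩⟩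

theorem runs_greedy {s : State} (hB : WordBound n B) (hs : HasDist x s) (hA : A ≠ 3)
    (hG : HasGraph B A G s) (hτ : 0 ≤ s.r 1) (hK : s.w 6 ≤ n) :
    Runs B (greedy A) s (240 * (n * n * n)) (GreedyPost x G (s.r 1) (s.w 6)) := by
  have hn := hB.1
  have hB' := hB.2
  have hnn : n ≤ n * n := Nat.le_mul_self n
  have hnnn : n * n ≤ n * n * n := Nat.le_mul_of_pos_right _ hn
  have h1nn : 1 ≤ n * n := Nat.mul_pos hn hn
  obtain ⟨i₀⟩ : Nonempty (Fin n) := ⟨⟨0, hn⟩⟩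
  have hD : 0 ≤ s.r 2 := dist_nonneg.trans (hs.bound i₀ i₀)
  set τ := s.r 1 with hτdef
  -- The substitute for ∞: it exceeds τ times every distance, so an entry that passes the threshold
  -- test is below W and therefore meaningful.
  set W := τ * s.r 2 + 1 with hWdef
  have hW : ∀ i j, τ * dist (x i) (x j) < W := fun i j => by
    have := mul_le_mul_of_nonneg_left (hs.bound i j) hτ
    linarith
  have hW0 : 0 ≤ W := by positivity
  have hpre : Runs B (rmul 3 1 2 ;; rconst 8 1 ;; radd 3 3 8) s 3 fun s' => s'.r 3 = W :=
    Runs.of_wp (by simp [hWdef, hτdef])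
  have hloopT : (s.w 6 + 1) * (70 * (n * n) + 1) + 1 ≤ 2 * n * (71 * (n * n)) + 1 := by
    have : (s.w 6 + 1) * (70 * (n * n) + 1) ≤ 2 * n * (71 * (n * n)) :=
      Nat.mul_le_mul (by omega) (by omega)
    omega
  have h142 : 2 * n * (71 * (n * n)) = 142 * (n * n * n) := by ring
  refine Runs.mono (hpre.frame.seq (T' := (15 * (n * n) + 2) + (51 * (n * n * n) + (2 +
    ((s.w 6 + 1) * (70 * (n * n) + 1) + 1)))) fun s1 h1 => ?_) (by omega) fun _ => id
  obtain ⟨hr3, hF1⟩ := h1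
  have hs1 : HasDist x s1 := hs.of_frame hF1 ⟨rfl, rfl, rfl, rfl⟩ rfl rfl
  have hA1 : s1.wa A = s.wa A := hF1.wa A rfl
  refine (runs_initMat hB hs1.std hA (hA1 ▸ hG.lt)).frame.seq fun s2 h2 => ?_
  obtain ⟨hinit, hF2⟩ := h2
  have hs2 : HasDist x s2 := hs1.of_frame hF2 ⟨rfl, rfl, rfl, rfl⟩ rfl rfl
  have hd0 : IsDistMat x G W (fun _ => False) (toMat n (s2.ra 1)) := by
    have hval : ∀ i j, toMat n (s2.ra 1) i j = if (i : ℕ) = j then 0 else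
        if s.wa A (i * n + j) = 0 then W else dist (x i) (x j) := fun i j => by
      rw [toMat, (hinit _ (cell_lt i j)).2, cell_div, cell_mod, hA1, hr3]
      have := congrFun (congrFun hs1.dist i) j
      rw [toMat] at this
      rw [this]
    refine isDistMat_edges hW0 (fun i => ?_) (fun i j hij => ?_) fun i j hne hij => ?_
    · rw [hval, if_pos rfl]
    · rw [hval, if_neg fun h => hij.ne (Fin.ext h), if_neg ((hG.adj i j).2 hij)]
    · rw [hval, if_neg fun h => hne (Fin.ext h), if_pos]
      by_contra h
      exact hij ((hG.adj i j).1 h)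
  refine (runs_floydWarshall hB hs2.std hd0).frame.seq fun s3 h3 => ?_
  obtain ⟨hfw, hF3⟩ := h3
  have hs3 : HasDist x s3 := hs2.of_frame hF3 ⟨rfl, rfl, rfl, rfl⟩ rfl rfl
  have hmid : Runs B (wconst 7 0 ;; wconst 8 1) s3 2 fun s' => s' = (s3.updW 7 0).updW 8 1 :=
    Runs.of_wp (by simp; omega)
  refine hmid.seq ?_
  rintro _ rfl
  have hs4 : HasDist x ((s3.updW 7 0).updW 8 1) :=
    ⟨⟨hs3.std.w0, hs3.std.w3, hs3.std.w4, hs3.std.w5⟩, hs3.dist, hs3.bound⟩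
  have hr1 : ((s3.updW 7 0).updW 8 1).r 1 = τ := by
    rw [State.updW_r, State.updW_r, hF3.r 1 rfl, hF2.r 1 rfl, hF1.r 1 rfl]
  have hw6 : ((s3.updW 7 0).updW 8 1).w 6 = s.w 6 := by
    have : s3.w 6 = s.w 6 := by rw [hF3.w 6 rfl, hF2.w 6 rfl, hF1.w 6 rfl]
    simpa
  have hinv : GreedyInv x G τ W (s.w 6) ((s3.updW 7 0).updW 8 1) (s.w 6 + 1)
      ((s3.updW 7 0).updW 8 1) := by
    refine ⟨Frame.refl _ _, Or.inl ⟨by simp, fun _ => (i₀, i₀), 0, by omega, by omega,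
      ⟨fun i hi => absurd hi (Nat.not_lt_zero _), by simp, fun i hi => absurd hi (Nat.not_lt_zero _),
        fun i j => ?_⟩, ?_⟩⟩
    · have : s3.wa 3 = s2.wa 3 := hF3.wa 3 rfl
      simp [this, (hinit _ (cell_lt i j)).1, firstPairs]
    · have : addEdges G (firstPairs (fun _ => (i₀, i₀)) 0) = G := by
        ext a b; simp [addEdges_adj, firstPairs]
      rw [this]
      exact hfw
  refine (Runs.loop (Inv := GreedyInv x G τ W (s.w 6) ((s3.updW 7 0).updW 8 1))
    (T := 70 * (n * n)) (fun f s' hI hb => ?_) _ _ hinv).mono le_rfl fun s' hs' => ?_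
  · have h8 : s'.w 8 = 1 := by
      simp only [Test.Holds] at hb
      rcases hI.2 with h | h
      · exact h.1
      · omega
    obtain ⟨hpos, hrun⟩ := runs_greedyRound hB hs4 hr1 hτ hW hK hw6 hI h8
    exact ⟨f - 1, by omega, hrun⟩
  · obtain ⟨⟨f, hF, h | h⟩, hb⟩ := hs'
    · have h4 : s'.w 4 = 0 := (hF.w 4 rfl).trans hs4.std.w4
      simp only [Test.Holds, h4, h.1] at hb
      omega
    · exact h.2

/-! ## Attempts with a given threshold -/

/-- Copy the pairs found by the greedy algorithm and its threshold to the output. -/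
def save : Prog :=
  forLoop 10 5 (wload 11 3 10 ;; wstore 1 10 11) ;; (wconst 2 1 ;; rmov 0 1)

theorem runs_save {s : State} (hB : WordBound n B) (hs : Std n s) (hlt : ∀ c < n * n, s.wa 3 c < B) :
    Runs B save s (4 * (n * n) + 4) fun s' => (∀ c < n * n, s'.wa 1 c = s.wa 3 c) ∧ s'.w 2 = 1 ∧
      s'.r 0 = s.r 1 := by
  obtain ⟨hn, hB⟩ := hB
  have hloop := Runs.forLoop (B := B) (i := 10) (N := 5) (p := wload 11 3 10 ;; wstore 1 10 11)
    (s := s) (m := n * n) (T := 2) (fun j s' => ∀ c < j, s'.wa 1 c = s.wa 3 c)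
    hs.w5 hs.w3 (by omega) (by decide) (by decide) rfl rfl rfl (by simp) fun j hj s' hF hi hI => by
      have h3 : s'.wa 3 = s.wa 3 := hF.wa 3 rfl
      refine (Runs.of_wp ?_).mono (Nat.le_of_ble_eq_true rfl) fun _ => id
      simp [hi, h3]
      exact ⟨hlt j hj, forall_le_of (fun c hc => by rw [Function.update_of_ne hc.ne]; exact hI c hc)
        (by simp)⟩
  refine Runs.mono (hloop.frame.seq (T' := 2) fun s1 h1 => ?_) (by omega) fun _ => id
  refine Runs.of_wp ?_
  have h2 : s1.r 1 = s.r 1 := h1.2.r 1 rfl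
  simp [h2]
  exact ⟨by omega, h1.1⟩

/-- A solution with at most `K` pairs is stored; if `w 2` is not zero, then `r 0` is an upper bound
of its dilation. -/
def Stored (x : Fin n → M) (G : SimpleGraph (Fin n)) (K : ℕ) (s : State) : Prop :=
  ∃ S : Finset (Fin n × Fin n), S.card ≤ K ∧
    (∀ i j : Fin n, s.wa 1 (i * n + j) = if (i, j) ∈ S then 1 else 0) ∧
    (s.w 2 = 0 ∨ (s.w 2 = 1 ∧ 1 ≤ s.r 0 ∧ IsSpanner x (addEdges G S) (ENNReal.ofReal (s.r 0))))

theorem Stored.congr {K : ℕ} {s s' : State} (h : Stored x G K s) (hwa : s'.wa 1 = s.wa 1)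
    (hw : s'.w 2 = s.w 2) (hr : s'.r 0 = s.r 0) : Stored x G K s' := by
  unfold Stored; rw [hwa, hw, hr]; exact h

/-- The greedy algorithm may add more than `K` pairs. -/
def Fails (x : Fin n → M) (G : SimpleGraph (Fin n)) (K : ℕ) (τ : ℝ) : Prop :=
  ∃ e, IsGreedySeq x G τ e (K + 1)

/-- Try the threshold `r 1`. -/
def attempt : Prog := greedy 0 ;; .ite (weq 9 3) save .skip

/-- Either the threshold `τ` has been attained and stored, or it is too small. -/
def AttemptPost (x : Fin n → M) (G : SimpleGraph (Fin n)) (K : ℕ) (τ : ℝ) (s s' : State) : Prop :=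
  (s'.w 9 = 1 ∧ s'.w 2 = 1 ∧ s'.r 0 = τ ∧ Stored x G K s') ∨
  (s'.w 9 = 0 ∧ Fails x G K τ ∧ s'.wa 1 = s.wa 1 ∧ s'.w 2 = s.w 2 ∧ s'.r 0 = s.r 0)

theorem AttemptPost.stored {K : ℕ} {τ : ℝ} {s s' : State} (h : AttemptPost x G K τ s s')
    (hs : Stored x G K s) : Stored x G K s' := by
  rcases h with h | h
  · exact h.2.2.2
  · exact hs.congr h.2.2.1 h.2.2.2.1 h.2.2.2.2

/-- The input of an attempt. -/
structure Ready (x : Fin n → M) (G : SimpleGraph (Fin n)) (B K : ℕ) (s : State) : Prop where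
  dist : HasDist x s
  graph : HasGraph B 0 G s
  w6 : s.w 6 = K

theorem Ready.of_frame {K : ℕ} {W : ℕ → ℕ → Bool} {s s' : State} (h : Ready x G B K s)
    (hF : Frame W s s')
    (hW : W 0 0 = false ∧ W 0 3 = false ∧ W 0 4 = false ∧ W 0 5 = false)
    (h2 : W 1 2 = false) (h0 : W 3 0 = false) (ha : W 2 0 = false) (h6 : W 0 6 = false) :
    Ready x G B K s' :=
  ⟨h.dist.of_frame hF hW h2 h0, ⟨by rw [hF.wa 0 ha]; exact h.graph.lt, by
    rw [hF.wa 0 ha]; exact h.graph.adj⟩, (hF.w 6 h6).trans h.w6⟩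

/-- A stored value has to be at least 1. Two distinct points force this for any successful
threshold; for a single point it must be assumed. -/
theorem runs_attempt {s : State} {K : ℕ} (hB : WordBound n B) (hx : Function.Injective x)
    (hs : Ready x G B K s) (hK : K ≤ n) (hτ : 0 ≤ s.r 1) (hone : 2 ≤ n ∨ 1 ≤ s.r 1) :
    Runs B attempt s (250 * (n * n * n)) (AttemptPost x G K (s.r 1) s) := by
  have hn := hB.1
  have hB' := hB.2
  have hnnn : n * n ≤ n * n * n := Nat.le_mul_of_pos_right _ hn
  have h1nn : 1 ≤ n * n := Nat.mul_pos hn hn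
  refine Runs.mono ((runs_greedy hB hs.dist (by decide) hs.graph hτ (hs.w6 ▸ hK)).frame.seq
    (T' := (4 * (n * n) + 4) + 1) fun s1 h1 => ?_) (by omega) fun _ => id
  obtain ⟨⟨e, m, hm, hf, hout⟩, hF⟩ := h1
  rw [hs.w6] at hm hout
  have hs1 : Std n s1 := hs.dist.std.of_frame hF ⟨rfl, rfl, rfl, rfl⟩
  refine Runs.ite (fun h9 => ?_) fun h9 => ?_
  · simp only [Test.Holds, hs1.w3] at h9
    rcases hout with ⟨-, hsp⟩ | ⟨h9', -⟩
    swap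
    · omega
    refine (runs_save hB hs1 fun c hc => ?_).frame.mono le_rfl fun s2 h2 => Or.inl ?_
    · obtain ⟨u, v, -, -, rfl⟩ := exists_cell hn hc
      rw [hf.val]
      split_ifs <;> omega
    · obtain ⟨⟨hcopy, hw2, hr0⟩, hF2⟩ := h2
      have hr : s1.r 1 = s.r 1 := hF.r 1 rfl
      refine ⟨(hF2.w 9 rfl).trans h9, hw2, hr0.trans hr, firstPairs e m,
        (firstPairs_card_le e m).trans hm, fun i j => ?_, Or.inr ⟨hw2, ?_, ?_⟩⟩
      · rw [hcopy _ (cell_lt i j), hf.val]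
      · rw [hr0, hr]
        rcases hone with h2n | h
        · exact hsp.one_le hx (u := ⟨0, by omega⟩) (v := ⟨1, by omega⟩) (by simp)
        · exact h
      · rw [hr0, hr]; exact hsp
  · simp only [Test.Holds, hs1.w3] at h9
    rcases hout with ⟨h9', -⟩ | ⟨h9', hfail⟩
    · omega
    exact (Runs.of_wp (p := .skip) (Q := AttemptPost x G K (s.r 1) s) (Or.inr
      ⟨h9', hfail, hF.wa 1 rfl, hF.w 2 rfl, hF.r 0 rfl⟩)).mono (by simp [Prog.cost]) fun _ => id

/-! ## Searching for the threshold -/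

/-- Binary search among the `w 21` thresholds in real array `7`. -/
def binarySearch : Prog :=
  (wconst 23 0 ;; wmov 24 21) ;;
  .while (wlt 23 24)
    ((wadd 25 23 24 ;; wadd 26 3 3 ;; wdiv 25 25 26 ;; rload 1 7 25) ;; attempt ;;
      .ite (weq 9 3) (wmov 24 25) (wadd 23 25 3))

/-- The outcome of a search among the thresholds `out 0, …, out (N - 1)`. -/
def SearchPost (x : Fin n → M) (G : SimpleGraph (Fin n)) (K N : ℕ) (out : ℕ → ℝ) (s : State) :
    Prop :=
  Stored x G K s ∧ ∃ h ≤ N, (h = 0 ∨ Fails x G K (out (h - 1))) ∧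
    ((h = N ∧ s.w 2 = 0) ∨ (h < N ∧ s.w 2 = 1 ∧ s.r 0 = out h))

/-- The state between the rounds of binary search. -/
def SearchInv (x : Fin n → M) (G : SimpleGraph (Fin n)) (K N : ℕ) (out : ℕ → ℝ) (W : ℕ → ℕ → Bool)
    (s₀ : State) (f : ℕ) (s : State) : Prop :=
  Frame W s₀ s ∧ s.w 23 ≤ s.w 24 ∧ s.w 24 ≤ N ∧ s.w 24 - s.w 23 < 2 ^ f ∧ Stored x G K s ∧
    (s.w 23 = 0 ∨ Fails x G K (out (s.w 23 - 1))) ∧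
    ((s.w 24 = N ∧ s.w 2 = 0) ∨ (s.w 24 < N ∧ s.w 2 = 1 ∧ s.r 0 = out (s.w 24)))

/-- Monotonicity of success in the threshold is neither known nor used: the invariant only says that
the candidate just below the interval has failed and that the one at its upper end, if any, has
succeeded and is stored. -/
theorem runs_binarySearch {s : State} {K N f : ℕ} (hB : WordBound n B) (hx : Function.Injective x)
    (hs : Ready x G B K s) (hK : K ≤ n) (hn2 : 2 ≤ n) (hN : N ≤ n * n) (hw21 : s.w 21 = N)
    (hpos : ∀ a < N, 0 ≤ s.ra 7 a) (hst : Stored x G K s) (hw2 : s.w 2 = 0) (hf : N < 2 ^ f) :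
    Runs B binarySearch s (f * (260 * (n * n * n)) + 3) (SearchPost x G K N (s.ra 7)) := by
  have hn := hB.1
  have hB' := hB.2
  have hnnn : n * n ≤ n * n * n := Nat.le_mul_of_pos_right _ hn
  have h1nn : 1 ≤ n * n := Nat.mul_pos hn hn
  have hpre : Runs B (wconst 23 0 ;; wmov 24 21) s 2 fun s' => s' = (s.updW 23 0).updW 24 N :=
    Runs.of_wp (by simp [hw21]; omega)
  have hT : f * (250 * (n * n * n) + 6 + 1) ≤ f * (260 * (n * n * n)) :=
    Nat.mul_le_mul_left _ (by omega)
  refine Runs.mono (hpre.seq (T' := f * (250 * (n * n * n) + 6 + 1) + 1) ?_) (by omega) fun _ => id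
  rintro _ rfl
  set s₀ := (s.updW 23 0).updW 24 N with hs₀
  have hs0 : Ready x G B K s₀ := ⟨⟨⟨hs.dist.std.w0, hs.dist.std.w3, hs.dist.std.w4,
    hs.dist.std.w5⟩, hs.dist.dist, hs.dist.bound⟩, ⟨hs.graph.lt, hs.graph.adj⟩, hs.w6⟩
  have h70 : s₀.ra 7 = s.ra 7 := rfl
  set body := (wadd 25 23 24 ;; wadd 26 3 3 ;; wdiv 25 25 26 ;; rload 1 7 25) ;; attempt ;;
      Prog.ite (weq 9 3) (wmov 24 25) (wadd 23 25 3) with hbody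
  refine (Runs.loop (Inv := SearchInv x G K N (s.ra 7) body.writes s₀)
    (T := 250 * (n * n * n) + 6) (fun f s1 hI hb => ?_) f s₀ ?_).mono le_rfl fun s' hs' => ?_
  · obtain ⟨hF, hle, hN', hlt, hst1, hlo, hhi⟩ := hI
    simp only [Test.Holds] at hb
    have hs1 : Ready x G B K s1 := hs0.of_frame hF ⟨rfl, rfl, rfl, rfl⟩ rfl rfl rfl rfl
    have h7 : s1.ra 7 = s.ra 7 := hF.ra 7 rfl
    obtain ⟨h0, h3, h4, h5⟩ := hs1.dist.std
    have hf0 : f ≠ 0 := by rintro rfl; simp at hlt; omega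
    obtain ⟨g, rfl⟩ := Nat.exists_eq_succ_of_ne_zero hf0
    rw [pow_succ] at hlt
    set mid := (s1.w 23 + s1.w 24) / 2 with hmid
    refine ⟨g, Nat.lt_succ_self g, ?_⟩
    have hq : Runs B (wadd 25 23 24 ;; wadd 26 3 3 ;; wdiv 25 25 26 ;; rload 1 7 25) s1 4
        fun s2 => s2.w 25 = mid ∧ s2.r 1 = s.ra 7 mid := by
      refine Runs.of_wp ?_
      simp [h3, h7, ← hmid]
      omega
    refine Runs.mono ((hq.frame.seq (T' := 250 * (n * n * n) + 2) fun s2 h2 => ?_).frame)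
      (T' := 250 * (n * n * n) + 6) (by omega) (fun s4 h4 => ⟨hF.trans h4.2, h4.1⟩)
    obtain ⟨⟨h25, hr1⟩, hF2⟩ := h2
    have hs2 : Ready x G B K s2 := hs1.of_frame hF2 ⟨rfl, rfl, rfl, rfl⟩ rfl rfl rfl rfl
    have hst2 : Stored x G K s2 := hst1.congr (hF2.wa 1 rfl) (hF2.w 2 rfl) (hF2.r 0 rfl)
    have hatt := runs_attempt hB hx hs2 hK (by rw [hr1]; exact hpos _ (by omega)) (Or.inl hn2)
    refine hatt.frame.seq fun s3 h3 => ?_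
    obtain ⟨hpost, hF3⟩ := h3
    have hst3 := hpost.stored hst2
    have h3' : s3.w 3 = 1 := (hF3.w 3 rfl).trans hs2.dist.std.w3
    have h25' : s3.w 25 = mid := (hF3.w 25 rfl).trans h25
    have h23 : s3.w 23 = s1.w 23 := (hF3.w 23 rfl).trans (hF2.w 23 rfl)
    have h24 : s3.w 24 = s1.w 24 := (hF3.w 24 rfl).trans (hF2.w 24 rfl)
    refine Runs.ite (fun h9 => ?_) fun h9 => ?_
    · simp only [Test.Holds, h3'] at h9
      refine (Runs.of_wp (p := wmov 24 25) (Q := fun s4 => s4 = s3.updW 24 mid) ?_).mono le_rfl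
        fun s4 hs4 => ?_
      · simp [h25']; omega
      subst hs4
      rcases hpost with hpost | hpost
      · refine ⟨by simp [h23]; omega, by simp; omega, by simp [h23]; omega,
          hst3.congr rfl (by simp) rfl, by simpa [h23], Or.inr ⟨by simp; omega,
          by simpa using hpost.2.1, by simp [hpost.2.2.1, hr1]⟩⟩
      · omega
    · simp only [Test.Holds, h3'] at h9
      refine (Runs.of_wp (p := wadd 23 25 3) (Q := fun s4 => s4 = s3.updW 23 (mid + 1)) ?_).mono
        le_rfl fun s4 hs4 => ?_
      · simp [h25', h3']; omega
      subst hs4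
      rcases hpost with hpost | hpost
      · omega
      · refine ⟨by simp [h24]; omega, by simp [h24]; omega, by simp [h24]; omega,
          hst3.congr rfl (by simp) rfl, Or.inr ?_, ?_⟩
        · simpa [hr1] using hpost.2.1
        · have e1 : s3.w 2 = s1.w 2 := hpost.2.2.2.1.trans (hF2.w 2 rfl)
          have e2 : s3.r 0 = s1.r 0 := hpost.2.2.2.2.trans (hF2.r 0 rfl)
          simpa [h24, e1, e2] using hhi
  · refine ⟨Frame.refl _ _, by simp [hs₀], by simp [hs₀], by simpa [hs₀] using hf,
      hst.congr rfl (by simp [hs₀]) rfl, by simp [hs₀], Or.inl (by simp [hs₀, hw2])⟩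
  · obtain ⟨⟨f, hF, hle, hN', -, hst', hlo, hhi⟩, hb⟩ := hs'
    simp only [Test.Holds] at hb
    have : s'.w 23 = s'.w 24 := by omega
    exact ⟨hst', s'.w 24, hN', this ▸ hlo, hhi⟩

/-- Decrease the threshold by the factor `q / (q + 1)` as long as possible. -/
def descend (q : ℕ) : Prog :=
  (rconst 6 q ;; rconst 7 (q + 1) ;; rdiv 6 6 7 ;; wmov 27 2) ;;
  .while (wlt 4 27) (rmul 1 0 6 ;; attempt ;; wmov 27 9)

/-- The state between the rounds of `descend`. -/
def DescendInv (x : Fin n → M) (G : SimpleGraph (Fin n)) (K : ℕ) (ρ t : ℝ) (W : ℕ → ℕ → Bool)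
    (s₀ : State) (f : ℕ) (s : State) : Prop :=
  Frame W s₀ s ∧ Stored x G K s ∧ s.w 2 = s₀.w 2 ∧
    ((s.w 27 = 1 ∧ s.w 2 = 1 ∧ 0 < f ∧ ρ ^ f * s.r 0 ≤ t * ρ) ∨
      (s.w 27 = 0 ∧ (s.w 2 = 1 → Fails x G K (s.r 0 * ρ))))

/-- No threshold below t can succeed, by `hmin`, so the number of rounds is bounded by the number of
factors q/(q + 1) that bring the stored value down to t. -/
theorem runs_descend {s : State} {K q f : ℕ} {t : ℝ} (hB : WordBound n B)
    (hx : Function.Injective x) (hs : Ready x G B K s) (hK : K ≤ n) (hn2 : 2 ≤ n) (hq : 0 < q)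
    (hst : Stored x G K s) (ht : 0 < t)
    (hmin : ∀ (S : Finset (Fin n × Fin n)) (τ : ℝ), S.card ≤ K → 1 ≤ τ →
      IsSpanner x (addEdges G S) (ENNReal.ofReal τ) → t ≤ τ)
    (hf0 : 0 < f)
    (hf : s.w 2 = 1 → (q / (q + 1) : ℝ) ^ f * s.r 0 ≤ t * (q / (q + 1))) :
    Runs B (descend q) s (f * (260 * (n * n * n)) + 5) fun s' => Stored x G K s' ∧
      s'.w 2 = s.w 2 ∧ (s'.w 2 = 1 → Fails x G K (s'.r 0 * (q / (q + 1)))) := by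
  have hn := hB.1
  have hB' := hB.2
  have hnnn : n * n ≤ n * n * n := Nat.le_mul_of_pos_right _ hn
  have h1nn : 1 ≤ n * n := Nat.mul_pos hn hn
  set ρ : ℝ := q / (q + 1) with hρ
  have hq' : (0 : ℝ) < q := by exact_mod_cast hq
  have hρ0 : 0 < ρ := by positivity
  have hρ1 : ρ < 1 := by rw [hρ, div_lt_one (by linarith)]; linarith
  have hw2 : s.w 2 = 0 ∨ s.w 2 = 1 := by
    obtain ⟨S, -, -, h | h⟩ := hst
    exacts [Or.inl h, Or.inr h.1]
  have hq1 : (q : ℝ) + 1 ≠ 0 := by positivity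
  have hpre : Runs B (rconst 6 q ;; rconst 7 (q + 1) ;; rdiv 6 6 7 ;; wmov 27 2) s 4
      fun s' => s'.r 6 = ρ ∧ s'.w 27 = s.w 2 := by
    refine Runs.of_wp ?_
    simp [hq1, hρ]
    omega
  have hT : f * (250 * (n * n * n) + 2 + 1) ≤ f * (260 * (n * n * n)) :=
    Nat.mul_le_mul_left _ (by omega)
  refine Runs.mono (hpre.frame.seq (T' := f * (250 * (n * n * n) + 2 + 1) + 1) ?_) (by omega)
    fun _ => id
  rintro s₀ ⟨⟨h6, h27⟩, hF0⟩
  have hs0 : Ready x G B K s₀ := hs.of_frame hF0 ⟨rfl, rfl, rfl, rfl⟩ rfl rfl rfl rfl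
  have hst0 : Stored x G K s₀ := hst.congr (hF0.wa 1 rfl) (hF0.w 2 rfl) (hF0.r 0 rfl)
  have h20 : s₀.w 2 = s.w 2 := hF0.w 2 rfl
  set body := Prog.seq (rmul 1 0 6) (attempt ;; wmov 27 9) with hbody
  refine (Runs.loop (Inv := DescendInv x G K ρ t body.writes s₀)
    (T := 250 * (n * n * n) + 2) (fun f s1 hI hb => ?_) f s₀ ?_).mono le_rfl fun s' hs' => ?_
  · obtain ⟨hF, hst1, h2, hcase⟩ := hI
    have hs1 : Ready x G B K s1 := hs0.of_frame hF ⟨rfl, rfl, rfl, rfl⟩ rfl rfl rfl rfl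
    simp only [Test.Holds, hs1.dist.std.w4] at hb
    rcases hcase with ⟨-, hw21, hf0, hle⟩ | h
    swap
    · omega
    obtain ⟨g, rfl⟩ := Nat.exists_eq_succ_of_ne_zero hf0.ne'
    have h61 : s1.r 6 = ρ := (hF.r 6 rfl).trans h6
    have hr0 : 1 ≤ s1.r 0 := by
      obtain ⟨S, -, -, h | h⟩ := hst1
      · omega
      · exact h.2.1
    have hmul : Runs B (rmul 1 0 6 : Instr) s1 1 fun s2 => s2 = s1.setR 1 (s1.r 0 * ρ) :=
      Runs.of_wp (by simp [h61])
    have hs2 : Ready x G B K (s1.setR 1 (s1.r 0 * ρ)) := ⟨⟨⟨hs1.dist.std.w0, hs1.dist.std.w3,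
      hs1.dist.std.w4, hs1.dist.std.w5⟩, hs1.dist.dist, by simpa using hs1.dist.bound⟩,
      ⟨hs1.graph.lt, hs1.graph.adj⟩, hs1.w6⟩
    have hatt := runs_attempt hB hx hs2 hK (by simp; positivity) (Or.inl hn2)
    have hr1 : (s1.setR 1 (s1.r 0 * ρ)).r 1 = s1.r 0 * ρ := by simp
    rw [hr1] at hatt
    have hmov : ∀ s3 : State, s3.w 9 < B →
        Runs B (wmov 27 9 : Instr) s3 1 fun s4 => s4 = s3.updW 27 (s3.w 9) :=
      fun s3 h => Runs.of_wp (by simpa)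
    have hrun : Runs B body s1 (250 * (n * n * n) + 2) fun s4 => ∃ s3,
        AttemptPost x G K (s1.r 0 * ρ) (s1.setR 1 (s1.r 0 * ρ)) s3 ∧
        s4 = s3.updW 27 (s3.w 9) := by
      refine Runs.mono (hmul.seq (T' := 250 * (n * n * n) + 1) ?_) (by omega) fun _ => id
      rintro _ rfl
      refine hatt.seq fun s3 h3 => (hmov s3 ?_).mono le_rfl fun s4 h4 => ⟨s3, h3, h4⟩
      rcases h3 with h3 | h3 <;> omega
    have hst2 : Stored x G K (s1.setR 1 (s1.r 0 * ρ)) := hst1.congr rfl rfl (by simp)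
    -- In the last round (g = 0) the invariant says that the new threshold is at most tρ < t, so the
    -- attempt fails.
    have hcases : ∀ s3, AttemptPost x G K (s1.r 0 * ρ) (s1.setR 1 (s1.r 0 * ρ)) s3 →
        0 < g ∨ s3.w 9 = 0 := fun s3 h3 => by
      rcases h3 with ⟨-, h2', hr0', S, hSK, -, h | ⟨-, h1, hsp⟩⟩ | h3
      · omega
      · refine Or.inl (Nat.pos_of_ne_zero ?_)
        rintro rfl
        have := hmin S _ hSK h1 hsp
        rw [hr0'] at this
        have hle' : ρ * s1.r 0 ≤ t * ρ := by simpa using hle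
        nlinarith
      · exact Or.inr h3.1
    refine ⟨g, Nat.lt_succ_self g, hrun.frame.mono le_rfl ?_⟩
    rintro _ ⟨⟨s3, h3, rfl⟩, hF4⟩
    have hst3 := h3.stored hst2
    refine ⟨hF.trans hF4, hst3.congr rfl (by simp) rfl, ?_, ?_⟩
    · rcases h3 with h3 | h3
      · simp [h3.2.1, ← h2, hw21]
      · simp [h3.2.2.2.1, ← h2]
    · rcases hcases s3 h3 with hg | h9
      · rcases h3 with h3 | h3
        · refine Or.inl ⟨by simp [h3.1], by simp [h3.2.1], hg, ?_⟩
          simp only [State.updW_r, h3.2.2.1]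
          rw [pow_succ] at hle
          linarith
        · refine Or.inr ⟨by simp [h3.1], fun _ => ?_⟩
          simp only [State.updW_r, h3.2.2.2.2, State.setR_r]
          simpa using h3.2.1
      · rcases h3 with h3 | h3
        · omega
        · refine Or.inr ⟨by simp [h3.1], fun _ => ?_⟩
          simp only [State.updW_r, h3.2.2.2.2, State.setR_r]
          simpa using h3.2.1
  · refine ⟨Frame.refl _ _, hst0, rfl, ?_⟩
    rcases hw2 with h | h
    · exact Or.inr ⟨h27.trans h, fun h' => by omega⟩
    · refine Or.inl ⟨h27.trans h, h20.trans h, hf0, ?_⟩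
      rw [hF0.r 0 rfl]; exact hf h
  · obtain ⟨⟨f, hF, hst', h2, hcase⟩, hb⟩ := hs'
    have h4 : s'.w 4 = 0 := (hF.w 4 rfl).trans hs0.dist.std.w4
    simp only [Test.Holds, h4] at hb
    rcases hcase with h | h
    · omega
    · exact ⟨hst', h2.trans h20, h.2⟩

/-! ## Sorting the quotients of the scales -/

/-- The candidate in row `i` and column `q`; rows and columns are increasing if `m` is. -/
noncomputable def rowVal (m : ℕ → ℝ) (r : ℕ) (A : ℝ) (i q : ℕ) : ℝ := m i / m (r - q - 1) * A

/-- Find the least head of the rows; word array `6` holds the number of candidates that have been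
removed from each row. -/
def scanRows : Prog :=
  wconst 18 0 ;; forLoop 10 20 (wload 11 6 10 ;; .ite (wlt 11 20)
    ((rload 8 2 10 ;; wsub 12 20 11 ;; wsub 12 12 3 ;; rload 13 2 12 ;; rdiv 8 8 13 ;; rmul 8 8 5) ;;
      .ite (weq 18 4) (wconst 18 1 ;; wmov 19 10 ;; rmov 11 8)
        (.ite (rlt 8 11) (wconst 18 1 ;; wmov 19 10 ;; rmov 11 8) .skip)) .skip)

/-- The result of `scanRows` on the first `j` rows. -/
def RowsPost (m : ℕ → ℝ) (r : ℕ) (A : ℝ) (p : ℕ → ℕ) (j : ℕ) (s : State) : Prop :=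
  (s.w 18 = 0 ∧ ∀ i < j, r ≤ p i) ∨
  (s.w 18 = 1 ∧ s.w 19 < j ∧ p (s.w 19) < r ∧ s.r 11 = rowVal m r A (s.w 19) (p (s.w 19)) ∧
    ∀ i < j, p i < r → s.r 11 ≤ rowVal m r A i (p i))

theorem runs_scanRows {s : State} {r : ℕ} (hB : WordBound n B) (hs : Std n s) (h20 : s.w 20 = r)
    (hr : r ≤ n) (hp : ∀ i < r, s.wa 6 i ≤ r) (hm : ∀ i < r, s.ra 2 i ≠ 0) :
    Runs B scanRows s (15 * r + 3) (RowsPost (s.ra 2) r (s.r 5) (s.wa 6) r) := by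
  obtain ⟨hn, hB⟩ := hB
  have h1 : Runs B (wconst 18 0 : Instr) s 1 fun s' => s' = s.updW 18 0 :=
    Runs.of_wp (by simp; omega)
  refine Runs.mono (h1.seq (T' := r * (13 + 2) + 2) ?_) (by omega) fun _ => id
  rintro _ rfl
  have hs1 : Std n (s.updW 18 0) := ⟨hs.w0, hs.w3, hs.w4, hs.w5⟩
  refine Runs.forLoop (RowsPost (s.ra 2) r (s.r 5) (s.wa 6)) (by simpa) hs1.w3 (by omega) (by decide)
    (by decide) rfl rfl rfl (by simp [RowsPost]) ?_
  intro j hj s' hF hi hI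
  have h3 : s'.w 3 = 1 := (hF.w 3 rfl).trans hs1.w3
  have h4 : s'.w 4 = 0 := (hF.w 4 rfl).trans hs1.w4
  have h20' : s'.w 20 = r := (hF.w 20 rfl).trans (by simpa)
  have hr5 : s'.r 5 = s.r 5 := hF.r 5 rfl
  have ha2 : s'.ra 2 = s.ra 2 := hF.ra 2 rfl
  have ha6 : s'.wa 6 = s.wa 6 := hF.wa 6 rfl
  have hpj := hp j hj
  have hmq := hm (r - s.wa 6 j - 1) (by omega)
  refine (Runs.of_wp ?_).mono (Nat.le_of_ble_eq_true rfl) fun _ => id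
  simp [h3, h4, h20', hi, hr5, ha2, ha6, RowsPost, hmq]
  have hval : s.ra 2 j / s.ra 2 (r - s.wa 6 j - 1) * s.r 5 =
      rowVal (s.ra 2) r (s.r 5) j (s.wa 6 j) := rfl
  rw [hval]
  simp only [RowsPost] at hI
  refine ⟨by omega, fun h => ⟨by omega, by omega, fun h18 => ⟨by omega, by omega, h, rfl, ?_⟩,
    fun h18 => ⟨fun hlt => ⟨by omega, by omega, h, rfl, ?_⟩, fun hge => ?_⟩⟩, fun h => ?_⟩
  · rcases hI with hI | hI
    · refine forall_le_of (fun c hc h' => ?_) fun _ => le_rfl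
      have := hI.2 c hc
      omega
    · omega
  · rcases hI with hI | hI
    · omega
    · exact forall_le_of (fun c hc h' => hlt.le.trans (hI.2.2.2.2 c hc h')) fun _ => le_rfl
  · rcases hI with hI | hI
    · omega
    · exact Or.inr ⟨hI.1, hI.2.1.le, hI.2.2.1, hI.2.2.2.1, forall_le_of hI.2.2.2.2 fun _ => hge⟩
  · rcases hI with hI | hI
    · exact Or.inl ⟨hI.1, forall_le_of hI.2 h⟩
    · exact Or.inr ⟨hI.1, hI.2.1.le, hI.2.2.1, hI.2.2.2.1,
        forall_le_of hI.2.2.2.2 fun h' => absurd h' (by omega)⟩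

theorem sum_update_succ {s : Finset ℕ} {p : ℕ → ℕ} {i : ℕ} (hi : i ∈ s) :
    ∑ c ∈ s, Function.update p i (p i + 1) c = ∑ c ∈ s, p c + 1 := by
  have : ∀ c, Function.update p i (p i + 1) c = p c + if c = i then 1 else 0 := fun c => by
    by_cases h : c = i
    · subst h; simp
    · simp [h]
  simp only [this, Finset.sum_add_distrib, Finset.sum_ite_eq', if_pos hi]

/-- The first `j` candidates have been moved to `out`; `p` counts them by rows. -/
structure MergeInv (m : ℕ → ℝ) (r : ℕ) (A : ℝ) (j : ℕ) (p : ℕ → ℕ) (out : ℕ → ℝ) : Prop where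
  le : ∀ i < r, p i ≤ r
  sum : ∑ i ∈ Finset.range r, p i = j
  mono : ∀ a b, a ≤ b → b < j → out a ≤ out b
  low : ∀ a < j, ∀ i < r, ∀ q < r, p i ≤ q → out a ≤ rowVal m r A i q
  cover : ∀ i < r, ∀ q < p i, ∃ a < j, out a = rowVal m r A i q
  pos : ∀ a < j, 0 < out a

/-- Every row is increasing, so the least head is at most every remaining candidate, and appending
it keeps the output sorted. -/
theorem MergeInv.step {m : ℕ → ℝ} {r : ℕ} {A : ℝ} {j : ℕ} {p : ℕ → ℕ} {out : ℕ → ℝ}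
    (h : MergeInv m r A j p out) (hA : 0 < A) (hm : ∀ i < r, 0 < m i)
    (hmono : ∀ a b, a ≤ b → b < r → m a ≤ m b) {i₀ : ℕ} (hi₀ : i₀ < r) (hp : p i₀ < r)
    (hmin : ∀ i < r, p i < r → rowVal m r A i₀ (p i₀) ≤ rowVal m r A i (p i)) :
    MergeInv m r A (j + 1) (Function.update p i₀ (p i₀ + 1))
      (Function.update out j (rowVal m r A i₀ (p i₀))) := by
  have hrow : ∀ i < r, ∀ q q', q ≤ q' → q' < r → rowVal m r A i q ≤ rowVal m r A i q' :=
    fun i hi q q' hqq' hq' => by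
      have h1 := hmono (r - q' - 1) (r - q - 1) (by omega) (by omega)
      have h2 := hm (r - q' - 1) (by omega)
      have h3 := hm i hi
      unfold rowVal
      gcongr
  have hnew : ∀ i < r, ∀ q < r, p i ≤ q → rowVal m r A i₀ (p i₀) ≤ rowVal m r A i q :=
    fun i hi q hq hpq => (hmin i hi (hpq.trans_lt hq)).trans (hrow i hi _ _ hpq hq)
  have hple : ∀ i, p i ≤ Function.update p i₀ (p i₀ + 1) i := fun i => by
    by_cases hi : i = i₀
    · subst hi; simp
    · simp [hi]
  refine ⟨fun i hi => ?_, ?_, fun a b hab hb => ?_, fun a ha i hi q hq hpq => ?_,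
    fun i hi q hq => ?_, fun a ha => ?_⟩
  · by_cases h' : i = i₀
    · subst h'; simpa
    · simpa [h'] using h.le i hi
  · rw [sum_update_succ (Finset.mem_range.2 hi₀), h.sum]
  · rcases (Nat.lt_succ_iff.1 hb).eq_or_lt with rfl | hb
    · rw [Function.update_self]
      rcases hab.eq_or_lt with rfl | hab
      · rw [Function.update_self]
      · rw [Function.update_of_ne hab.ne]
        exact h.low a hab i₀ hi₀ _ hp le_rfl
    · rw [Function.update_of_ne hb.ne, Function.update_of_ne (hab.trans_lt hb).ne]
      exact h.mono a b hab hb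
  · rcases (Nat.lt_succ_iff.1 ha).eq_or_lt with rfl | ha
    · rw [Function.update_self]; exact hnew i hi q hq ((hple i).trans hpq)
    · rw [Function.update_of_ne ha.ne]; exact h.low a ha i hi q hq ((hple i).trans hpq)
  · by_cases h' : i = i₀ ∧ q = p i₀
    · exact ⟨j, Nat.lt_succ_self j, by rw [Function.update_self, h'.1, h'.2]⟩
    · have : q < p i := by
        by_cases hi' : i = i₀
        · subst hi'; rw [Function.update_self] at hq; simp at h'; omega
        · rwa [Function.update_of_ne hi'] at hq
      obtain ⟨a, ha, hout⟩ := h.cover i hi q this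
      exact ⟨a, by omega, by rw [Function.update_of_ne ha.ne, hout]⟩
  · rcases (Nat.lt_succ_iff.1 ha).eq_or_lt with rfl | ha
    · rw [Function.update_self]
      exact mul_pos (div_pos (hm _ hi₀) (hm _ (by omega))) hA
    · rw [Function.update_of_ne ha.ne]; exact h.pos a ha

/-- Write the candidates `n ^ 7 * m i / m j` to real array `7` in increasing order, where
`m 0, m 1, …` are the `w 7` scales in real array `2`. -/
def merge : Prog :=
  (wmov 20 7 ;; wmul 21 20 20 ;; rofw 5 0 ;; rmul 6 5 5 ;; rmul 7 6 6 ;; rmul 6 6 7 ;; rmul 5 5 6) ;;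
  forLoop 22 21 (scanRows ;; (rstore 7 22 11 ;; wload 12 6 19 ;; wadd 12 12 3 ;; wstore 6 19 12))

theorem runs_merge {s : State} {r : ℕ} (hB : WordBound n B) (hs : Std n s) (h7 : s.w 7 = r)
    (hr : r ≤ n) (hp : s.wa 6 = fun _ => 0) (hm : ∀ i < r, 0 < s.ra 2 i)
    (hmono : ∀ a b, a ≤ b → b < r → s.ra 2 a ≤ s.ra 2 b) :
    Runs B merge s (35 * (n * n * n)) fun s' => s'.w 21 = r * r ∧
      (∀ a b, a ≤ b → b < r * r → s'.ra 7 a ≤ s'.ra 7 b) ∧ (∀ a < r * r, 0 < s'.ra 7 a) ∧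
      ∀ i < r, ∀ j < r, ∃ a < r * r, s'.ra 7 a = s.ra 2 i / s.ra 2 j * (n : ℝ) ^ 7 := by
  have hn := hB.1
  have hB' := hB.2
  have hnnn : n * n ≤ n * n * n := Nat.le_mul_of_pos_right _ hn
  have h1nn : 1 ≤ n * n := Nat.mul_pos hn hn
  have hrr : r * r ≤ n * n := Nat.mul_le_mul hr hr
  -- There are r² extractions, each by a linear scan of r heads. This is within the cubic budget, so
  -- no priority queue is needed.
  have hT : r * r * (15 * r + 7 + 2) ≤ n * n * (24 * n) := Nat.mul_le_mul hrr (by omega)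
  have hT' : n * n * (24 * n) = 24 * (n * n * n) := by ring
  set A : ℝ := (n : ℝ) ^ 7 with hA
  have hA0 : 0 < A := by positivity
  have hpre : Runs B (wmov 20 7 ;; wmul 21 20 20 ;; rofw 5 0 ;; rmul 6 5 5 ;; rmul 7 6 6 ;;
      rmul 6 6 7 ;; rmul 5 5 6) s 7 fun s' => s'.w 20 = r ∧ s'.w 21 = r * r ∧ s'.r 5 = A := by
    refine Runs.of_wp ?_
    simp [h7, hs.w0, hA]
    exact ⟨by omega, by omega, by ring⟩
  refine Runs.mono (hpre.frame.seq (T' := r * r * (15 * r + 7 + 2) + 2) fun s1 h1 => ?_) (by omega)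
    fun _ => id
  obtain ⟨⟨h20, h21, h5⟩, hF1⟩ := h1
  have hs1 : Std n s1 := hs.of_frame hF1 ⟨rfl, rfl, rfl, rfl⟩
  have ha2 : s1.ra 2 = s.ra 2 := hF1.ra 2 rfl
  have ha6 : s1.wa 6 = fun _ => 0 := (hF1.wa 6 rfl).trans hp
  refine ((Runs.forLoop (m := r * r) (T := 15 * r + 7)
    (fun j s' => MergeInv (s.ra 2) r A j (s'.wa 6) (s'.ra 7)) h21 hs1.w3 (by omega) (by decide)
    (by decide) rfl rfl rfl ?_ ?_).frame).mono le_rfl ?_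
  · simp only [State.updW_wa, ha6]
    exact ⟨fun _ _ => Nat.zero_le _, by simp, fun _ _ _ h => absurd h (Nat.not_lt_zero _),
      fun _ h => absurd h (Nat.not_lt_zero _), fun _ _ _ h => absurd h (Nat.not_lt_zero _),
      fun _ h => absurd h (Nat.not_lt_zero _)⟩
  · intro j hj s2 hF hi hI
    have hs2 : Std n s2 := hs1.of_frame hF ⟨rfl, rfl, rfl, rfl⟩
    have h20' : s2.w 20 = r := (hF.w 20 rfl).trans h20
    have h5' : s2.r 5 = A := (hF.r 5 rfl).trans h5
    have ha2' : s2.ra 2 = s.ra 2 := (hF.ra 2 rfl).trans ha2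
    refine Runs.mono ((runs_scanRows hB hs2 h20' hr hI.le
      (by rw [ha2']; exact fun i hi => (hm i hi).ne')).frame.seq (T' := 4) fun s3 h3 => ?_)
      (by omega) fun _ => id
    obtain ⟨hpost, hF3⟩ := h3
    rw [ha2', h5'] at hpost
    have hwa : s3.wa 6 = s2.wa 6 := hF3.wa 6 rfl
    have hra : s3.ra 7 = s2.ra 7 := hF3.ra 7 rfl
    have h22 : s3.w 22 = j := (hF3.w 22 rfl).trans hi
    have h3' : s3.w 3 = 1 := (hF3.w 3 rfl).trans hs2.w3
    rcases hpost with hpost | ⟨-, h19, hlt, hr11, hmin⟩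
    -- If all rows were exhausted, then r² candidates would have been removed, but only j < r² have
    -- been.
    · exfalso
      have := Finset.card_nsmul_le_sum (Finset.range r) (s2.wa 6) r
        fun i hi => hpost.2 i (Finset.mem_range.1 hi)
      rw [Finset.card_range, smul_eq_mul, hI.sum] at this
      omega
    · rw [hr11] at hmin
      have hstep := hI.step hA0 hm hmono h19 hlt hmin
      refine (Runs.of_wp ?_).mono (Nat.le_of_ble_eq_true rfl) fun _ => id
      simp [hwa, hra, h22, h3', hr11]
      exact ⟨by omega, by omega, hstep⟩
  · rintro s' ⟨hI, hF⟩
    refine ⟨(hF.w 21 rfl).trans h21, hI.mono, hI.pos, fun i hi j hj => ?_⟩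
    have hfull : ∀ i < r, s'.wa 6 i = r := fun i hi => by
      by_contra hne
      have hlt := lt_of_le_of_ne (hI.le i hi) hne
      have := Finset.sum_lt_sum (s := Finset.range r) (f := s'.wa 6) (g := fun _ => r)
        (fun i hi => hI.le i (Finset.mem_range.1 hi)) ⟨i, Finset.mem_range.2 hi, hlt⟩
      rw [hI.sum] at this
      simp at this
    -- Denominators run backwards along a row, so scale j is the denominator in column r - j - 1.
    obtain ⟨a, ha, hout⟩ := hI.cover i hi (r - j - 1) (by rw [hfull i hi]; omega)
    refine ⟨a, ha, ?_⟩
    rw [hout, rowVal]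
    congr 3
    omega

/-! ## Padding the solution -/

/-- Add pairs to the solution until there are `w 1` of them. -/
def pad : Prog :=
  wconst 28 0 ;; forLoop 10 5 (wload 11 1 10 ;; wadd 28 28 11) ;;
  forLoop 10 5 (wload 11 1 10 ;;
    .ite (weq 11 4) (.ite (wlt 28 1) (wstore 1 10 3 ;; wadd 28 28 3) .skip) .skip)

theorem card_outputEdges {s : State} (h : ∀ c < n * n, s.wa 1 c ≤ 1) :
    (outputEdges n s).card = ∑ c ∈ Finset.range (n * n), s.wa 1 c := by
  rw [outputEdges, Finset.card_filter, Finset.sum_range, ← finProdFinEquiv.sum_comp]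
  refine Finset.sum_congr rfl fun e _ => ?_
  have h1 : ((finProdFinEquiv e : Fin (n * n)) : ℕ) = e.1 * n + e.2 := by
    simp [finProdFinEquiv]; ring
  have h2 := h _ (cell_lt e.1 e.2)
  rw [h1]
  split_ifs <;> omega

/-- During the second loop either k pairs have been reached or all cells seen so far are 1. At the
end the latter would mean n² ≥ k pairs, so k is reached in any case. -/
theorem runs_pad {s : State} {k : ℕ} (hB : WordBound n B) (hs : Std n s) (h1 : s.w 1 = k)
    (hk : k ≤ n * n) {S : Finset (Fin n × Fin n)} (hS : S.card ≤ k)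
    (hval : ∀ i j : Fin n, s.wa 1 (i * n + j) = if (i, j) ∈ S then 1 else 0) :
    Runs B pad s (13 * (n * n) + 5) fun s' => (outputEdges n s').card = k ∧
      S ⊆ outputEdges n s' := by
  obtain ⟨hn, hB⟩ := hB
  have hle : ∀ c < n * n, s.wa 1 c ≤ 1 := fun c hc => by
    obtain ⟨u, v, -, -, rfl⟩ := exists_cell hn hc
    rw [hval]; split_ifs <;> omega
  have hcard : ∑ c ∈ Finset.range (n * n), s.wa 1 c ≤ k := by
    rw [← card_outputEdges hle]
    refine le_trans (Finset.card_le_card fun e he => ?_) hS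
    have := (Finset.mem_filter.1 he).2
    rw [hval] at this
    by_contra hne
    exact this (if_neg hne)
  have h0 : Runs B (wconst 28 0 : Instr) s 1 fun s' => s' = s.updW 28 0 :=
    Runs.of_wp (by simp; omega)
  refine Runs.mono (h0.seq (T' := (n * n * (2 + 2) + 2) + (n * n * (5 + 2) + 2)) ?_) (by omega)
    fun _ => id
  rintro _ rfl
  have hs0 : Std n (s.updW 28 0) := ⟨hs.w0, hs.w3, hs.w4, hs.w5⟩
  refine (Runs.forLoop (fun j s' => s'.w 28 = ∑ c ∈ Finset.range j, s.wa 1 c)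
    hs0.w5 hs0.w3 (by omega) (by decide) (by decide) rfl rfl rfl (by simp) ?_).frame.seq ?_
  · intro j hj s1 hF hi hI
    have ha : s1.wa 1 = s.wa 1 := hF.wa 1 rfl
    have hj1 := hle j hj
    have hsum : ∑ c ∈ Finset.range j, s.wa 1 c ≤ k :=
      (Finset.sum_le_sum_of_subset (Finset.range_mono hj.le)).trans hcard
    refine (Runs.of_wp ?_).mono (Nat.le_of_ble_eq_true rfl) fun _ => id
    simp [hi, ha, hI, Finset.sum_range_succ]
    omega
  · rintro s1 ⟨h28, hF1⟩
    have hs1 : Std n s1 := hs0.of_frame hF1 ⟨rfl, rfl, rfl, rfl⟩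
    have ha1 : s1.wa 1 = s.wa 1 := hF1.wa 1 rfl
    have hw1 : s1.w 1 = k := (hF1.w 1 rfl).trans (by simpa)
    refine (Runs.forLoop (fun j s' => (∀ c < n * n, s'.wa 1 c ≤ 1) ∧
      (∀ c < n * n, s.wa 1 c ≠ 0 → s'.wa 1 c ≠ 0) ∧
      ∑ c ∈ Finset.range (n * n), s'.wa 1 c = s'.w 28 ∧ s'.w 28 ≤ k ∧
      (s'.w 28 = k ∨ ∀ c < j, s'.wa 1 c = 1))
      hs1.w5 hs1.w3 (by omega) (by decide) (by decide) rfl rfl rfl ?_ ?_).mono le_rfl ?_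
    · simp only [State.updW_wa, State.updW_w, ha1]
      exact ⟨hle, fun _ _ => id, by simpa using h28.symm, by simpa [h28] using hcard,
        Or.inr fun c hc => absurd hc (Nat.not_lt_zero _)⟩
    · rintro j hj s2 hF hi ⟨hle2, hsub, hsum, hk2, hfull⟩
      have hj1 := hle2 j hj
      have h3 : s2.w 3 = 1 := (hF.w 3 rfl).trans hs1.w3
      have h4 : s2.w 4 = 0 := (hF.w 4 rfl).trans hs1.w4
      have hw1' : s2.w 1 = k := (hF.w 1 rfl).trans hw1
      refine (Runs.of_wp ?_).mono (Nat.le_of_ble_eq_true rfl) fun _ => id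
      simp only [wp, Instr.Ok, Instr.eff, Test.Holds]
      simp [hi, h3, h4, hw1']
      refine ⟨by omega, fun hz => ⟨fun hlt => ⟨by omega, fun c hc => ?_, fun c hc hne => ?_, ?_,
        by omega, ?_⟩, fun hge => ⟨hle2, hsub, hsum, hk2, Or.inl (by omega)⟩⟩,
        fun hnz => ⟨hle2, hsub, hsum, hk2, ?_⟩⟩
      · rw [Function.update_apply]; split_ifs <;> [exact le_rfl; exact hle2 c hc]
      · rw [Function.update_apply]; split_ifs <;> [exact not_false; exact hsub c hc hne]
      · have := sum_update_succ (p := s2.wa 1) (Finset.mem_range.2 hj)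
        rw [hz] at this
        rw [← hsum]
        exact this
      · refine Or.inr (forall_le_of (fun c hc => ?_) (by simp))
        rw [Function.update_of_ne hc.ne]
        rcases hfull with h | h
        · omega
        · exact h c hc
      · exact hfull.imp id fun h => forall_le_of h (by omega)
    · rintro s' ⟨hle', hsub, hsum, hk', hfull⟩
      have h28' : s'.w 28 = k := by
        rcases hfull with h | h
        · exact h
        · rw [Finset.sum_congr rfl fun c hc => h c (Finset.mem_range.1 hc)] at hsum
          simp at hsum
          omega
      refine ⟨by rw [card_outputEdges hle', hsum, h28'], fun e he => ?_⟩
      refine Finset.mem_filter.2 ⟨Finset.mem_univ _, hsub _ (cell_lt e.1 e.2) ?_⟩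
      rw [hval, if_pos he]
      exact one_ne_zero

/-! ## The approximation algorithm -/

/-- Search for the least threshold for which at most `w 1` pairs are added. -/
def search (q : ℕ) : Prog := wmov 6 1 ;; merge ;; binarySearch ;; descend q

/-- By Bernoulli's inequality (1 + 1/q)^q ≥ 2, so q steps halve the threshold, qL steps divide it by
more than n, and 12qL steps make up for the factor n¹² lost by the candidates. -/
theorem pow_le_inv_pow {q L : ℕ} (hq : 0 < q) (hL : n < 2 ^ L) :
    (q / (q + 1) : ℝ) ^ (12 * q * L) * (n : ℝ) ^ 12 ≤ 1 := by
  have hq' : (0 : ℝ) < q := by exact_mod_cast hq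
  have h1 : (q / (q + 1) : ℝ) ^ q ≤ 1 / 2 := by
    have h0 : (-2 : ℝ) ≤ 1 / q := le_trans (by norm_num) (one_div_pos.2 hq').le
    have hb := one_add_mul_le_pow h0 q
    rw [mul_one_div_cancel hq'.ne'] at hb
    have h2 : (q / (q + 1) : ℝ) = (1 + 1 / (q : ℝ))⁻¹ := by field_simp
    rw [h2, inv_pow, one_div (2 : ℝ)]
    exact inv_anti₀ (by norm_num) (by linarith)
  have h2 : (1 / 2 : ℝ) ^ L * n ≤ 1 := by
    have : (n : ℝ) ≤ 2 ^ L := by exact_mod_cast hL.le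
    calc (1 / 2 : ℝ) ^ L * n ≤ (1 / 2) ^ L * 2 ^ L := by gcongr
      _ = 1 := by rw [← mul_pow]; norm_num
  calc (q / (q + 1) : ℝ) ^ (12 * q * L) * (n : ℝ) ^ 12
      = (((q / (q + 1) : ℝ) ^ q) ^ L * n) ^ 12 := by rw [mul_pow, ← pow_mul, ← pow_mul]; ring_nf
    _ ≤ ((1 / 2 : ℝ) ^ L * n) ^ 12 := by gcongr
    _ ≤ 1 := pow_le_one₀ (by positivity) h2

/-- A finite minimum dilation is approximated by one of the candidates, and larger candidates do
not fail. -/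
theorem exists_candidate (hx : Function.Injective x) (hn2 : 2 ≤ n) {e : ℕ → Fin n × Fin n} {m k : ℕ}
    (hseq : IsGreedySeq x ⊥ n e m)
    (hsp : IsSpanner x (addEdges ⊥ (firstPairs e m)) (ENNReal.ofReal n)) (hkn : k < n) {N : ℕ}
    {out : ℕ → ℝ} (hmono : ∀ a b, a ≤ b → b < N → out a ≤ out b)
    (hout : ∀ i < m, ∀ j < m, ∃ a < N, out a =
      dist (x (e i).1) (x (e i).2) / dist (x (e j).1) (x (e j).2) * (n : ℝ) ^ 7) {t : ℝ}
    (ht : minDilation x G k = ENNReal.ofReal t) (ht1 : 1 ≤ t) :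
    ∃ a < N, out a ≤ (n : ℝ) ^ 12 * t ∧ ∀ b < N, a ≤ b → ¬ Fails x G k (out b) := by
  have hcard : (Fintype.card (Fin n) : ℝ) = n := by simp
  obtain ⟨i, hi, j, hj, h1, h2⟩ := IsGreedySeq.exists_ratio (G := G) (k := k) hx
    (by rwa [hcard]) (by rwa [hcard]) (by simpa) ht ht1
  rw [hcard] at h1 h2
  obtain ⟨a, ha, hval⟩ := hout i hi j hj
  set y := dist (x (e i).1) (x (e i).2) / dist (x (e j).1) (x (e j).2)
  have hn : (2 : ℝ) ≤ n := by exact_mod_cast hn2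
  refine ⟨a, ha, ?_, fun b hb hab ⟨e', he'⟩ => ?_⟩
  · rw [hval]
    calc y * (n : ℝ) ^ 7 ≤ (n ^ 5 * t) * (n : ℝ) ^ 7 := by gcongr
      _ = n ^ 12 * t := by ring
  -- Failure would give out b ≤ (k + 1)t ≤ nt. The factor n⁷ exceeds the loss n⁵ in the quotient by
  -- n², so every candidate from a on is at least n²t.
  · have h3 := he'.le_minDilation hx
    rw [ht, ← ENNReal.ofReal_natCast, ← ENNReal.ofReal_mul (by positivity),
      ENNReal.ofReal_le_ofReal_iff (by positivity)] at h3
    have h4 := hmono a b hab hb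
    have h5 : (n : ℝ) ^ 2 * t ≤ out a := by
      rw [hval]
      calc (n : ℝ) ^ 2 * t ≤ n ^ 2 * (n ^ 5 * y) := by gcongr
        _ = y * n ^ 7 := by ring
    have h6 : ((k + 1 : ℕ) : ℝ) ≤ n := by exact_mod_cast hkn
    have h7 : ((k + 1 : ℕ) : ℝ) * t ≤ n * t := by gcongr
    have h8 : (n : ℝ) ^ 2 * t ≤ n * t := by linarith
    have h9 : 0 < (n : ℝ) * t := by positivity
    nlinarith

/-- The result of the search for the threshold. -/
def Optimized (x : Fin n → M) (G : SimpleGraph (Fin n)) (k : ℕ) (ρ : ℝ) (s : State) : Prop :=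
  Stored x G k s ∧ ((s.w 2 = 0 ∧ minDilation x G k = ⊤) ∨ (s.w 2 = 1 ∧ Fails x G k (s.r 0 * ρ)))

theorem runs_search {s : State} {k q L m : ℕ} {e : ℕ → Fin n × Fin n} (hB : WordBound n B)
    (hx : Function.Injective x) (hn2 : 2 ≤ n) (hs : Ready x G B n s) (hkn : k < n)
    (hw1 : s.w 1 = k) (hm : m ≤ n) (hf : Found x ⊥ n e m s)
    (hsp : IsSpanner x (addEdges ⊥ (firstPairs e m)) (ENNReal.ofReal n))
    (h6 : s.wa 6 = fun _ => 0) (hwa1 : s.wa 1 = fun _ => 0) (hw2 : s.w 2 = 0) (hq : 0 < q)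
    (hL : n < 2 ^ L) :
    Runs B (search q) s ((36 + 260 * (2 * L + (12 * q * L + 1))) * (n * n * n) + 8)
      (Optimized x G k (q / (q + 1))) := by
  have hn := hB.1
  have hB' := hB.2
  have hnnn : n * n ≤ n * n * n := Nat.le_mul_of_pos_right _ hn
  have h1nn : 1 ≤ n * n := Nat.mul_pos hn hn
  have hmov : Runs B (wmov 6 1 : Instr) s 1 fun s' => s' = s.updW 6 k :=
    Runs.of_wp (by simp [hw1]; omega)
  refine Runs.mono (hmov.seq (T' := 35 * (n * n * n) + ((2 * L * (260 * (n * n * n)) + 3) +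
    ((12 * q * L + 1) * (260 * (n * n * n)) + 5))) ?_) ?_ fun _ => id
  swap
  · have : (36 + 260 * (2 * L + (12 * q * L + 1))) * (n * n * n) + 8 =
      36 * (n * n * n) + (2 * L * (260 * (n * n * n)) + (12 * q * L + 1) * (260 * (n * n * n))) + 8 := by
      ring
    omega
  rintro _ rfl
  have hs1 : Ready x G B k (s.updW 6 k) := ⟨⟨⟨hs.dist.std.w0, hs.dist.std.w3, hs.dist.std.w4,
    hs.dist.std.w5⟩, hs.dist.dist, hs.dist.bound⟩, ⟨hs.graph.lt, hs.graph.adj⟩, by simp⟩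
  have hlen : ∀ i < m, (s.updW 6 k).ra 2 i = dist (x (e i).1) (x (e i).2) := hf.len
  refine (runs_merge hB hs1.dist.std (r := m) (by simpa using hf.count) hm h6 (fun i hi => ?_)
    fun a b hab hb => ?_).frame.seq fun s2 h2 => ?_
  · rw [hlen i hi]; exact dist_pos.2 (hx.ne (hf.seq.ne hi))
  · rw [hlen a (hab.trans_lt hb), hlen b hb]; exact hf.seq.monotone hab hb
  obtain ⟨⟨h21, hmono, hpos, hcov⟩, hF2⟩ := h2
  have hs2 : Ready x G B k s2 := hs1.of_frame hF2 ⟨rfl, rfl, rfl, rfl⟩ rfl rfl rfl rfl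
  have hw2' : s2.w 2 = 0 := (hF2.w 2 rfl).trans (by simpa)
  have hst2 : Stored x G k s2 := ⟨∅, by simp, fun i j => by
    rw [hF2.wa 1 rfl, State.updW_wa, hwa1]; simp, Or.inl hw2'⟩
  have hcov' : ∀ i < m, ∀ j < m, ∃ a < m * m, s2.ra 7 a =
      dist (x (e i).1) (x (e i).2) / dist (x (e j).1) (x (e j).2) * (n : ℝ) ^ 7 :=
    fun i hi j hj => by rw [← hlen i hi, ← hlen j hj]; exact hcov i hi j hj
  have hNL : m * m < 2 ^ (2 * L) := by
    rw [two_mul, pow_add]; exact Nat.mul_lt_mul'' (hm.trans_lt hL) (hm.trans_lt hL)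
  refine (runs_binarySearch hB hx hs2 hkn.le hn2 (Nat.mul_le_mul hm hm) h21
    (fun a ha => (hpos a ha).le) hst2 hw2' hNL).frame.seq fun s3 h3 => ?_
  obtain ⟨⟨hst3, h, hh, hlow, hcase⟩, hF3⟩ := h3
  have hs3 : Ready x G B k s3 := hs2.of_frame hF3 ⟨rfl, rfl, rfl, rfl⟩ rfl rfl rfl rfl
  have hcand := fun t => exists_candidate (G := G) (t := t) hx hn2 hf.seq hsp hkn hmono hcov'
  -- The candidate h - 1 has failed, so it precedes every index from which on nothing fails.
  have hle : ∀ a < m * m, (∀ b < m * m, a ≤ b → ¬ Fails x G k (s2.ra 7 b)) → h ≤ a :=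
    fun a ha hb => by
      by_contra! hlt
      rcases hlow with h0 | hfail
      · omega
      · exact hb (h - 1) (by omega) (by omega) hfail
  have hk2 : k ≤ Fintype.card (Fin n) ^ 2 := by
    rw [Fintype.card_fin, sq]; exact hkn.le.trans (Nat.le_mul_self n)
  have hminS : ∀ (S : Finset (Fin n × Fin n)) (τ : ℝ), S.card ≤ k → 1 ≤ τ →
      IsSpanner x (addEdges G S) (ENNReal.ofReal τ) → minDilation x G k ≤ ENNReal.ofReal τ :=
    fun S τ hS hτ hspan => hspan.minDilation_le hτ hS hk2
  have h1min := one_le_minDilation x G k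
  have hreal : minDilation x G k ≠ ⊤ → ∃ t : ℝ, 1 ≤ t ∧ minDilation x G k = ENNReal.ofReal t :=
    fun htop => ⟨(minDilation x G k).toReal,
      by rw [← ENNReal.toReal_one]; exact ENNReal.toReal_mono htop h1min,
      (ENNReal.ofReal_toReal htop).symm⟩
  rcases hcase with ⟨hN, h0⟩ | ⟨hN, h1, hr0⟩
  · have htop : minDilation x G k = ⊤ := by
      by_contra htop
      obtain ⟨t, ht1, ht⟩ := hreal htop
      obtain ⟨a, ha, -, hb⟩ := hcand t ht ht1
      have := hle a ha hb
      omega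
    refine (runs_descend hB hx hs3 hkn.le hn2 hq hst3 one_pos (fun _ _ _ h _ => h)
      (Nat.succ_pos (12 * q * L)) fun h1 => by omega).mono le_rfl fun s4 h4 => ?_
    exact ⟨h4.1, Or.inl ⟨h4.2.1.trans h0, htop⟩⟩
  · have htop : minDilation x G k ≠ ⊤ := by
      obtain ⟨S, hS, -, h0 | ⟨-, h1', hspan⟩⟩ := hst3
      · omega
      · exact ((hminS S _ hS h1' hspan).trans_lt ENNReal.ofReal_lt_top).ne
    obtain ⟨t, ht1, ht⟩ := hreal htop
    obtain ⟨a, ha, hat, hb⟩ := hcand t ht ht1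
    have hrt : s3.r 0 ≤ (n : ℝ) ^ 12 * t := by
      rw [hr0]; exact (hmono h a (hle a ha hb) ha).trans hat
    have hpow := pow_le_inv_pow (n := n) hq hL
    refine (runs_descend hB hx hs3 hkn.le hn2 hq hst3 (t := t) (by linarith)
      (fun S τ hS hτ hspan => ?_) (Nat.succ_pos (12 * q * L)) fun _ => ?_).mono le_rfl
      fun s4 h4 => ⟨h4.1, Or.inr ⟨h4.2.1.trans h1, h4.2.2 (h4.2.1.trans h1)⟩⟩
    · have := hminS S τ hS hτ hspan
      rwa [ht, ENNReal.ofReal_le_ofReal_iff (by linarith)] at this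
    · have hρ : (0 : ℝ) ≤ q / (q + 1) := by positivity
      rw [pow_succ, mul_comm t, mul_right_comm, mul_comm]
      refine mul_le_mul_of_nonneg_left ?_ hρ
      calc (q / (q + 1) : ℝ) ^ (12 * q * L) * s3.r 0
          ≤ (q / (q + 1) : ℝ) ^ (12 * q * L) * ((n : ℝ) ^ 12 * t) := by gcongr
        _ = (q / (q + 1) : ℝ) ^ (12 * q * L) * (n : ℝ) ^ 12 * t := by ring
        _ ≤ 1 * t := by gcongr
        _ = t := one_mul t

/-- Set up the constants, the sum of all distances, and the input of the first greedy run. -/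
def setup : Prog :=
  (wconst 3 1 ;; wmul 5 0 0) ;; forLoop 10 5 (rload 8 0 10 ;; radd 2 2 8) ;; (rofw 1 0 ;; wmov 6 0)

/-- The approximation algorithm with approximation factor `(1 + 1 / q) * (k + 1)`. -/
def algorithm (q : ℕ) : Prog :=
  setup ;; greedy 5 ;; .ite (wlt 1 0) (search q) attempt ;; pad

theorem matrixCells_cell {α : Type*} [Zero α] (f : Fin n → Fin n → α) (i j : Fin n) :
    matrixCells n f (i * n + j) = f i j := by
  rw [matrixCells, dif_pos (cell_lt i j)]
  congr 1 <;> apply Fin.ext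
  · exact cell_div i j
  · exact cell_mod i j

theorem runs_setup {k : ℕ} (hB : WordBound n B) :
    Runs B setup (inputState x G k) (4 * (n * n) + 6) fun s => Ready x G B n s ∧ s.r 1 = n ∧
      Frame setup.writes (inputState x G k) s := by
  classical
  have hn := hB.1
  have hB' := hB.2
  set s := inputState x G k with hsdef
  have h0 : s.w 0 = n := by simp [hsdef, inputState]
  have h4 : s.w 4 = 0 := by simp [hsdef, inputState]
  have hr2 : s.r 2 = 0 := by simp [hsdef, inputState]
  have hra : ∀ i j : Fin n, s.ra 0 (i * n + j) = dist (x i) (x j) := fun i j => by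
    simp only [hsdef, inputState, if_true, matrixCells_cell]
  have hwa : ∀ i j : Fin n, s.wa 0 (i * n + j) = if G.Adj i j then 1 else 0 := fun i j => by
    simp only [hsdef, inputState, if_true, matrixCells_cell]
  have hwaB : ∀ c, s.wa 0 c < B := fun c => by
    simp only [hsdef, inputState, if_true, matrixCells]
    split_ifs <;> omega
  have hpre : Runs B (wconst 3 1 ;; wmul 5 0 0) s 2 fun s' => s' = (s.updW 3 1).updW 5 (n * n) :=
    Runs.of_wp (by simp [h0]; omega)
  suffices hmain : Runs B setup s (4 * (n * n) + 6) fun s' => Ready x G B n s' ∧ s'.r 1 = n from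
    hmain.frame.mono le_rfl fun s' h => ⟨h.1.1, h.1.2, h.2⟩
  refine Runs.mono (hpre.seq (T' := (n * n * (2 + 2) + 2) + 2) ?_) (by omega) fun _ => id
  rintro _ rfl
  have hs1 : Std n ((s.updW 3 1).updW 5 (n * n)) := ⟨by simp [h0], by simp, by simp [h4], by simp⟩
  refine (Runs.forLoop (fun j s' => 0 ≤ s'.r 2 ∧ ∀ c < j, s.ra 0 c ≤ s'.r 2)
    hs1.w5 hs1.w3 (by omega) (by decide) (by decide) rfl rfl rfl (by simp [hr2]) ?_).frame.seq ?_
  · intro j hj s2 hF hi hI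
    have ha : s2.ra 0 = s.ra 0 := hF.ra 0 rfl
    obtain ⟨u, v, -, -, rfl⟩ := exists_cell hn hj
    have hd : 0 ≤ s.ra 0 (u * n + v) := by rw [hra]; exact dist_nonneg
    refine (Runs.of_wp ?_).mono (Nat.le_of_ble_eq_true rfl) fun _ => id
    simp [hi, ha]
    exact ⟨add_nonneg hI.1 hd, forall_le_of (fun c hc => by linarith [hI.2 c hc]) (by linarith)⟩
  · rintro s2 ⟨⟨-, hbound⟩, hF⟩
    have hs2 : Std n s2 := hs1.of_frame hF ⟨rfl, rfl, rfl, rfl⟩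
    have ha : s2.ra 0 = s.ra 0 := hF.ra 0 rfl
    have hw : s2.wa 0 = s.wa 0 := hF.wa 0 rfl
    have hpost : Runs B (rofw 1 0 ;; wmov 6 0) s2 2 fun s' => s' = (s2.setR 1 n).updW 6 n :=
      Runs.of_wp (by simp [hs2.w0]; omega)
    refine hpost.mono le_rfl ?_
    rintro _ rfl
    refine ⟨⟨⟨⟨by simp [hs2.w0], by simp [hs2.w3], by simp [hs2.w4], by simp [hs2.w5]⟩, ?_, ?_⟩,
      ⟨?_, ?_⟩, by simp⟩, by simp⟩
    · funext i j
      simp only [State.updW_ra, State.setR_ra, toMat, ha, hra]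
    · intro i j
      have := hbound _ (cell_lt i j)
      rw [hra] at this
      simpa using this
    · simpa [hw] using hwaB
    · intro i j
      simp [hw, hwa]

theorem runs_algorithm {k q L : ℕ} (hB : WordBound n B) (hx : Function.Injective x)
    (hk : k ≤ n * n) (hk1 : 1 ≤ k) (hq : 0 < q) (hL : n < 2 ^ L) (hL1 : 1 ≤ L) :
    Runs B (algorithm q) (inputState x G k) ((4000 + 4000 * q) * (n * n * n * L)) fun s =>
      (outputEdges n s).card = k ∧
      dilation x (addEdges G (outputEdges n s)) ≤ outputValue s ∧
      outputValue s ≤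
        ENNReal.ofReal ((1 + 1 / q) * ((k : ℝ) + 1)) * minDilation x G k := by
  have hn := hB.1
  have hB' := hB.2
  have hnnn : n * n ≤ n * n * n := Nat.le_mul_of_pos_right _ hn
  have h1nn : 1 ≤ n * n := Nat.mul_pos hn hn
  have hnL : n * n * n ≤ n * n * n * L := Nat.le_mul_of_pos_right _ hL1
  have hq' : (0 : ℝ) < q := by exact_mod_cast hq
  set Ts := (36 + 260 * (2 * L + (12 * q * L + 1))) * (n * n * n) + 8 with hTs
  have hTs' : Ts = 296 * (n * n * n) + 520 * (n * n * n * L) + 3120 * (q * (n * n * n * L)) + 8 := by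
    rw [hTs]; ring
  have hTot : (4000 + 4000 * q) * (n * n * n * L) =
      4000 * (n * n * n * L) + 4000 * (q * (n * n * n * L)) := by ring
  refine Runs.mono ((runs_setup hB).seq (T' := 240 * (n * n * n) + ((Ts + 250 * (n * n * n) + 1) +
    (13 * (n * n) + 5))) fun s1 h1 => ?_) (by omega) fun _ => id
  obtain ⟨hs1, hr1, hF1⟩ := h1
  -- Word array 5 is still all zero and serves as the adjacency matrix of the empty graph.
  have hempty : HasGraph B 5 (⊥ : SimpleGraph (Fin n)) s1 := by
    have : s1.wa 5 = fun _ => 0 := (hF1.wa 5 rfl).trans (by simp [inputState])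
    exact ⟨by simp [this]; omega, by simp [this]⟩
  refine (runs_greedy hB hs1.dist (by decide) hempty (by rw [hr1]; positivity)
    hs1.w6.le).frame.seq fun s2 h2 => ?_
  obtain ⟨⟨e, m, hm, hf, hout⟩, hF2⟩ := h2
  rw [hs1.w6] at hm hout
  rw [hr1] at hf hout
  have hnofail : ∀ {H : SimpleGraph (Fin n)} {e' : ℕ → Fin n × Fin n},
      ¬ IsGreedySeq x H n e' (n + 1) := fun he' => by
    have := he'.length_le (by simp)
    simp at this
  have hsp : IsSpanner x (addEdges ⊥ (firstPairs e m)) (ENNReal.ofReal n) := by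
    rcases hout with h | ⟨-, e', he'⟩
    · exact h.2
    · exact absurd he' hnofail
  have hs2 : Ready x G B n s2 := hs1.of_frame hF2 ⟨rfl, rfl, rfl, rfl⟩ rfl rfl rfl rfl
  have hw1 : s2.w 1 = k := by rw [hF2.w 1 rfl, hF1.w 1 rfl]; simp [inputState]
  have hw2 : s2.w 2 = 0 := by rw [hF2.w 2 rfl, hF1.w 2 rfl]; simp [inputState]
  have hwa1 : s2.wa 1 = fun _ => 0 := by rw [hF2.wa 1 rfl, hF1.wa 1 rfl]; simp [inputState]
  have hwa6 : s2.wa 6 = fun _ => 0 := by rw [hF2.wa 6 rfl, hF1.wa 6 rfl]; simp [inputState]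
  have hr1' : s2.r 1 = n := (hF2.r 1 rfl).trans hr1
  have h1min := one_le_minDilation x G k
  have hsearch : Runs B (.ite (wlt 1 0) (search q) attempt) s2 (Ts + 250 * (n * n * n) + 1)
      fun s => Stored x G k s ∧ outputValue s ≤
        ENNReal.ofReal ((1 + 1 / q) * ((k : ℝ) + 1)) * minDilation x G k := by
    refine Runs.ite (fun hlt => ?_) fun hge => ?_
    · simp only [Test.Holds, hw1, hs2.dist.std.w0] at hlt
      refine (runs_search hB hx (by omega) hs2 hlt hw1 hm hf hsp hwa6 hwa1 hw2 hq hL).mono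
        (by omega) fun s h => ⟨h.1, ?_⟩
      rcases h.2 with ⟨h2, htop⟩ | ⟨h2, e', he'⟩
      · rw [htop, ENNReal.mul_top]
        · exact le_top
        · rw [ne_eq, ENNReal.ofReal_eq_zero, not_le]; positivity
      · have hle := he'.le_minDilation hx
        rw [outputValue, if_neg (by omega)]
        calc ENNReal.ofReal (s.r 0)
            = ENNReal.ofReal (1 + 1 / q) * ENNReal.ofReal (s.r 0 * (q / (q + 1))) := by
              rw [← ENNReal.ofReal_mul (by positivity)]
              congr 1
              field_simp
          _ ≤ ENNReal.ofReal (1 + 1 / q) * (((k + 1 : ℕ) : ℝ≥0∞) * minDilation x G k) := by gcongr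
          _ = ENNReal.ofReal ((1 + 1 / q) * ((k : ℝ) + 1)) * minDilation x G k := by
              rw [ENNReal.ofReal_mul (by positivity), mul_assoc, ← ENNReal.ofReal_natCast,
                Nat.cast_add_one]
    -- For k ≥ n the threshold n succeeds with at most n ≤ k pairs, and n ≤ k + 1 ≤ (k + 1)t*.
    · simp only [Test.Holds, hw1, hs2.dist.std.w0, not_lt] at hge
      refine (runs_attempt hB hx hs2 le_rfl (by rw [hr1']; positivity)
        (Or.inr (by rw [hr1']; exact_mod_cast hn))).mono (by omega) fun s h => ?_
      rw [hr1'] at h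
      rcases h with ⟨-, h2, hr0, S, hS, hval, hsol⟩ | ⟨-, ⟨e', he'⟩, -⟩
      · refine ⟨⟨S, hS.trans hge, hval, hsol⟩, ?_⟩
        rw [outputValue, if_neg (by omega), hr0]
        calc ENNReal.ofReal n ≤ ENNReal.ofReal ((1 + 1 / q) * ((k : ℝ) + 1)) * 1 := by
              rw [mul_one]
              refine ENNReal.ofReal_le_ofReal ?_
              have h1 : (n : ℝ) ≤ k := by exact_mod_cast hge
              have h2 : 0 < 1 / (q : ℝ) := by positivity
              nlinarith
          _ ≤ _ := by gcongr
      · exact absurd he' hnofail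
  refine hsearch.frame.seq fun s3 h3 => ?_
  obtain ⟨⟨⟨S, hS, hval, hsol⟩, hopt⟩, hF3⟩ := h3
  have hs3 : Std n s3 := hs2.dist.std.of_frame hF3 ⟨rfl, rfl, rfl, rfl⟩
  have hw1' : s3.w 1 = k := (hF3.w 1 rfl).trans hw1
  refine (runs_pad hB hs3 hw1' hk hS hval).frame.mono le_rfl fun s4 h4 => ?_
  obtain ⟨⟨hcard, hsub⟩, hF4⟩ := h4
  have hw24 : s4.w 2 = s3.w 2 := hF4.w 2 rfl
  have hr04 : s4.r 0 = s3.r 0 := hF4.r 0 rfl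
  have hval4 : outputValue s4 = outputValue s3 := by rw [outputValue, outputValue, hw24, hr04]
  refine ⟨hcard, ?_, by rw [hval4]; exact hopt⟩
  rw [hval4, outputValue]
  rcases hsol with h0 | ⟨h1, hone, hspan⟩
  · rw [if_pos h0]; exact le_top
  · rw [if_neg (by omega)]
    exact dilation_le (hspan.mono (addEdges_mono G hsub)) hone

end RealRAM

/-! ### The theorem: choice of the parameter, the word size and the constant -/

theorem mainTheorem4 (ε : ℝ) (hε : 0 < ε) :
    ∃ (P : RealRAM.Prog) (c : ℕ) (C : ℝ),
      ∀ (n k : ℕ), 1 ≤ k → k ≤ n ^ 2 →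
      ∀ (M : Type*) [MetricSpace M] (x : Fin n → M), Function.Injective x →
      ∀ G : SimpleGraph (Fin n),
        ∃ (T : ℕ) (s : RealRAM.State),
          RealRAM.Exec ((n + 2) ^ c) P (RealRAM.inputState x G k) T s ∧
          (2 ≤ n → (T : ℝ) ≤ C * ((n : ℝ) ^ 3 * Real.log n)) ∧
          (RealRAM.outputEdges n s).card = k ∧
          MetricGraph.dilation x (MetricGraph.addEdges G (RealRAM.outputEdges n s)) ≤
            RealRAM.outputValue s ∧
          MetricGraph.minDilation x G k ≤ RealRAM.outputValue s ∧
          RealRAM.outputValue s ≤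
            ENNReal.ofReal ((1 + ε) * ((k : ℝ) + 1)) * MetricGraph.minDilation x G k := by
  obtain ⟨q, hq⟩ := exists_nat_one_div_lt hε
  refine ⟨RealRAM.algorithm (q + 1), 3, 4 * (4000 + 4000 * (q + 1)), ?_⟩
  intro n k hk1 hk M _ x hx G
  have hn : 0 < n := by
    rcases Nat.eq_zero_or_pos n with rfl | h
    · simp at hk; omega
    · exact h
  have hB : RealRAM.WordBound n ((n + 2) ^ 3) := ⟨hn, by nlinarith⟩
  obtain ⟨T, hT, s, hexec, hcard, hdil, hval⟩ := RealRAM.runs_algorithm (G := G) (q := q + 1)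
    (L := Nat.log 2 n + 1) hB hx (by rwa [← sq]) hk1 q.succ_pos
    (Nat.lt_pow_succ_log_self one_lt_two n) (Nat.le_add_left 1 _)
  refine ⟨T, s, hexec, fun hn2 => ?_, hcard, hdil,
    (MetricGraph.minDilation_le x G hcard).trans hdil, hval.trans ?_⟩
  · have hn2' : (2 : ℝ) ≤ n := by exact_mod_cast hn2
    have hlog2 : Real.log 2 ≤ Real.log n := Real.log_le_log two_pos hn2'
    have hlog : (Nat.log 2 n : ℝ) * Real.log 2 ≤ Real.log n := by
      rw [← Real.log_pow]
      exact Real.log_le_log (by positivity) (by exact_mod_cast Nat.pow_log_le_self 2 hn.ne')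
    -- For n ≥ 2 the left side is at most 2 log n / log 2, and 2 / log 2 < 4.
    have hL : (Nat.log 2 n : ℝ) + 1 ≤ 4 * Real.log n := by
      have := Real.log_two_gt_d9
      nlinarith
    calc (T : ℝ) ≤ (((4000 + 4000 * (q + 1)) * (n * n * n * (Nat.log 2 n + 1)) : ℕ) : ℝ) := by
          exact_mod_cast hT
      _ = (4000 + 4000 * (q + 1)) * ((n : ℝ) ^ 3 * ((Nat.log 2 n : ℝ) + 1)) := by push_cast; ring
      _ ≤ (4000 + 4000 * (q + 1)) * ((n : ℝ) ^ 3 * (4 * Real.log n)) := by gcongr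
      _ = 4 * (4000 + 4000 * (q + 1)) * ((n : ℝ) ^ 3 * Real.log n) := by ring
  · gcongr
    push_cast
    exact hq.le
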